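/- Let $(X_k)_{k\ge 1}$ be independent real random variables on a probability space with $\mathbb E[X_k]=0$ and $\mathrm{Var}(X_k)=1$. Suppose each $X_k$ has a density $p_k$ whose support $\{p_k>0\}$ is an interval, with $p_k$ differentiable in the interior of this interval. Let $$\tau_k(x)=\frac{1}{p_k(x)}\int_x^\infty y\,p_k(y)\,dy\qquad (p_k(x)>0)$$ be the Stein kernel of $X_k$. Assume that (i) $\beta:=\max\{\sup_{k\ge1}\mathbb E|X_k|^8,\ \sup_{k\ge1}\mathbb E|\tau_k(X_k)|^8,\ \sup_{k\ge1}\mathbb E|\tau_k'(X_k)|^8\}<\infty$; (ii) there is $\tau_0>0$ such that $\tau_k(X_k)\ge\tau_0$ almost surely for all $k\ge 1$; (iii) $\mathbb E|X_1^2+\dots+X_{n_0}^2|^{-8}<\infty$ for some $n_0\ge 1$. Then $\gamma:=\sup_{n\ge n_0}n^8\,\mathbb E|X_1^2+\dots+X_n^2|^{-8}<\infty$. Moreover, let $n\ge n_0$, let $A_n=(a_{uv})_{u,v=1}^n$ be a real symmetric matrix with vanishing diagonal such that $A_n^TA_n$ is positive definite, let $\lambda_{\min}^{(n)}$ be the smallest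 eigenvalue of $A_n^TA_n$, and put $$F_n=\sum_{1\le u\le v\le n}a_{uv}X_uX_v,\qquad \sigma_n^2=\mathrm{Var}(F_n),\ \sigma_n>0.$$ Then $\sigma_n^{-1}F_n$ has an absolutely continuous density, and for $Z\sim N(0,1)$ $$I(\sigma_n^{-1}F_n\|Z)\le\frac{C_{\beta,\tau_0,\gamma}}{\sigma_n^4}\left(\sum_{k=1}^n\Big(\sum_{v=1}^na_{kv}^2\Big)^2+\sum_{u,v=1}^n\Big(\sum_{k=1}^na_{ku}a_{kv}\Big)^2\right)\big(\sigma_n^{-2}\lambda_{\min}^{(n)}n\big)^{-3},$$ where $C_{\beta,\tau_0,\gamma}>0$ depends only on $\beta,\tau_0,\gamma$. Here, for a random variable $F$ of mean $0$ and variance $1$ with an absolutely continuous density $p_F$, $I(F\|Z)=\mathbb E\big[(\rho_F(F)+F)^2\big]$ with the score function $\rho_F=p_F'/p_F$. -/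

import Mathlib

open MeasureTheory ProbabilityTheory
open scoped ENNReal

noncomputable section

/-- `p` is a density of the random variable `Y` whose support `{p > 0}` is an interval, and `p` is
differentiable inside that interval. (At an endpoint of the support `p` may jump, as for the
uniform and exponential distributions.) -/
structure IsDiffIntervalDensity {Ω : Type*} [MeasurableSpace Ω] (P : Measure Ω)
    (Y : Ω → ℝ) (p : ℝ → ℝ) : Prop where
  nonneg : ∀ x, 0 ≤ p x
  map_eq : P.map Y = (volume : Measure ℝ).withDensity (fun x => ENNReal.ofReal (p x))
  ordConnected : (Function.support p).OrdConnected
  differentiableOn : DifferentiableOn ℝ p (interior (Function.support p))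

/-- The Stein kernel of a distribution on `ℝ` with density `p`:
`τ(x) = (∫_x^∞ (y - m) p(y) dy) / p(x)`, where `m` is the mean. It is meaningful on the support
of `p`, and it is only ever evaluated at a random variable with density `p`. -/
def steinKernel (p : ℝ → ℝ) (x : ℝ) : ℝ :=
  (∫ y in Set.Ioi x, (y - ∫ z, z * p z) * p y) / p x

/-- `p` is an absolutely continuous density of the random variable `F`. -/
structure IsAbsContDensity {Ω : Type*} [MeasurableSpace Ω] (P : Measure Ω)
    (F : Ω → ℝ) (p : ℝ → ℝ) : Prop where
  nonneg : ∀ x, 0 ≤ p x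
  map_eq : P.map F = (volume : Measure ℝ).withDensity (fun x => ENNReal.ofReal (p x))
  absCont : ∀ a b : ℝ, AbsolutelyContinuousOnInterval p a b

/-- The Fisher information distance of a random variable `F` to the normal distribution with
mean `m` and variance `v`: `E[(ρ_F(F) + (F - m) / v)²]` with the score function `ρ_F = p_F' / p_F`,
where `p_F` is the absolutely continuous density of `F`. An absolutely continuous density is unique
if it exists, so the infimum has only one term; if there is none, the value is `∞`. -/
def fisherDistance {Ω : Type*} [MeasurableSpace Ω] (P : Measure Ω) (F : Ω → ℝ) (m v : ℝ) :
    ℝ≥0∞ :=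
  ⨅ (p : ℝ → ℝ) (_ : IsAbsContDensity P F p),
    ∫⁻ ω, ENNReal.ofReal ((deriv p (F ω) / p (F ω) + (F ω - m) / v) ^ 2) ∂P

/-- The quadratic form `∑_{u ≤ v} a_{uv} X_u X_v` in the first `n` variables of a sequence. -/
def quadForm {Ω : Type*} {n : ℕ} (A : Matrix (Fin n) (Fin n) ℝ) (X : ℕ → Ω → ℝ) (ω : Ω) : ℝ :=
  ∑ u : Fin n, ∑ v ∈ Finset.Ici u, A u v * X u ω * X v ω

/-- `max {sup_k E|X_k|⁸, sup_k E|τ_k(X_k)|⁸, sup_k E|τ_k'(X_k)|⁸}`, where `τ_k` is the Stein kernel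
of the density `p_k`. -/
def eighthMomentSup {Ω : Type*} [MeasurableSpace Ω] (P : Measure Ω) (X : ℕ → Ω → ℝ)
    (p : ℕ → ℝ → ℝ) : ℝ≥0∞ :=
  max (⨆ k, ∫⁻ ω, ‖X k ω‖ₑ ^ 8 ∂P)
    (max (⨆ k, ∫⁻ ω, ‖steinKernel (p k) (X k ω)‖ₑ ^ 8 ∂P)
      (⨆ k, ∫⁻ ω, ‖deriv (steinKernel (p k)) (X k ω)‖ₑ ^ 8 ∂P))

/-- The negative moment `E|S|⁻⁸` of the sum `S` of the squares of the first `n` variables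
(the integrand is `∞` where `S = 0`). -/
def negMomentSumSq {Ω : Type*} [MeasurableSpace Ω] (P : Measure Ω) (X : ℕ → Ω → ℝ) (n : ℕ) :
    ℝ≥0∞ :=
  ∫⁻ ω, (ENNReal.ofReal (∑ i ∈ Finset.range n, X i ω ^ 2))⁻¹ ^ 8 ∂P

/-- `sup_{n ≥ n₀} n⁸ E|S_n|⁻⁸`, where `S_n` is the sum of the squares of the first `n` variables. -/
def negMomentSup {Ω : Type*} [MeasurableSpace Ω] (P : Measure Ω) (X : ℕ → Ω → ℝ) (n₀ : ℕ) :
    ℝ≥0∞ :=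
  ⨆ (n : ℕ) (_ : n₀ ≤ n), (n : ℝ≥0∞) ^ 8 * negMomentSumSq P X n

end

/-! ### A graded calculus of moment bounds -/

/-! Let F be the quadratic form, L_k = ∂_k F its rows and Γ = ∑ τ_k L_k² its carré du champ. Stein's
identity E[X_k Φ] = E[τ_k ∂_kΦ], applied to Φ = φ(F) L_k / Γ and summed over k, gives E[φ'(F)] =
E[φ(F) δ] with δ = 2F/Γ + S/Γ² and S = ∑ τ_k L_k ∂_kΓ (`SteinSequence.integral_deriv_halfForm`).
Such a formula is enough for a density: W = F/σ has an absolutely continuous density with score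
-E[σδ | W], so conditioning bounds the Fisher distance by E(W - σδ)²
(`fisherDistance_le_of_integral_deriv_eq`).

Since E Γ = 2σ², the error is W - σδ = σ⁻¹ F (Γ - 2σ²)/Γ - σ S/Γ², and S² ≤ Γ ∑ τ_j (∂_jΓ)² by
Cauchy–Schwarz. Three estimates remain. Γ is close to 2σ² in L⁴
(`SteinSequence.bound_carreDuChamp_sub`), and ∑ τ_j (∂_jΓ)² is small in L²
(`SteinSequence.bound_carreCarre`); both follow by expanding into centred linear, bilinear and
trilinear forms in independent variables and using a square function inequality
(`MomentBound.add_orthogonal`). Finally Γ ≥ τ₀ λ ∑ X_i², so Γ⁻¹ is of order 1/(λn) in L⁸ by the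
negative moments of sums of squares (`negMomentSup_lt_top`).

Two points make this work under the stated hypotheses. A Stein kernel bounded below forces the
density to be positive on all of ℝ, so there are no endpoints to treat. And F² (Γ - 2σ²)² Γ⁻² costs
2 + 4 + 2 = 8 units of weight in the Hölder bookkeeping of `MomentBound`, which is all that eighth
moments allow. -/

/-- `f` has `L^(8/j)` norm at most `c`. The weights `j` add up under multiplication. -/
structure MomentBound {Ω : Type*} [MeasurableSpace Ω] (P : Measure Ω) (j : ℕ) (f : Ω → ℝ)
    (c : ℝ) : Prop where
  aesm : AEStronglyMeasurable f P
  nonneg : 0 ≤ c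
  le : eLpNorm f (8 / (j : ℝ≥0∞)) P ≤ ENNReal.ofReal c

namespace MomentBound

variable {Ω : Type*} [MeasurableSpace Ω] {P : Measure Ω} {i j : ℕ} {f g : Ω → ℝ} {a b c : ℝ}

theorem mono (h : MomentBound P j f a) (hab : a ≤ b) : MomentBound P j f b :=
  ⟨h.aesm, h.nonneg.trans hab, h.le.trans (ENNReal.ofReal_le_ofReal hab)⟩

theorem congr (h : MomentBound P j f a) (hfg : f =ᵐ[P] g) : MomentBound P j g a :=
  ⟨h.aesm.congr hfg, h.nonneg, (eLpNorm_congr_ae hfg).symm.le.trans h.le⟩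

theorem mono_abs (h : MomentBound P j f a) (hg : AEStronglyMeasurable g P)
    (hfg : ∀ᵐ ω ∂P, |g ω| ≤ |f ω|) : MomentBound P j g a :=
  ⟨hg, h.nonneg, (eLpNorm_mono_ae hfg).trans h.le⟩

/-- The reciprocal exponents are i/8 and j/8. Weight 0 is allowed: 8/0 = ∞ in `ℝ≥0∞`, so bounded
factors cost nothing. -/
theorem holderTriple (i j : ℕ) :
    ENNReal.HolderTriple (8 / (i : ℝ≥0∞)) (8 / (j : ℝ≥0∞)) (8 / ((i + j : ℕ) : ℝ≥0∞)) := by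
  constructor
  rw [ENNReal.inv_div (by simp) (by simp), ENNReal.inv_div (by simp) (by simp),
    ENNReal.inv_div (by simp) (by simp)]
  simp [ENNReal.add_div]

theorem mul (hf : MomentBound P i f a) (hg : MomentBound P j g b) :
    MomentBound P (i + j) (fun ω => f ω * g ω) (a * b) := by
  refine ⟨hf.aesm.mul hg.aesm, mul_nonneg hf.nonneg hg.nonneg, ?_⟩
  have := holderTriple i j
  have h := eLpNorm_smul_le_mul_eLpNorm (p := 8 / (i : ℝ≥0∞)) (q := 8 / (j : ℝ≥0∞))
    (r := 8 / ((i + j : ℕ) : ℝ≥0∞)) hg.aesm hf.aesm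
  refine le_trans h ?_
  rw [ENNReal.ofReal_mul hf.nonneg]
  exact mul_le_mul' hf.le hg.le

theorem one_le_exponent (hj : j ≤ 8) : (1 : ℝ≥0∞) ≤ 8 / (j : ℝ≥0∞) := by
  rw [ENNReal.le_div_iff_mul_le (by simp) (by simp), one_mul]
  exact_mod_cast hj

theorem add (hj : j ≤ 8) (hf : MomentBound P j f a) (hg : MomentBound P j g b) :
    MomentBound P j (fun ω => f ω + g ω) (a + b) := by
  refine ⟨hf.aesm.add hg.aesm, add_nonneg hf.nonneg hg.nonneg, ?_⟩
  rw [ENNReal.ofReal_add hf.nonneg hg.nonneg]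
  exact (eLpNorm_add_le hf.aesm hg.aesm (one_le_exponent hj)).trans (add_le_add hf.le hg.le)

theorem const_mul (r : ℝ) (hf : MomentBound P j f a) :
    MomentBound P j (fun ω => r * f ω) (|r| * a) := by
  refine ⟨hf.aesm.const_mul r, mul_nonneg (abs_nonneg r) hf.nonneg, ?_⟩
  have h := eLpNorm_const_smul_le (c := r) (f := f) (p := 8 / (j : ℝ≥0∞)) (μ := P)
  refine le_trans h ?_
  rw [ENNReal.ofReal_mul (abs_nonneg r), ← Real.enorm_eq_ofReal_abs]
  gcongr
  exact hf.le

theorem sub (hj : j ≤ 8) (hf : MomentBound P j f a) (hg : MomentBound P j g b) :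
    MomentBound P j (fun ω => f ω - g ω) (a + b) := by
  have h := add hj hf (const_mul (-1) hg)
  simp only [abs_neg, abs_one, one_mul, neg_mul, ← sub_eq_add_neg] at h
  exact h

theorem zero : MomentBound P j (fun _ => 0) 0 :=
  ⟨aestronglyMeasurable_const, le_rfl, by
    have : eLpNorm (fun _ : Ω => (0 : ℝ)) (8 / (j : ℝ≥0∞)) P = 0 := eLpNorm_zero'
    rw [this]; simp⟩

theorem sum (hj : j ≤ 8) {ι : Type*} (s : Finset ι) {f : ι → Ω → ℝ} {c : ι → ℝ}
    (h : ∀ k ∈ s, MomentBound P j (f k) (c k)) :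
    MomentBound P j (fun ω => ∑ k ∈ s, f k ω) (∑ k ∈ s, c k) := by
  classical
  induction s using Finset.induction_on with
  | empty => simpa using zero
  | insert k s hk ih =>
    simp only [Finset.sum_insert hk]
    exact add hj (h k (by simp)) (ih fun l hl => h l (by simp [hl]))

section Probability

variable [IsProbabilityMeasure P]

theorem mono_weight (h : MomentBound P i f a) (hij : i ≤ j) : MomentBound P j f a := by
  refine ⟨h.aesm, h.nonneg, le_trans (eLpNorm_le_eLpNorm_of_exponent_le ?_ h.aesm) h.le⟩
  gcongr

theorem of_abs_le (hf : AEStronglyMeasurable f P) (hc : 0 ≤ c) (h : ∀ᵐ ω ∂P, |f ω| ≤ c) :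
    MomentBound P j f c := by
  refine mono_weight (i := 0) ⟨hf, hc, ?_⟩ (Nat.zero_le j)
  simp only [Nat.cast_zero, ENNReal.div_zero (show (8 : ℝ≥0∞) ≠ 0 by simp)]
  refine (eLpNorm_le_of_ae_bound h).trans ?_
  simp

theorem const (r : ℝ) : MomentBound P j (fun _ => r) |r| :=
  of_abs_le aestronglyMeasurable_const (abs_nonneg r) (by simp)

theorem pow (h : MomentBound P j f a) (m : ℕ) :
    MomentBound P (m * j) (fun ω => f ω ^ m) (a ^ m) := by
  induction m with
  | zero => simpa using const (P := P) (j := 0) 1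
  | succ m ih =>
    have := mul ih h
    simpa [pow_succ, Nat.succ_mul] using this

theorem memLp_one (hj : j ≤ 8) (h : MomentBound P j f a) : MemLp f 1 P := by
  have h8 := mono_weight h hj
  refine ⟨h.aesm, ?_⟩
  have := h8.le
  rw [show (8 : ℝ≥0∞) / ((8 : ℕ) : ℝ≥0∞) = 1 from by
    push_cast; exact ENNReal.div_self (by simp) (by simp)] at this
  exact this.trans_lt ENNReal.ofReal_lt_top

theorem integrable (hj : j ≤ 8) (h : MomentBound P j f a) : Integrable f P :=
  memLp_one_iff_integrable.1 (memLp_one hj h)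

theorem lintegral_enorm_le (hj : j ≤ 8) (h : MomentBound P j f a) :
    ∫⁻ ω, ‖f ω‖ₑ ∂P ≤ ENNReal.ofReal a := by
  have := (mono_weight h hj).le
  rwa [show (8 : ℝ≥0∞) / ((8 : ℕ) : ℝ≥0∞) = 1 from by
    push_cast; exact ENNReal.div_self (by simp) (by simp), eLpNorm_one_eq_lintegral_enorm] at this

theorem integral_abs_le (hj : j ≤ 8) (h : MomentBound P j f a) : ∫ ω, |f ω| ∂P ≤ a := by
  have h1 := lintegral_enorm_le hj h
  have h2 := integral_norm_eq_lintegral_enorm h.aesm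
  simp only [Real.norm_eq_abs] at h2
  rw [h2]
  exact ENNReal.toReal_le_of_le_ofReal h.nonneg h1

theorem integral_le (hj : j ≤ 8) (h : MomentBound P j f a) : ∫ ω, f ω ∂P ≤ a :=
  (le_abs_self _).trans ((abs_integral_le_integral_abs).trans (integral_abs_le hj h))

end Probability

theorem exponent_eq {j p : ℕ} (hp : p * j = 8) : (8 : ℝ≥0∞) / (j : ℝ≥0∞) = (p : ℝ≥0∞) := by
  have hj : j ≠ 0 := by rintro rfl; simp at hp
  rw [← Nat.cast_ofNat (R := ℝ≥0∞) (n := 8), ← hp]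
  push_cast
  rw [mul_div_assoc, ENNReal.div_self (by simpa using hj) (by simp), mul_one]

theorem of_lintegral {p : ℕ} (hp : p * j = 8) (hf : AEStronglyMeasurable f P) (hc : 0 ≤ c)
    (h : ∫⁻ ω, ‖f ω‖ₑ ^ p ∂P ≤ ENNReal.ofReal (c ^ p)) : MomentBound P j f c := by
  have hp0 : p ≠ 0 := by rintro rfl; simp at hp
  refine ⟨hf, hc, ?_⟩
  rw [exponent_eq hp, eLpNorm_eq_lintegral_rpow_enorm_toReal (by simpa using hp0) (by simp)]
  simp only [ENNReal.toReal_natCast, ENNReal.rpow_natCast]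
  refine (ENNReal.rpow_le_rpow h (by positivity)).trans ?_
  rw [ENNReal.ofReal_rpow_of_nonneg (by positivity) (by positivity), one_div,
    Real.pow_rpow_inv_natCast hc hp0]

theorem of_integral {p : ℕ} (hp : p * j = 8) (he : Even p) (hf : AEStronglyMeasurable f P)
    (hc : 0 ≤ c) (hi : Integrable (fun ω => f ω ^ p) P) (h : ∫ ω, f ω ^ p ∂P ≤ c ^ p) :
    MomentBound P j f c := by
  refine of_lintegral hp hf hc ?_
  have : ∀ ω, ‖f ω‖ₑ ^ p = ENNReal.ofReal (f ω ^ p) := fun ω => by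
    rw [Real.enorm_eq_ofReal_abs, ← ENNReal.ofReal_pow (abs_nonneg _), he.pow_abs]
  simp only [this]
  rw [← ofReal_integral_eq_lintegral_ofReal hi (ae_of_all _ fun ω => he.pow_nonneg _)]
  exact ENNReal.ofReal_le_ofReal h

/-- Moments of independent factors multiply, so the weight stays j where Hölder would give 2j. A
nonzero j keeps the exponent finite. -/
theorem mul_indep (hj : j ≠ 0) (hf : MomentBound P j f a) (hg : MomentBound P j g b)
    (hfg : IndepFun f g P) : MomentBound P j (fun ω => f ω * g ω) (a * b) := by
  refine ⟨hf.aesm.mul hg.aesm, mul_nonneg hf.nonneg hg.nonneg, ?_⟩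
  have h8 : (8 : ℝ≥0∞) / (j : ℝ≥0∞) ≠ 0 := by simp [ENNReal.div_eq_zero_iff]
  have h8' : (8 : ℝ≥0∞) / (j : ℝ≥0∞) ≠ ∞ := by simp [ENNReal.div_eq_top, hj]
  have hpos := ENNReal.toReal_pos h8 h8'
  refine le_trans (le_of_eq ?_) ((mul_le_mul' hf.le hg.le).trans
    (ENNReal.ofReal_mul hf.nonneg).symm.le)
  simp only [eLpNorm_eq_lintegral_rpow_enorm_toReal h8 h8']
  rw [← ENNReal.mul_rpow_of_nonneg _ _ (by positivity)]
  congr 1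
  simp only [enorm_mul, ENNReal.mul_rpow_of_nonneg _ _ hpos.le]
  exact lintegral_mul_eq_lintegral_mul_lintegral_of_indepFun''
    (hf.aesm.enorm.pow_const _) (hg.aesm.enorm.pow_const _)
    (hfg.comp (φ := fun x : ℝ => ‖x‖ₑ ^ (8 / (j : ℝ≥0∞)).toReal)
      (ψ := fun x : ℝ => ‖x‖ₑ ^ (8 / (j : ℝ≥0∞)).toReal) (by fun_prop) (by fun_prop))

end MomentBound

/-! ### Moments of sums of orthogonal increments -/

section

variable {Ω : Type*} [MeasurableSpace Ω] {P : Measure Ω} [IsProbabilityMeasure P]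

/-- The term linear in d is kept exact because it will integrate to zero; the higher ones are
absorbed. The constant is crude, to agree with the eighth power. -/
theorem add_pow_four_le (s d : ℝ) :
    (s + d) ^ 4 ≤ s ^ 4 + 4 * (s ^ 3 * d) + 256 * (s ^ 2 * d ^ 2 + d ^ 4) := by
  nlinarith [sq_nonneg (d * (s - d)), sq_nonneg (s * d), sq_nonneg (d ^ 2)]

/-- Every term of degree at least 2 in d is dominated by s⁶d² + d⁸, and the binomial coefficients
sum to 2⁸ = 256. -/
theorem add_pow_eight_le (s d : ℝ) :
    (s + d) ^ 8 ≤ s ^ 8 + 8 * (s ^ 7 * d) + 256 * (s ^ 6 * d ^ 2 + d ^ 8) := by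
  -- The first three squares control the odd terms s⁵d³, s³d⁵, sd⁷; the next two control s⁴d⁴ and
  -- s²d⁶ by the extreme terms.
  have h1 : 0 ≤ (s ^ 2 * d * (s - d)) ^ 2 := sq_nonneg _
  have h2 : 0 ≤ (s * d ^ 2 * (s - d)) ^ 2 := sq_nonneg _
  have h3 : 0 ≤ (d ^ 3 * (s - d)) ^ 2 := sq_nonneg _
  have h4 : 0 ≤ (s ^ 3 * d - s * d ^ 3) ^ 2 := sq_nonneg _
  have h5 : 0 ≤ (s ^ 2 * d ^ 2 - d ^ 4) ^ 2 := sq_nonneg _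
  have h6 : 0 ≤ (s ^ 3 * d) ^ 2 := sq_nonneg _
  have h7 : 0 ≤ (d ^ 4) ^ 2 := sq_nonneg _
  have h8 : 0 ≤ (s * d ^ 3) ^ 2 := sq_nonneg _
  have h9 : 0 ≤ (s ^ 2 * d ^ 2) ^ 2 := sq_nonneg _
  nlinarith

/-- With x and y squared norms, this turns a bound on the 2(l+1)-th moment back into a bound on the
squared norm. -/
theorem add_mul_pow_le {x y κ : ℝ} (hx : 0 ≤ x) (hy : 0 ≤ y) (hκ : 1 ≤ κ) {l : ℕ} (hl : l ≠ 0) :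
    x ^ (l + 1) + κ * (x ^ l * y + y ^ (l + 1)) ≤ (x + κ * y) ^ (l + 1) := by
  have h1 : x ^ l + y ^ l ≤ (x + κ * y) ^ l := by
    refine (pow_add_pow_le hx hy hl).trans ?_
    gcongr
    nlinarith
  have h2 : x ^ l ≤ (x + κ * y) ^ l := by
    gcongr
    nlinarith
  have hκy : 0 ≤ κ * y := by positivity
  calc x ^ (l + 1) + κ * (x ^ l * y + y ^ (l + 1)) = x * x ^ l + κ * y * (x ^ l + y ^ l) := by ring
    _ ≤ x * (x + κ * y) ^ l + κ * y * (x + κ * y) ^ l := by gcongr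
    _ = _ := by ring

/-- Squared norms add as variances do, up to the factor 256: the only term linear in D is orthogonal
to S^(2l+1), and the others are quadratic or higher in D. The cases used are L⁸ (l = 3, j = 1) and
L⁴ (l = 1, j = 2). -/
theorem MomentBound.add_orthogonal {j l : ℕ} (hl : l ≠ 0) (hj : 2 * (l + 1) * j = 8)
    (hpt : ∀ s d : ℝ, (s + d) ^ (2 * (l + 1)) ≤ s ^ (2 * (l + 1)) +
      (2 * (l + 1) : ℕ) * (s ^ (2 * l + 1) * d) + 256 * (s ^ (2 * l) * d ^ 2 + d ^ (2 * (l + 1))))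
    {S D : Ω → ℝ} {a b : ℝ} (hS : MomentBound P j S a) (hD : MomentBound P j D b)
    (horth : ∫ ω, S ω ^ (2 * l + 1) * D ω ∂P = 0) :
    MomentBound P j (fun ω => S ω + D ω) (√(a ^ 2 + 256 * b ^ 2)) := by
  have hj8 : j ≤ 8 := by nlinarith
  have w1 : MomentBound P 8 (fun ω => S ω ^ (2 * (l + 1))) (a ^ (2 * (l + 1))) := by
    have := hS.pow (2 * (l + 1)); rwa [hj] at this
  have w2 : MomentBound P 8 (fun ω => D ω ^ (2 * (l + 1))) (b ^ (2 * (l + 1))) := by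
    have := hD.pow (2 * (l + 1)); rwa [hj] at this
  have w3 : MomentBound P 8 (fun ω => S ω ^ (2 * l) * D ω ^ 2) (a ^ (2 * l) * b ^ 2) := by
    have := (hS.pow (2 * l)).mul (hD.pow 2)
    rwa [← add_mul, show 2 * l + 2 = 2 * (l + 1) by ring, hj] at this
  have w4 : MomentBound P 8 (fun ω => S ω ^ (2 * l + 1) * D ω) (a ^ (2 * l + 1) * b) := by
    have := (hS.pow (2 * l + 1)).mul hD
    rwa [← Nat.succ_mul, show (2 * l + 1).succ = 2 * (l + 1) by simp; ring, hj] at this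
  have w5 : MomentBound P 8 (fun ω => (S ω + D ω) ^ (2 * (l + 1))) ((a + b) ^ (2 * (l + 1))) := by
    have := (hS.add hj8 hD).pow (2 * (l + 1)); rwa [hj] at this
  refine MomentBound.of_integral hj (by simp) (hS.aesm.add hD.aesm) (Real.sqrt_nonneg _)
    (w5.integrable le_rfl) ?_
  have i1 := w1.integrable le_rfl
  have i2 := w2.integrable le_rfl
  have i3 := w3.integrable le_rfl
  have i4 := w4.integrable le_rfl
  calc ∫ ω, (S ω + D ω) ^ (2 * (l + 1)) ∂P
      ≤ ∫ ω, (S ω ^ (2 * (l + 1)) + (2 * (l + 1) : ℕ) * (S ω ^ (2 * l + 1) * D ω)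
        + 256 * (S ω ^ (2 * l) * D ω ^ 2 + D ω ^ (2 * (l + 1)))) ∂P :=
        integral_mono (w5.integrable le_rfl)
          ((i1.add (i4.const_mul _)).add ((i3.add i2).const_mul _)) fun ω => hpt _ _
    _ = ∫ ω, S ω ^ (2 * (l + 1)) ∂P + 256 * (∫ ω, S ω ^ (2 * l) * D ω ^ 2 ∂P
        + ∫ ω, D ω ^ (2 * (l + 1)) ∂P) := by
      have e1 : Integrable (fun ω => S ω ^ (2 * (l + 1)) +
          (2 * (l + 1) : ℕ) * (S ω ^ (2 * l + 1) * D ω)) P := i1.add (i4.const_mul _)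
      have e2 : Integrable (fun ω => 256 * (S ω ^ (2 * l) * D ω ^ 2 + D ω ^ (2 * (l + 1)))) P :=
        (i3.add i2).const_mul _
      rw [integral_add e1 e2, integral_add i1 (i4.const_mul _), integral_const_mul,
        integral_const_mul, integral_add i3 i2, horth]
      ring
    _ ≤ a ^ (2 * (l + 1)) + 256 * (a ^ (2 * l) * b ^ 2 + b ^ (2 * (l + 1))) := by
      gcongr
      exacts [w1.integral_le le_rfl, w3.integral_le le_rfl, w2.integral_le le_rfl]
    _ ≤ (a ^ 2 + 256 * b ^ 2) ^ (l + 1) := by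
      have := add_mul_pow_le (sq_nonneg a) (sq_nonneg b) (κ := 256) (by norm_num) hl
      simpa only [← pow_mul] using this
    _ = √(a ^ 2 + 256 * b ^ 2) ^ (2 * (l + 1)) := by
      rw [pow_mul, Real.sq_sqrt (by positivity)]

/-- A square function bound in `L⁸` and in `L⁴` for sums `∑ Yₖ Rₖ` with `Yₖ` centred and
independent of the coefficient `Rₖ` and the preceding partial sum. -/
theorem MomentBound.sum_mul_predictable {j : ℕ} (hj : j = 1 ∨ j = 2) {Y R : ℕ → Ω → ℝ}
    {b : ℝ} {r : ℕ → ℝ} (n : ℕ) (hY : ∀ k < n, MomentBound P j (Y k) b)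
    (hR : ∀ k < n, MomentBound P j (R k) (r k))
    (hind : ∀ k < n, IndepFun (Y k)
      (fun ω => (R k ω, ∑ i ∈ Finset.range k, Y i ω * R i ω)) P)
    (hmean : ∀ k < n, ∫ ω, Y k ω ∂P = 0) :
    MomentBound P j (fun ω => ∑ k ∈ Finset.range n, Y k ω * R k ω)
      (16 * |b| * √(∑ k ∈ Finset.range n, r k ^ 2)) := by
  induction n with
  | zero => simpa using MomentBound.zero
  | succ n ih =>
    have hS := ih (fun k hk => hY k (by omega)) (fun k hk => hR k (by omega))
      (fun k hk => hind k (by omega)) (fun k hk => hmean k (by omega))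
    have hn := hind n (by omega)
    have hD : MomentBound P j (fun ω => Y n ω * R n ω) (b * r n) :=
      (hY n (by omega)).mul_indep (by omega) (hR n (by omega)) (hn.comp measurable_id measurable_fst)
    -- `Y n` is independent of the pair (coefficient, partial sum), so its zero mean factors out.
    have horth : ∀ m : ℕ, ∫ ω, (∑ i ∈ Finset.range n, Y i ω * R i ω) ^ m * (Y n ω * R n ω) ∂P = 0 := by
      intro m
      have h := IndepFun.integral_fun_mul_eq_mul_integral
        (hn.comp (φ := id) (ψ := fun x : ℝ × ℝ => x.1 * x.2 ^ m) measurable_id (by fun_prop))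
        (hY n (by omega)).aesm ((hR n (by omega)).aesm.mul (hS.aesm.pow m))
      simp only [Function.comp_apply, id] at h
      rw [hmean n (by omega), zero_mul] at h
      rw [← h]
      congr 1; ext ω; ring
    have key : MomentBound P j (fun ω => (∑ k ∈ Finset.range n, Y k ω * R k ω) + Y n ω * R n ω)
        (√((16 * |b| * √(∑ k ∈ Finset.range n, r k ^ 2)) ^ 2 + 256 * (b * r n) ^ 2)) := by
      rcases hj with rfl | rfl
      · exact MomentBound.add_orthogonal (l := 3) (by norm_num) (by norm_num)
          (fun s d => by simpa using add_pow_eight_le s d) hS hD (horth 7)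
      · exact MomentBound.add_orthogonal (l := 1) (by norm_num) (by norm_num)
          (fun s d => by simpa using add_pow_four_le s d) hS hD (horth 3)
    simp only [Finset.sum_range_succ]
    refine key.mono (le_of_eq ?_)
    have hs : 0 ≤ ∑ k ∈ Finset.range n, r k ^ 2 := Finset.sum_nonneg fun k _ => sq_nonneg _
    -- 256 = 16², so the induction closes with equality; this is the source of the factor 16.
    have he : (16 * |b|) ^ 2 * ∑ k ∈ Finset.range n, r k ^ 2 + 256 * (b * r n) ^ 2
        = (16 * |b|) ^ 2 * (∑ k ∈ Finset.range n, r k ^ 2 + r n ^ 2) := by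
      rw [mul_pow 16, sq_abs]; ring
    rw [mul_pow, Real.sq_sqrt hs, he,
      Real.sqrt_mul (sq_nonneg _), Real.sqrt_sq (by positivity)]

end

/-! ### Measures with a real-valued density -/

section

variable {p : ℝ → ℝ}

theorem integral_withDensity_ofReal (hp : AEMeasurable p) (h0 : ∀ x, 0 ≤ p x) (g : ℝ → ℝ) :
    ∫ x, g x ∂((volume : Measure ℝ).withDensity fun x => ENNReal.ofReal (p x))
      = ∫ x, p x * g x := by
  rw [integral_withDensity_eq_integral_toReal_smul₀ hp.ennreal_ofReal (by simp)]
  simp [ENNReal.toReal_ofReal (h0 _)]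

theorem integrable_withDensity_ofReal (hp : AEMeasurable p) (h0 : ∀ x, 0 ≤ p x) {g : ℝ → ℝ} :
    Integrable g ((volume : Measure ℝ).withDensity fun x => ENNReal.ofReal (p x))
      ↔ Integrable fun x => p x * g x := by
  rw [integrable_withDensity_iff_integrable_smul₀' hp.ennreal_ofReal (by simp)]
  simp [ENNReal.toReal_ofReal (h0 _)]

theorem ae_withDensity_ofReal (hp : AEMeasurable p) {Q : ℝ → Prop} :
    (∀ᵐ x ∂((volume : Measure ℝ).withDensity fun x => ENNReal.ofReal (p x)), Q x)
      ↔ ∀ᵐ x, 0 < p x → Q x := by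
  rw [ae_withDensity_iff' hp.ennreal_ofReal]
  simp

end

/-! ### A density from an integration by parts formula -/

theorem hasDerivAt_integral_Iio {f : ℝ → ℝ} (hf : Continuous f) (hi : Integrable f) (x : ℝ) :
    HasDerivAt (fun x => ∫ t in Set.Iio x, f t) (f x) x := by
  have h : (fun x => ∫ t in Set.Iio x, f t) = fun x => (∫ t in (0 : ℝ)..x, f t) +
      ∫ t in Set.Iio (0 : ℝ), f t := by
    ext x
    rw [← intervalIntegral.integral_Iic_sub_Iic hi.integrableOn hi.integrableOn,
      integral_Iic_eq_integral_Iio, integral_Iic_eq_integral_Iio]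
    ring
  rw [h]
  exact (intervalIntegral.integral_hasDerivAt_right (hf.intervalIntegrable _ _)
    (hf.stronglyMeasurableAtFilter _ _) hf.continuousAt).add_const _

theorem absolutelyContinuousOnInterval_const (c a b : ℝ) :
    AbsolutelyContinuousOnInterval (fun _ : ℝ => c) a b :=
  LipschitzOnWith.absolutelyContinuousOnInterval (K := 0) (LipschitzWith.const c).lipschitzOnWith

theorem isLocallyFiniteMeasure_withDensity_of_le {q : ℝ → ℝ} {M : ℝ} (h : ∀ x, q x ≤ M) :
    IsLocallyFiniteMeasure ((volume : Measure ℝ).withDensity fun x => ENNReal.ofReal (q x)) := by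
  refine Measure.isLocallyFiniteMeasure_of_le
    (μ := (ENNReal.ofReal M).toNNReal • (volume : Measure ℝ)) ?_
  have h2 : (volume : Measure ℝ).withDensity (fun _ => ENNReal.ofReal M)
      = (ENNReal.ofReal M).toNNReal • (volume : Measure ℝ) := by
    rw [withDensity_const]
    ext s
    simp
  rw [← h2]
  exact withDensity_mono (ae_of_all _ fun x => ENNReal.ofReal_le_ofReal (h x))

/-- A finite measure whose integrals of compactly supported continuous functions are given by a
bounded function `q` has density `q`. -/
theorem eq_withDensity_of_integral_eq {ν : Measure ℝ} [IsFiniteMeasure ν] {q : ℝ → ℝ}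
    (hq : Measurable q) {M : ℝ} (hM : ∀ x, |q x| ≤ M)
    (h : ∀ f : ℝ → ℝ, Continuous f → HasCompactSupport f → ∫ x, f x ∂ν = ∫ x, q x * f x) :
    (∀ᵐ x, 0 ≤ q x) ∧ ν = (volume : Measure ℝ).withDensity fun x => ENNReal.ofReal (q x) := by
  -- Neither the sign nor the integrability of `q` is known yet. Boundedness makes q⁺dx and q⁻dx
  -- locally finite, so ν + q⁻dx and q⁺dx can be compared on compactly supported functions.
  have l1 : IsLocallyFiniteMeasure
      ((volume : Measure ℝ).withDensity fun x => ENNReal.ofReal (max (q x) 0)) :=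
    isLocallyFiniteMeasure_withDensity_of_le (M := M)
      fun x => max_le ((le_abs_self _).trans (hM x)) ((abs_nonneg _).trans (hM x))
  have l2 : IsLocallyFiniteMeasure
      ((volume : Measure ℝ).withDensity fun x => ENNReal.ofReal (max (-q x) 0)) :=
    isLocallyFiniteMeasure_withDensity_of_le (M := M)
      fun x => max_le ((neg_le_abs _).trans (hM x)) ((abs_nonneg _).trans (hM x))
  set μ₁ := (volume : Measure ℝ).withDensity fun x => ENNReal.ofReal (max (q x) 0) with hμ₁
  set μ₂ := (volume : Measure ℝ).withDensity fun x => ENNReal.ofReal (max (-q x) 0) with hμ₂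
  have hq1 : AEMeasurable fun x => max (q x) 0 := (hq.max measurable_const).aemeasurable
  have hq2 : AEMeasurable fun x => max (-q x) 0 := (hq.neg.max measurable_const).aemeasurable
  have l3 : IsFiniteMeasureOnCompacts (ν + μ₂) :=
    ⟨fun K hK => by
      rw [Measure.add_apply]
      exact ENNReal.add_lt_top.2 ⟨hK.measure_lt_top, hK.measure_lt_top⟩⟩
  have heq : ν + μ₂ = μ₁ := by
    refine Measure.ext_of_integral_eq_on_compactlySupported fun f => ?_
    have hfc : Continuous f := f.continuous
    have hfs : HasCompactSupport f := f.hasCompactSupport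
    have i0 : Integrable f ν := hfc.integrable_of_hasCompactSupport hfs
    have i1 : Integrable f μ₁ := hfc.integrable_of_hasCompactSupport hfs
    have i2 : Integrable f μ₂ := hfc.integrable_of_hasCompactSupport hfs
    rw [integral_add_measure i0 i2, h f hfc hfs, hμ₁, hμ₂,
      integral_withDensity_ofReal hq1 (fun _ => le_max_right _ _),
      integral_withDensity_ofReal hq2 (fun _ => le_max_right _ _)]
    rw [hμ₁, integrable_withDensity_ofReal hq1 (fun _ => le_max_right _ _)] at i1
    rw [hμ₂, integrable_withDensity_ofReal hq2 (fun _ => le_max_right _ _)] at i2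
    have e : (fun x => q x * f x) = fun x => max (q x) 0 * f x - max (-q x) 0 * f x := by
      ext x
      rcases le_total (q x) 0 with hx | hx
      · rw [max_eq_right hx, max_eq_left (by linarith)]; ring
      · rw [max_eq_left hx, max_eq_right (by linarith)]; ring
    rw [e, integral_sub i1 i2]
    ring
  have hN : MeasurableSet {x | q x < 0} := hq measurableSet_Iio
  -- q⁺dx does not charge {q < 0}, and it dominates q⁻dx, which lives there; hence q⁻ = 0 almost
  -- everywhere.
  have hz : μ₁ {x | q x < 0} = 0 := by
    rw [hμ₁, withDensity_apply _ hN, setLIntegral_congr_fun hN (g := fun _ => 0), lintegral_zero]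
    intro x hx
    simp [le_of_lt (show q x < 0 from hx)]
  have hz2 : μ₂ {x | q x < 0} = 0 := by
    refine le_antisymm ?_ bot_le
    rw [← hz, ← heq]
    simp
  have hnn : ∀ᵐ x, 0 ≤ q x := by
    have : ∀ᵐ x ∂μ₂, ¬ q x < 0 := by
      rw [ae_iff]; simpa using hz2
    rw [hμ₂, ae_withDensity_ofReal hq2] at this
    filter_upwards [this] with x hx
    by_contra hlt
    push Not at hlt
    exact hx (by simpa using hlt) hlt
  have hμ2 : μ₂ = 0 := by
    rw [hμ₂, withDensity_eq_zero_iff hq2.ennreal_ofReal]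
    filter_upwards [hnn] with x hx
    simp [hx]
  refine ⟨hnn, ?_⟩
  rw [hμ2, add_zero] at heq
  rw [heq, hμ₁]
  refine withDensity_congr_ae ?_
  filter_upwards [hnn] with x hx
  rw [max_eq_left hx]

/-- If `∫ φ' dν = ∫ φ m dν` for all smooth bounded `φ`, then `ν` has the absolutely continuous
density `q(x) = ∫_{y > x} m(y) ν(dy)`, and `q' = -m q`. -/
theorem exists_density_of_integral_deriv_eq {ν : Measure ℝ} [IsProbabilityMeasure ν] {m : ℝ → ℝ}
    (hm : Measurable m) (hmi : Integrable m ν)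
    (h : ∀ φ φ' : ℝ → ℝ, (∀ x, HasDerivAt φ (φ' x) x) → Continuous φ' →
      (∃ M, ∀ x, |φ x| ≤ M ∧ |φ' x| ≤ M) → ∫ x, φ' x ∂ν = ∫ x, φ x * m x ∂ν) :
    ∃ q : ℝ → ℝ, (∀ x, 0 ≤ q x) ∧ Continuous q ∧
      ν = (volume : Measure ℝ).withDensity (fun x => ENNReal.ofReal (q x)) ∧
      (∀ a b : ℝ, AbsolutelyContinuousOnInterval q a b) ∧
      ∀ᵐ x, HasDerivAt q (-(m x * q x)) x := by
  set q : ℝ → ℝ := fun x => ∫ y in Set.Ioi x, m y ∂ν with hq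
  have hqi : ∀ x, q x = ∫ y, (Set.Ioi x).indicator m y ∂ν := fun x =>
    (integral_indicator measurableSet_Ioi).symm
  have hset : MeasurableSet {z : ℝ × ℝ | z.1 < z.2} := measurableSet_lt measurable_fst measurable_snd
  have hqm : Measurable q := by
    have h1 : Measurable fun z : ℝ × ℝ => {z : ℝ × ℝ | z.1 < z.2}.indicator (fun z => m z.2) z :=
      (hm.comp measurable_snd).indicator hset
    have h2 := (h1.stronglyMeasurable.integral_prod_right' (ν := ν)).measurable
    convert h2 using 2 with x
    rw [hqi]
    rfl
  have hqM : ∀ x, |q x| ≤ ∫ y, |m y| ∂ν := fun x =>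
    (abs_integral_le_integral_abs).trans (setIntegral_le_integral hmi.abs
      (ae_of_all _ fun _ => abs_nonneg _))
  have hint : ∀ f : ℝ → ℝ, Continuous f → HasCompactSupport f →
      ∫ x, f x ∂ν = ∫ x, q x * f x := by
    intro f hfc hfs
    have hfi : Integrable f := hfc.integrable_of_hasCompactSupport hfs
    obtain ⟨C, hC⟩ := hfc.bounded_above_of_compact_support hfs
    -- The test function is the primitive of f from -∞, bounded because f is integrable; Fubini then
    -- moves the tail integral onto m, which produces `q`.
    rw [h (fun x => ∫ t in Set.Iio x, f t) f (hasDerivAt_integral_Iio hfc hfi) hfc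
      ⟨max C (∫ t, |f t|), fun x => ⟨le_max_of_le_right ?_, le_max_of_le_left (hC x)⟩⟩]
    swap
    · exact (abs_integral_le_integral_abs).trans (setIntegral_le_integral hfi.abs
        (ae_of_all _ fun _ => abs_nonneg _))
    have e1 : ∀ x, (∫ t in Set.Iio x, f t) * m x =
        ∫ t, {z : ℝ × ℝ | z.1 < z.2}.indicator (fun z => f z.1 * m z.2) (t, x) := by
      intro x
      rw [← integral_indicator measurableSet_Iio, ← integral_mul_const]
      congr 1; ext t
      by_cases htx : t < x <;> simp [Set.indicator, htx]
    have e2 : ∀ t, q t * f t =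
        ∫ x, {z : ℝ × ℝ | z.1 < z.2}.indicator (fun z => f z.1 * m z.2) (t, x) ∂ν := by
      intro t
      rw [hqi, mul_comm, ← integral_const_mul]
      congr 1; ext x
      by_cases htx : t < x <;> simp [Set.indicator, htx]
    simp only [e1, e2]
    refine (integral_integral_swap (f := fun t x =>
      {z : ℝ × ℝ | z.1 < z.2}.indicator (fun z => f z.1 * m z.2) (t, x)) ?_).symm
    exact (hfi.mul_prod hmi).indicator hset
  obtain ⟨hnn, hν⟩ := eq_withDensity_of_integral_eq hqm hqM hint
  have hν' : ν = (volume : Measure ℝ).withDensity fun x => ENNReal.ofReal (max (q x) 0) := by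
    rw [hν]
    refine withDensity_congr_ae (ae_of_all _ fun x => ?_)
    simp [ENNReal.ofReal_max]
  have hqm' : AEMeasurable fun x => max (q x) 0 := (hqm.max measurable_const).aemeasurable
  have hgi : Integrable fun y => max (q y) 0 * m y := by
    rw [← integrable_withDensity_ofReal hqm' (fun _ => le_max_right _ _), ← hν']
    exact hmi
  have hqg : ∀ x, q x = ∫ y in Set.Ioi x, max (q y) 0 * m y := by
    intro x
    rw [hqi, ← integral_indicator measurableSet_Ioi, hν',
      integral_withDensity_ofReal hqm' (fun _ => le_max_right _ _)]
    congr 1; ext y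
    by_cases hy : x < y <;> simp [Set.indicator, hy]
  -- Writing ν through its own density shows that `q` is a primitive of -q⁺m, which gives absolute
  -- continuity and the derivative.
  have hqint : ∀ c x, q x = q c - ∫ y in c..x, max (q y) 0 * m y := by
    intro c x
    rw [hqg x, hqg c, ← intervalIntegral.integral_Ioi_sub_Ioi' hgi.integrableOn hgi.integrableOn]
    ring
  have hac : ∀ a b : ℝ, AbsolutelyContinuousOnInterval q a b := by
    intro a b
    have h1 := (hgi.intervalIntegrable (a := a) (b := b)
      ).absolutelyContinuousOnInterval_intervalIntegral (c := a) Set.left_mem_uIcc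
    have h2 := (absolutelyContinuousOnInterval_const (q a) a b).sub h1
    exact (funext fun x => hqint a x) ▸ h2
  have hqc : Continuous q := by
    have h1 : Continuous fun x => ∫ y in (0 : ℝ)..x, max (q y) 0 * m y :=
      intervalIntegral.continuous_primitive (fun a b => hgi.intervalIntegrable) 0
    have h2 : q = fun x => q 0 - ∫ y in (0 : ℝ)..x, max (q y) 0 * m y := funext fun x => hqint 0 x
    rw [h2]
    exact continuous_const.sub h1
  -- Continuity upgrades the almost everywhere sign to every point.
  have hq0 : ∀ x, 0 ≤ q x := by
    have : (fun x => max (q x) 0) = q := by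
      refine (hqc.max continuous_const).ae_eq_iff_eq volume hqc |>.1 ?_
      filter_upwards [hnn] with x hx
      exact max_eq_left hx
    intro x
    rw [← this]
    exact le_max_right _ _
  refine ⟨q, hq0, hqc, hν, hac, ?_⟩
  filter_upwards [LocallyIntegrable.ae_hasDerivAt_integral hgi.locallyIntegrable] with x hx
  have h3 : HasDerivAt (fun x => q 0 - ∫ y in (0 : ℝ)..x, max (q y) 0 * m y)
      (-(max (q x) 0 * m x)) x := (hx 0).const_sub _
  rw [max_eq_left (hq0 x), mul_comm (q x)] at h3
  rwa [← (funext fun x => hqint 0 x : q = _)] at h3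

/-- Integration by parts for a random variable `W` with weight `D` yields an absolutely continuous
density with score `-E[D | W]`, and hence a bound on the Fisher information distance. -/
theorem fisherDistance_le_of_integral_deriv_eq {Ω : Type*} [MeasurableSpace Ω] {P : Measure Ω}
    [IsProbabilityMeasure P] {W D : Ω → ℝ} (hW : Measurable W) (hWi : Integrable W P)
    (hD : Integrable D P)
    (h : ∀ φ φ' : ℝ → ℝ, (∀ x, HasDerivAt φ (φ' x) x) → Continuous φ' →
      (∃ M, ∀ x, |φ x| ≤ M ∧ |φ' x| ≤ M) → ∫ ω, φ' (W ω) ∂P = ∫ ω, φ (W ω) * D ω ∂P) :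
    fisherDistance P W 0 1 ≤ ∫⁻ ω, ‖W ω - D ω‖ₑ ^ 2 ∂P := by
  have hle : MeasurableSpace.comap W inferInstance ≤ ‹MeasurableSpace Ω› := hW.comap_le
  -- Doob–Dynkin: E[D | W] = m(W). The integration by parts formula passes to m by conditioning.
  obtain ⟨m, hm, hmW⟩ := (stronglyMeasurable_condExp (f := D) (μ := P)
    (m := MeasurableSpace.comap W inferInstance)).measurable.exists_eq_measurable_comp
  have hν : IsProbabilityMeasure (P.map W) := Measure.isProbabilityMeasure_map hW.aemeasurable
  have hmi : Integrable m (P.map W) := by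
    rw [integrable_map_measure hm.aestronglyMeasurable hW.aemeasurable, ← hmW]
    exact integrable_condExp
  obtain ⟨q, hq0, hqc, hqν, hac, hder⟩ := exists_density_of_integral_deriv_eq hm hmi (by
    rintro φ φ' hφ hφ' ⟨M, hM⟩
    have hφc : Continuous φ := continuous_iff_continuousAt.2 fun x => (hφ x).continuousAt
    rw [integral_map hW.aemeasurable hφ'.aestronglyMeasurable,
      integral_map hW.aemeasurable (f := fun x => φ x * m x)
        (hφc.measurable.mul hm).aestronglyMeasurable,
      h φ φ' hφ hφ' ⟨M, hM⟩]
    have hs : StronglyMeasurable[MeasurableSpace.comap W inferInstance] fun ω => φ (W ω) :=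
      (hφc.measurable.comp (comap_measurable W)).stronglyMeasurable
    have hb := condExp_stronglyMeasurable_mul_of_bound hle hs hD M (ae_of_all _ fun ω => (hM _).1)
    rw [← integral_condExp hle]
    refine integral_congr_ae (hb.trans (ae_of_all _ fun ω => ?_))
    simp only [Pi.mul_apply]
    rw [hmW]
    rfl)
  refine (iInf₂_le q ⟨hq0, hqν, hac⟩).trans ?_
  have hpos : ∀ᵐ ω ∂P, deriv q (W ω) / q (W ω) = - m (W ω) := by
    refine ae_of_ae_map (p := fun x => deriv q x / q x = - m x) hW.aemeasurable ?_
    rw [hqν, ae_withDensity_ofReal hqc.aemeasurable]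
    filter_upwards [hder] with x hx h0
    rw [hx.deriv]
    field_simp
  -- W plus its score equals E[W - D | W], and conditional expectation contracts L².
  have hce : (fun ω => deriv q (W ω) / q (W ω) + (W ω - 0) / 1) =ᵐ[P]
      P[fun ω => W ω - D ω | MeasurableSpace.comap W inferInstance] := by
    have h1 := condExp_sub (μ := P) hWi hD (MeasurableSpace.comap W inferInstance)
    have h2 : P[W | MeasurableSpace.comap W inferInstance] = W :=
      condExp_of_stronglyMeasurable hle (comap_measurable W).stronglyMeasurable hWi
    filter_upwards [h1, hpos] with ω e1 e2
    rw [show (fun ω => W ω - D ω) = W - D from rfl, e1, e2, h2]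
    simp only [Pi.sub_apply, hmW, Function.comp_apply]
    ring
  have hn := eLpNorm_condExp_le_eLpNorm (μ := P) (m := MeasurableSpace.comap W inferInstance)
    (fun ω => W ω - D ω) (p := 2) (by norm_num)
  rw [← eLpNorm_congr_ae hce, eLpNorm_eq_lintegral_rpow_enorm_toReal (by simp) (by simp),
    eLpNorm_eq_lintegral_rpow_enorm_toReal (by simp) (by simp)] at hn
  rw [ENNReal.rpow_le_rpow_iff (by simp)] at hn
  simp only [ENNReal.toReal_ofNat, ENNReal.rpow_ofNat] at hn
  refine le_trans (le_of_eq ?_) hn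
  refine lintegral_congr fun ω => ?_
  rw [Real.enorm_eq_ofReal_abs, ← ENNReal.ofReal_pow (abs_nonneg _), sq_abs]

/-! ### Stein kernels bounded below -/

section

variable {p : ℝ → ℝ} {τ₀ : ℝ}

/-- Otherwise y p(y) ≤ 0 everywhere with zero integral, so p would vanish almost everywhere. -/
theorem exists_pos_mem_support (h0 : ∀ x, 0 ≤ p x) (hyp : Integrable fun y => y * p y)
    (hmean : ∫ y, y * p y = 0) (hne : ¬ p =ᵐ[volume] 0) : ∃ s, 0 < s ∧ 0 < p s := by
  by_contra! hcon
  have hle : ∀ y, y * p y ≤ 0 := fun y => by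
    rcases le_or_gt y 0 with hy | hy
    · exact mul_nonpos_of_nonpos_of_nonneg hy (h0 y)
    · rw [le_antisymm (hcon y hy) (h0 y), mul_zero]
  have h1 : (fun y => y * p y) =ᵐ[volume] 0 := by
    have hyn : Integrable fun y => -(y * p y) := hyp.neg
    have h2 : (fun y => -(y * p y)) =ᵐ[volume] 0 := by
      rw [← integral_eq_zero_iff_of_nonneg (fun y => by simpa using hle y) hyn,
        integral_neg, hmean, neg_zero]
    filter_upwards [h2] with y hy
    simpa using hy
  apply hne
  have hz : ∀ᵐ y : ℝ, y ≠ 0 := by simp [ae_iff]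
  filter_upwards [h1, hz] with y hy hy0
  simpa [hy0] using hy

/-- A Gronwall argument at a finite upper end b. With H(x) = ∫_x^b y p(y) dy, the hypothesis reads p
≤ H/τ₀, so H(x) ≤ (b - x) b H(x)/τ₀ for x ≥ 0; close to b this forces H = 0, against positivity of p
there. -/
theorem not_bddAbove_support_of_steinKernel_ge (h0 : ∀ x, 0 ≤ p x)
    (hyp : Integrable fun y => y * p y) (hmean : ∫ y, y * p y = 0) (hne : ¬ p =ᵐ[volume] 0)
    (hS : (Function.support p).OrdConnected) (hτ₀ : 0 < τ₀)
    (hτ : ∀ᵐ x, 0 < p x → τ₀ * p x ≤ ∫ y in Set.Ioi x, y * p y) :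
    ¬ BddAbove (Function.support p) := by
  intro hb
  obtain ⟨s₁, hs₁, hps₁⟩ := exists_pos_mem_support h0 hyp hmean hne
  -- A point of the support left of x₁ ≥ 0 is needed at the end, to place a whole interval beyond x₁
  -- inside the support.
  obtain ⟨s₀, hs₀, hps₀⟩ : ∃ s, s < 0 ∧ 0 < p s := by
    have hyp' : Integrable fun y => y * p (-y) := by
      have := hyp.comp_neg.neg
      refine this.congr (ae_of_all _ fun y => ?_)
      simp
    have hmean' : ∫ y, y * p (-y) = 0 := by
      have := integral_neg_eq_self (fun y => y * p y) volume
      rw [hmean] at this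
      have h2 : (fun y => y * p (-y)) = fun y => -(-y * p (-y)) := by ext y; ring
      rw [h2, integral_neg, this, neg_zero]
    obtain ⟨s, hs, hps⟩ := exists_pos_mem_support (p := fun y => p (-y)) (fun x => h0 _) hyp' hmean'
      (fun h => hne (by
        have := (Measure.measurePreserving_neg (volume : Measure ℝ)).quasiMeasurePreserving.ae h
        filter_upwards [this] with y hy
        simpa using hy))
    exact ⟨-s, by linarith, hps⟩
  set b := sSup (Function.support p) with hbdef
  have hleb : ∀ x, 0 < p x → x ≤ b := fun x hx => le_csSup hb hx.ne'
  have hb0 : 0 < b := hs₁.trans_le (hleb _ hps₁)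
  -- Chosen so that (b - x₁) b ≤ τ₀/2, and nonnegative so that y p(y) ≥ 0 beyond it.
  set x₁ := max 0 (b - τ₀ / (2 * b)) with hx₁
  have hx₁0 : 0 ≤ x₁ := le_max_left _ _
  have hx₁b : x₁ < b := max_lt hb0 (by have : 0 < τ₀ / (2 * b) := by positivity
                                       linarith)
  have hx₁b' : (b - x₁) * b ≤ τ₀ / 2 := by
    have : b - x₁ ≤ τ₀ / (2 * b) := by linarith [le_max_right 0 (b - τ₀ / (2 * b))]
    calc (b - x₁) * b ≤ τ₀ / (2 * b) * b := by gcongr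
      _ = τ₀ / 2 := by field_simp
  set H : ℝ → ℝ := fun x => ∫ y in Set.Ioi x, y * p y with hH
  have hnn : ∀ x, 0 ≤ x → ∀ y ∈ Set.Ioi x, 0 ≤ y * p y := fun x hx y hy =>
    mul_nonneg (hx.trans (le_of_lt hy)) (h0 y)
  have hHnn : 0 ≤ H x₁ := setIntegral_nonneg measurableSet_Ioi (hnn x₁ hx₁0)
  have hHmono : ∀ x, x₁ ≤ x → H x ≤ H x₁ := fun x hx =>
    setIntegral_mono_set hyp.integrableOn
      ((ae_restrict_iff' measurableSet_Ioi).2 (ae_of_all _ (hnn x₁ hx₁0)))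
      (Filter.Eventually.of_forall (Set.Ioi_subset_Ioi hx))
  have hHeq : H x₁ = ∫ y in Set.Ioc x₁ b, y * p y := by
    rw [hH]
    simp only
    rw [← Set.Ioc_union_Ioi_eq_Ioi hx₁b.le, setIntegral_union (Set.Ioc_disjoint_Ioi le_rfl)
      measurableSet_Ioi hyp.integrableOn hyp.integrableOn,
      setIntegral_eq_zero_of_forall_eq_zero (t := Set.Ioi b), add_zero]
    intro y hy
    have : p y = 0 := by
      by_contra hpy
      exact absurd (hleb y (lt_of_le_of_ne (h0 y) (Ne.symm hpy))) (not_le.2 hy)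
    rw [this, mul_zero]
  have hHle : H x₁ ≤ (b - x₁) * (b * (H x₁ / τ₀)) := by
    calc H x₁ = ∫ y in Set.Ioc x₁ b, y * p y := hHeq
      _ ≤ ∫ y in Set.Ioc x₁ b, b * (H x₁ / τ₀) := by
        refine setIntegral_mono_on_ae hyp.integrableOn (integrableOn_const (by simp)) measurableSet_Ioc ?_
        filter_upwards [hτ] with y hy hyI
        rcases (h0 y).eq_or_lt with hpy | hpy
        · rw [← hpy, mul_zero]; positivity
        · have h1 : p y ≤ H x₁ / τ₀ := by
            rw [le_div_iff₀ hτ₀, mul_comm]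
            exact (hy hpy).trans (hHmono y hyI.1.le)
          exact mul_le_mul hyI.2 h1 hpy.le hb0.le
      _ = _ := by simp [hx₁b.le]
  have hHz : H x₁ = 0 := by
    refine le_antisymm ?_ hHnn
    have h1 : (b - x₁) * (b * (H x₁ / τ₀)) = ((b - x₁) * b) * H x₁ / τ₀ := by ring
    have h2 : ((b - x₁) * b) * H x₁ / τ₀ ≤ H x₁ / 2 := by
      rw [div_le_iff₀ hτ₀]
      nlinarith
    linarith
  have hae : ∀ᵐ y, y ∈ Set.Ioi x₁ → y * p y = 0 := by
    have := (setIntegral_eq_zero_iff_of_nonneg_ae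
      ((ae_restrict_iff' measurableSet_Ioi).2 (ae_of_all _ (hnn x₁ hx₁0))) hyp.integrableOn).1 hHz
    exact (ae_restrict_iff' measurableSet_Ioi).1 this
  obtain ⟨s, hs, hxs⟩ := exists_lt_of_lt_csSup ⟨s₁, hps₁.ne'⟩ hx₁b
  have hvol : volume (Set.Ioo x₁ s) = 0 := by
    refine measure_mono_null ?_ (ae_iff.1 hae)
    intro y hy
    simp only [Set.mem_ofPred_eq, Classical.not_imp]
    refine ⟨hy.1, mul_ne_zero (hx₁0.trans_lt hy.1).ne' ?_⟩
    exact hS.out (x := s₀) (y := s) hps₀.ne' hs ⟨(hs₀.trans_le hx₁0).le.trans hy.1.le, hy.2.le⟩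
  rw [Real.volume_Ioo, ENNReal.ofReal_eq_zero] at hvol
  linarith

/-- The hypotheses are invariant under y ↦ -y, so the support is unbounded on both sides; being an
interval, it is the line. -/
theorem support_eq_univ_of_steinKernel_ge (h0 : ∀ x, 0 ≤ p x)
    (hyp : Integrable fun y => y * p y) (hmean : ∫ y, y * p y = 0) (hne : ¬ p =ᵐ[volume] 0)
    (hS : (Function.support p).OrdConnected) (hτ₀ : 0 < τ₀)
    (hτ : ∀ᵐ x, 0 < p x → τ₀ * p x ≤ ∫ y in Set.Ioi x, y * p y) :
    Function.support p = Set.univ := by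
  have h1 := not_bddAbove_support_of_steinKernel_ge h0 hyp hmean hne hS hτ₀ hτ
  have h2 : ¬ BddBelow (Function.support p) := by
    have hyp' : Integrable fun y => y * p (-y) := by
      have := hyp.comp_neg.neg
      refine this.congr (ae_of_all _ fun y => ?_)
      simp
    have hmean' : ∫ y, y * p (-y) = 0 := by
      have := integral_neg_eq_self (fun y => y * p y) volume
      rw [hmean] at this
      have h2 : (fun y => y * p (-y)) = fun y => -(-y * p (-y)) := by ext y; ring
      rw [h2, integral_neg, this, neg_zero]
    -- This is where the mean zero makes the bound symmetric: the two tail integrals of y p(y) are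
    -- opposite.
    have hrefl : ∀ x, ∫ y in Set.Ioi x, y * p (-y) = ∫ y in Set.Ioi (-x), y * p y := by
      intro x
      have e1 : (fun y => y * p (-y)) = fun y => -((fun z => z * p z) (-y)) := by ext y; simp
      have e2 := integral_add_compl (measurableSet_Iic (a := -x)) hyp
      rw [hmean, Set.compl_Iic] at e2
      rw [e1, integral_neg, integral_comp_neg_Ioi x (fun z => z * p z)]
      linarith
    have hnb := not_bddAbove_support_of_steinKernel_ge (p := fun y => p (-y)) (τ₀ := τ₀)
      (fun x => h0 _) hyp' hmean' (fun h => hne (by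
        have := (Measure.measurePreserving_neg (volume : Measure ℝ)).quasiMeasurePreserving.ae h
        filter_upwards [this] with y hy
        simpa using hy)) ⟨fun x hx y hy z hz => hS.out (x := -y) (y := -x) hy hx
          ⟨by linarith [hz.2], by linarith [hz.1]⟩⟩ hτ₀ (by
        have := (Measure.measurePreserving_neg (volume : Measure ℝ)).quasiMeasurePreserving.ae hτ
        filter_upwards [this] with y hy hpy
        rw [hrefl]
        exact hy hpy)
    intro ⟨c, hc⟩
    refine hnb ⟨-c, fun x hx => ?_⟩
    have := hc (show -x ∈ Function.support p from hx)
    linarith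
  ext x
  simp only [Set.mem_univ, iff_true]
  obtain ⟨u, hu, hxu⟩ := not_bddAbove_iff.1 h1 x
  obtain ⟨l, hl, hlx⟩ := not_bddBelow_iff.1 h2 x
  exact hS.out hl hu ⟨hlx.le, hxu.le⟩

end

/-- p is continuous inside the interval and zero outside; the frontier of a convex set is null. -/
theorem IsDiffIntervalDensity.aemeasurable {Ω : Type*} [MeasurableSpace Ω] {P : Measure Ω}
    {Y : Ω → ℝ} {p : ℝ → ℝ} (h : IsDiffIntervalDensity P Y p) : AEMeasurable p := by
  have hc : ContinuousOn p (interior (Function.support p)) := h.differentiableOn.continuousOn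
  have hm : Measurable ((interior (Function.support p)).indicator p) := by
    classical
    rw [← Set.piecewise_eq_indicator]
    exact (hc.measurable_piecewise continuousOn_const isOpen_interior.measurableSet)
  refine ⟨_, hm, ?_⟩
  have hfr : volume (frontier (Function.support p)) = 0 :=
    (h.ordConnected.convex).addHaar_frontier volume
  have : ∀ᵐ x, x ∉ frontier (Function.support p) := by
    rw [ae_iff]; simpa using hfr
  filter_upwards [this] with x hx
  by_cases hxi : x ∈ interior (Function.support p)
  · simp [hxi]
  · have hx2 : x ∉ Function.support p := fun hxs => hx ⟨subset_closure hxs, hxi⟩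
    rw [Set.indicator_of_notMem hxi]
    simpa using hx2

/-- The regularity of a centred distribution with density `p` that is positive on the line and
differentiable, with Stein kernel bounded below by `τ₀`. -/
structure HasRegularSteinKernel {Ω : Type*} [MeasurableSpace Ω] (P : Measure Ω)
    (Y : Ω → ℝ) (p : ℝ → ℝ) (τ₀ : ℝ) : Prop where
  pos : ∀ x, 0 < p x
  continuous : Continuous p
  map_eq : P.map Y = (volume : Measure ℝ).withDensity (fun x => ENNReal.ofReal (p x))
  hasDerivAt : ∀ x, HasDerivAt (steinKernel p) (deriv (steinKernel p) x) x
  ge : ∀ x, τ₀ ≤ steinKernel p x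
  hasDerivAt_mul : ∀ x, HasDerivAt (fun x => p x * steinKernel p x) (-(x * p x)) x

/-- Once the support is all of ℝ, p is differentiable everywhere, hence so is the quotient τ.
Continuity then turns the almost sure lower bound into a pointwise one. -/
theorem IsDiffIntervalDensity.hasRegularSteinKernel {Ω : Type*} [MeasurableSpace Ω]
    {P : Measure Ω} [IsProbabilityMeasure P] {Y : Ω → ℝ} {p : ℝ → ℝ} {τ₀ : ℝ}
    (h : IsDiffIntervalDensity P Y p) (hY : Measurable Y) (hYi : Integrable Y P)
    (hmean : ∫ ω, Y ω ∂P = 0) (hτ₀ : 0 < τ₀) (hτ : ∀ᵐ ω ∂P, τ₀ ≤ steinKernel p (Y ω)) :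
    HasRegularSteinKernel P Y p τ₀ := by
  have hpm := h.aemeasurable
  have hyp : Integrable fun y => y * p y := by
    have : Integrable (fun y : ℝ => y) (P.map Y) :=
      (integrable_map_measure aestronglyMeasurable_id hY.aemeasurable).2 hYi
    rw [h.map_eq, integrable_withDensity_ofReal hpm h.nonneg] at this
    simpa only [mul_comm] using this
  have hm0 : ∫ y, y * p y = 0 := by
    rw [← hmean]
    have := integral_map (μ := P) (f := fun y : ℝ => y) hY.aemeasurable aestronglyMeasurable_id
    rw [← this, h.map_eq, integral_withDensity_ofReal hpm h.nonneg]
    simp only [mul_comm]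
  have hne : ¬ p =ᵐ[volume] 0 := by
    intro h0
    have hz : P.map Y = 0 := by
      rw [h.map_eq, withDensity_eq_zero_iff hpm.ennreal_ofReal]
      filter_upwards [h0] with x hx
      simp [hx]
    exact IsProbabilityMeasure.ne_zero P ((Measure.map_eq_zero_iff hY.aemeasurable).1 hz)
  have hst : ∀ x, steinKernel p x = (∫ y in Set.Ioi x, y * p y) / p x := by
    intro x
    simp only [steinKernel, hm0, sub_zero]
  -- The bound is transferred from Ω to Lebesgue-almost every point of the support through a
  -- measurable version of the kernel.
  have hae : ∀ᵐ x, 0 < p x → τ₀ ≤ steinKernel p x := by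
    have hmeas : AEMeasurable (steinKernel p) (volume : Measure ℝ) := by
      have h1 : Continuous fun x => ∫ y in Set.Ioi x, y * p y := by
        have h2 : (fun x => ∫ y in Set.Ioi x, y * p y) =
            fun x => (∫ y in Set.Ioi (0 : ℝ), y * p y) - ∫ y in (0 : ℝ)..x, y * p y := by
          ext x
          rw [← intervalIntegral.integral_Ioi_sub_Ioi' hyp.integrableOn hyp.integrableOn]
          ring
        rw [h2]
        exact continuous_const.sub
          (intervalIntegral.continuous_primitive (fun a b => hyp.intervalIntegrable) 0)
      have h3 : steinKernel p = fun x => (∫ y in Set.Ioi x, y * p y) / p x := funext hst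
      rw [h3]
      exact h1.measurable.aemeasurable.div hpm
    have hmap : AEMeasurable (steinKernel p) (P.map Y) := by
      rw [h.map_eq]
      exact hmeas.mono_ac (withDensity_absolutelyContinuous _ _)
    rw [← ae_withDensity_ofReal hpm, ← h.map_eq]
    have hmk : ∀ᵐ x ∂(P.map Y), τ₀ ≤ hmap.mk _ x := by
      rw [ae_map_iff hY.aemeasurable (measurableSet_le measurable_const hmap.measurable_mk)]
      filter_upwards [hτ, ae_of_ae_map hY.aemeasurable hmap.ae_eq_mk] with ω h1 h2
      rwa [← h2]
    filter_upwards [hmk, hmap.ae_eq_mk] with x h1 h2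
    rwa [h2]
  have hsupp := support_eq_univ_of_steinKernel_ge h.nonneg hyp hm0 hne h.ordConnected hτ₀ (by
    filter_upwards [hae] with x hx hpx
    have := hx hpx
    rwa [hst, le_div_iff₀ hpx] at this)
  have hpos : ∀ x, 0 < p x := fun x =>
    lt_of_le_of_ne (h.nonneg x) (Ne.symm (by
      have : x ∈ Function.support p := hsupp ▸ Set.mem_univ x
      exact this))
  have hdiff : Differentiable ℝ p := by
    have := h.differentiableOn
    rw [hsupp, interior_univ, differentiableOn_univ] at this
    exact this
  have hH : ∀ x, HasDerivAt (fun x => ∫ y in Set.Ioi x, y * p y) (-(x * p x)) x := by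
    intro x
    have h2 : (fun x => ∫ y in Set.Ioi x, y * p y) =
        fun x => (∫ y in Set.Ioi (0 : ℝ), y * p y) - ∫ y in (0 : ℝ)..x, y * p y := by
      ext x
      rw [← intervalIntegral.integral_Ioi_sub_Ioi' hyp.integrableOn hyp.integrableOn]
      ring
    have hc : Continuous fun y => y * p y := continuous_id.mul hdiff.continuous
    rw [h2]
    exact (intervalIntegral.integral_hasDerivAt_right (hc.intervalIntegrable _ _)
      (hc.stronglyMeasurableAtFilter _ _) hc.continuousAt).const_sub _
  have hst' : steinKernel p = fun x => (∫ y in Set.Ioi x, y * p y) / p x := funext hst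
  have hdst : ∀ x, HasDerivAt (steinKernel p) (deriv (steinKernel p) x) x := by
    intro x
    refine DifferentiableAt.hasDerivAt ?_
    rw [hst']
    exact (hH x).differentiableAt.div (hdiff x) (hpos x).ne'
  have hcst : Continuous (steinKernel p) :=
    continuous_iff_continuousAt.2 fun x => (hdst x).continuousAt
  refine ⟨hpos, hdiff.continuous, h.map_eq, hdst, ?_, ?_⟩
  · have h1 : (fun x => max τ₀ (steinKernel p x)) = steinKernel p := by
      refine (continuous_const.max hcst).ae_eq_iff_eq volume hcst |>.1 ?_
      filter_upwards [hae] with x hx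
      exact max_eq_right (hx (hpos x))
    intro x
    rw [← h1]
    exact le_max_left _ _
  · intro x
    have : (fun x => p x * steinKernel p x) = fun x => ∫ y in Set.Ioi x, y * p y := by
      ext x
      rw [hst, mul_div_cancel₀ _ (hpos x).ne']
    rw [this]
    exact hH x

/-! ### Stein's identity in one variable. -/

namespace HasRegularSteinKernel

variable {Ω : Type*} [MeasurableSpace Ω] {P : Measure Ω} {Y : Ω → ℝ} {p : ℝ → ℝ} {τ₀ : ℝ}

theorem continuous_steinKernel (h : HasRegularSteinKernel P Y p τ₀) :
    Continuous (steinKernel p) :=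
  continuous_iff_continuousAt.2 fun x => (h.hasDerivAt x).continuousAt

theorem ae_ne (h : HasRegularSteinKernel P Y p τ₀) (hY : Measurable Y) (c : ℝ) :
    ∀ᵐ ω ∂P, Y ω ≠ c := by
  refine ae_of_ae_map (p := fun x => x ≠ c) hY.aemeasurable ?_
  rw [h.map_eq]
  have hc : ∀ᵐ x : ℝ, x ≠ c := by simp [ae_iff]
  exact (withDensity_absolutelyContinuous _ _).ae_le hc

/-- Stein's identity `E[Y Φ(Y, Z)] = E[τ(Y) ∂₁Φ(Y, Z)]` for `Z` independent of `Y`. -/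
theorem integral_mul_eq [IsProbabilityMeasure P] (h : HasRegularSteinKernel P Y p τ₀)
    (hY : Measurable Y) {E : Type*} [MeasurableSpace E] {Z : Ω → E} (hZ : Measurable Z)
    (hYZ : IndepFun Y Z P) {Φ Ψ : ℝ → E → ℝ} (hΦ : Measurable (Function.uncurry Φ))
    (hΨ : Measurable (Function.uncurry Ψ))
    (hder : ∀ᵐ z ∂(P.map Z), ∀ t, HasDerivAt (fun t => Φ t z) (Ψ t z) t)
    (i1 : Integrable (fun ω => Y ω * Φ (Y ω) (Z ω)) P)
    (i2 : Integrable (fun ω => steinKernel p (Y ω) * Φ (Y ω) (Z ω)) P)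
    (i3 : Integrable (fun ω => steinKernel p (Y ω) * Ψ (Y ω) (Z ω)) P) :
    ∫ ω, Y ω * Φ (Y ω) (Z ω) ∂P = ∫ ω, steinKernel p (Y ω) * Ψ (Y ω) (Z ω) ∂P := by
  have hpm : AEMeasurable p := h.continuous.aemeasurable
  have hp0 : ∀ x, 0 ≤ p x := fun x => (h.pos x).le
  have hτm := h.continuous_steinKernel.measurable
  have hYP : IsProbabilityMeasure (P.map Y) := Measure.isProbabilityMeasure_map hY.aemeasurable
  have hZP : IsProbabilityMeasure (P.map Z) := Measure.isProbabilityMeasure_map hZ.aemeasurable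
  have hprod := (indepFun_iff_map_prod_eq_prod_map_map hY.aemeasurable hZ.aemeasurable).1 hYZ
  have hpair : AEMeasurable (fun ω => (Y ω, Z ω)) P := (hY.prodMk hZ).aemeasurable
  have m1 : Measurable fun z : ℝ × E => z.1 * Φ z.1 z.2 := measurable_fst.mul hΦ
  have m2 : Measurable fun z : ℝ × E => steinKernel p z.1 * Φ z.1 z.2 :=
    (hτm.comp measurable_fst).mul hΦ
  have m3 : Measurable fun z : ℝ × E => steinKernel p z.1 * Ψ z.1 z.2 :=
    (hτm.comp measurable_fst).mul hΨ
  have j1 : Integrable (fun z : ℝ × E => z.1 * Φ z.1 z.2) ((P.map Y).prod (P.map Z)) := by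
    rw [← hprod]
    exact (integrable_map_measure m1.aestronglyMeasurable hpair).2 i1
  have j2 : Integrable (fun z : ℝ × E => steinKernel p z.1 * Φ z.1 z.2)
      ((P.map Y).prod (P.map Z)) := by
    rw [← hprod]
    exact (integrable_map_measure m2.aestronglyMeasurable hpair).2 i2
  have j3 : Integrable (fun z : ℝ × E => steinKernel p z.1 * Ψ z.1 z.2)
      ((P.map Y).prod (P.map Z)) := by
    rw [← hprod]
    exact (integrable_map_measure m3.aestronglyMeasurable hpair).2 i3
  have e1 := integral_map hpair m1.aestronglyMeasurable
  have e3 := integral_map hpair m3.aestronglyMeasurable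
  rw [hprod, integral_prod_symm _ j1] at e1
  rw [hprod, integral_prod_symm _ j3] at e3
  rw [← e1, ← e3]
  refine integral_congr_ae ?_
  filter_upwards [hder, j1.prod_left_ae, j2.prod_left_ae, j3.prod_left_ae] with z hz k1 k2 k3
  rw [h.map_eq, integrable_withDensity_ofReal hpm hp0] at k1 k2 k3
  rw [h.map_eq, integral_withDensity_ofReal hpm hp0, integral_withDensity_ofReal hpm hp0]
  -- With z frozen, (pτ)' = -tp makes the difference of the two integrands the derivative of pτΦ.
  -- Integrability of pτΦ itself (from `i2`) makes the total integral vanish, with no condition at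
  -- infinity.
  have hd : ∀ t, HasDerivAt (fun t => p t * (steinKernel p t * Φ t z))
      (p t * (steinKernel p t * Ψ t z) - p t * (t * Φ t z)) t := by
    intro t
    have := (h.hasDerivAt_mul t).mul (hz t)
    refine (this.congr_deriv ?_).congr_of_eventuallyEq (Filter.Eventually.of_forall fun t => ?_)
    · ring
    · simp only [Pi.mul_apply]; ring
  have := integral_eq_zero_of_hasDerivAt_of_integrable hd (k3.sub k1) k2
  rw [integral_sub k3 k1] at this
  linarith

end HasRegularSteinKernel

/-! ### Sums of functions of independent variables -/

/-- The σ-algebra generated by the variables `X j`, `j ∈ S`. -/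
@[reducible] def sigmaOf {Ω : Type*} (X : ℕ → Ω → ℝ) (S : Set ℕ) : MeasurableSpace Ω :=
  ⨆ j ∈ S, MeasurableSpace.comap (X j) inferInstance

theorem measurable_sigmaOf {Ω : Type*} {X : ℕ → Ω → ℝ} {S : Set ℕ} {j : ℕ} (hj : j ∈ S) : Measurable[sigmaOf X S] (X j) :=
  (comap_measurable (X j)).mono (le_iSup₂_of_le j hj le_rfl) le_rfl

theorem measurable_sigmaOf_mono {Ω : Type*} {X : ℕ → Ω → ℝ} {S T : Set ℕ} (hST : S ⊆ T) {E : Type*} [MeasurableSpace E]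
    {f : Ω → E} (hf : Measurable[sigmaOf X S] f) : Measurable[sigmaOf X T] f :=
  hf.mono (iSup₂_le fun j hj => le_iSup₂_of_le j (hST hj) le_rfl) le_rfl

theorem measurable_sum_ite {Ω : Type*} {X : ℕ → Ω → ℝ} {Z : ℕ → Ω → ℝ} (hZm : ∀ k, Measurable[sigmaOf X {k}] (Z k)) (n : ℕ)
    (c : ℕ → ℝ) (S : Set ℕ) [DecidablePred (· ∈ S)] :
    Measurable[sigmaOf X S] fun ω => ∑ u ∈ Finset.range n, (if u ∈ S then c u else 0) * Z u ω := by
  refine Finset.measurable_fun_sum _ fun u _ => ?_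
  by_cases hu : u ∈ S
  · simp only [if_pos hu]
    exact (measurable_sigmaOf_mono (by simpa using hu) (hZm u)).const_mul _
  · simp only [if_neg hu, zero_mul]
    exact measurable_const

section

variable {Ω : Type*} [mΩ : MeasurableSpace Ω] {P : Measure Ω} {X : ℕ → Ω → ℝ}

theorem sigmaOf_le (hX : ∀ k, Measurable (X k)) (S : Set ℕ) : sigmaOf X S ≤ mΩ :=
  iSup₂_le fun j _ => (hX j).comap_le

theorem indepFun_of_sigmaOf (hX : ∀ k, Measurable (X k)) (hind : iIndepFun X P) {S T : Set ℕ}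
    (hST : Disjoint S T) {E E' : Type*} [mE : MeasurableSpace E] [mE' : MeasurableSpace E']
    {f : Ω → E} {g : Ω → E'} (hf : Measurable[sigmaOf X S] f) (hg : Measurable[sigmaOf X T] g) :
    IndepFun f g P := by
  have h := indep_iSup_of_disjoint (fun j => (hX j).comap_le) hind hST
  rw [IndepFun_iff_Indep]
  exact indep_of_indep_of_le_left (indep_of_indep_of_le_right h hg.comap_le) hf.comap_le

variable [IsProbabilityMeasure P]

namespace MomentBound

/-- The coefficient of `Y k` depends only on earlier variables, so disjoint blocks of indices supply
the required independence. -/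
theorem sum_forward (hX : ∀ k, Measurable (X k)) (hind : iIndepFun X P) {j : ℕ}
    (hj : j = 1 ∨ j = 2) {Y R : ℕ → Ω → ℝ} {b : ℝ} {r : ℕ → ℝ} (n : ℕ)
    (hYm : ∀ k, Measurable[sigmaOf X {k}] (Y k)) (hY : ∀ k, MomentBound P j (Y k) b)
    (hmean : ∀ k, ∫ ω, Y k ω ∂P = 0) (hRm : ∀ k, Measurable[sigmaOf X (Set.Iio k)] (R k))
    (hR : ∀ k < n, MomentBound P j (R k) (r k)) :
    MomentBound P j (fun ω => ∑ k ∈ Finset.range n, Y k ω * R k ω)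
      (16 * b * √(∑ k ∈ Finset.range n, r k ^ 2)) := by
  have h := sum_mul_predictable hj n (fun k _ => hY k) hR (fun k _ => ?_) (fun k _ => hmean k)
  · rwa [abs_of_nonneg (hY 0).nonneg] at h
  · refine indepFun_of_sigmaOf hX hind (S := {k}) (T := Set.Iio k) (by simp) (hYm k) ?_
    refine (hRm k).prodMk (Finset.measurable_fun_sum _ fun i hi => ?_)
    have hik : i < k := Finset.mem_range.1 hi
    exact (measurable_sigmaOf_mono (by simpa using hik) (hYm i)).mul
      (measurable_sigmaOf_mono (Set.Iio_subset_Iio hik.le) (hRm i))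

/-- The same martingale structure with time reversed by k ↦ n - 1 - k. -/
theorem sum_backward (hX : ∀ k, Measurable (X k)) (hind : iIndepFun X P) {j : ℕ}
    (hj : j = 1 ∨ j = 2) {Y R : ℕ → Ω → ℝ} {b : ℝ} {r : ℕ → ℝ} (n : ℕ)
    (hYm : ∀ k, Measurable[sigmaOf X {k}] (Y k)) (hY : ∀ k, MomentBound P j (Y k) b)
    (hmean : ∀ k, ∫ ω, Y k ω ∂P = 0) (hRm : ∀ k, Measurable[sigmaOf X (Set.Ioi k)] (R k))
    (hR : ∀ k < n, MomentBound P j (R k) (r k)) :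
    MomentBound P j (fun ω => ∑ k ∈ Finset.range n, Y k ω * R k ω)
      (16 * b * √(∑ k ∈ Finset.range n, r k ^ 2)) := by
  have h := sum_mul_predictable hj (Y := fun k => Y (n - 1 - k)) (R := fun k => R (n - 1 - k))
    (r := fun k => r (n - 1 - k)) n (fun k _ => hY _) (fun k hk => hR _ (by omega))
    (fun k hk => ?_) (fun k _ => hmean _)
  · rw [abs_of_nonneg (hY 0).nonneg, Finset.sum_range_reflect (fun k => r k ^ 2)] at h
    refine h.congr (ae_of_all _ fun ω => ?_)
    exact Finset.sum_range_reflect (fun k => Y k ω * R k ω) n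
  · refine indepFun_of_sigmaOf hX hind (S := {n - 1 - k}) (T := Set.Ioi (n - 1 - k)) (by simp)
      (hYm _) ?_
    refine (hRm _).prodMk (Finset.measurable_fun_sum _ fun i hi => ?_)
    have hik : n - 1 - k < n - 1 - i := by have := Finset.mem_range.1 hi; omega
    exact (measurable_sigmaOf_mono (by simpa using hik) (hYm _)).mul
      (measurable_sigmaOf_mono (Set.Ioi_subset_Ioi hik.le) (hRm _))

theorem sum_linear (hX : ∀ k, Measurable (X k)) (hind : iIndepFun X P) {j : ℕ}
    (hj : j = 1 ∨ j = 2) {Y : ℕ → Ω → ℝ} {b : ℝ} (n : ℕ)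
    (hYm : ∀ k, Measurable[sigmaOf X {k}] (Y k)) (hY : ∀ k, MomentBound P j (Y k) b)
    (hmean : ∀ k, ∫ ω, Y k ω ∂P = 0) (c : ℕ → ℝ) :
    MomentBound P j (fun ω => ∑ k ∈ Finset.range n, c k * Y k ω)
      (16 * b * √(∑ k ∈ Finset.range n, c k ^ 2)) := by
  have h := sum_forward hX hind hj n hYm hY hmean (R := fun k _ => c k) (r := fun k => |c k|)
    (fun k => measurable_const) (fun k _ => const (c k))
  simp only [sq_abs] at h
  simpa only [mul_comm (c _)] using h

theorem sum_ite_sq_le (n : ℕ) (c : ℕ → ℝ) (S : Set ℕ) [DecidablePred (· ∈ S)] :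
    ∑ u ∈ Finset.range n, (if u ∈ S then c u else 0) ^ 2 ≤ ∑ u ∈ Finset.range n, c u ^ 2 := by
  refine Finset.sum_le_sum fun u _ => ?_
  split_ifs
  · exact le_rfl
  · simpa using sq_nonneg (c u)

theorem sum_linear_ite (hX : ∀ k, Measurable (X k)) (hind : iIndepFun X P) {j : ℕ}
    (hj : j = 1 ∨ j = 2) {Y : ℕ → Ω → ℝ} {b : ℝ} (n : ℕ)
    (hYm : ∀ k, Measurable[sigmaOf X {k}] (Y k)) (hY : ∀ k, MomentBound P j (Y k) b)
    (hmean : ∀ k, ∫ ω, Y k ω ∂P = 0) (c : ℕ → ℝ) (S : Set ℕ) [DecidablePred (· ∈ S)] :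
    MomentBound P j (fun ω => ∑ u ∈ Finset.range n, (if u ∈ S then c u else 0) * Y u ω)
      (16 * b * √(∑ k ∈ Finset.range n, c k ^ 2)) := by
  refine (sum_linear hX hind hj n hYm hY hmean _).mono ?_
  have := (hY 0).nonneg
  exact mul_le_mul_of_nonneg_left (Real.sqrt_le_sqrt (sum_ite_sq_le n c S)) (by positivity)

theorem sum_split (n k : ℕ) (c z : ℕ → ℝ) (hc : c k = 0) :
    ∑ u ∈ Finset.range n, c u * z u =
      ∑ u ∈ Finset.range n, (if u ∈ Set.Iio k then c u else 0) * z u +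
      ∑ u ∈ Finset.range n, (if u ∈ Set.Ioi k then c u else 0) * z u := by
  rw [← Finset.sum_add_distrib]
  refine Finset.sum_congr rfl fun u _ => ?_
  rcases lt_trichotomy u k with h | rfl | h
  · simp [h, h.le]
  · simp [hc]
  · simp [h, h.le]

/-- Without diagonal terms, each inner sum splits into the variables before k and those after k: a
forward and a backward martingale, hence 512 = 2 · 16². -/
theorem sum_bilinear (hX : ∀ k, Measurable (X k)) (hind : iIndepFun X P) {j : ℕ}
    (hj : j = 1 ∨ j = 2) {Y Z : ℕ → Ω → ℝ} {b b' : ℝ} (n : ℕ)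
    (hYm : ∀ k, Measurable[sigmaOf X {k}] (Y k)) (hY : ∀ k, MomentBound P j (Y k) b)
    (hYmean : ∀ k, ∫ ω, Y k ω ∂P = 0)
    (hZm : ∀ k, Measurable[sigmaOf X {k}] (Z k)) (hZ : ∀ k, MomentBound P j (Z k) b')
    (hZmean : ∀ k, ∫ ω, Z k ω ∂P = 0) (c : ℕ → ℕ → ℝ) (hc : ∀ k, c k k = 0) :
    MomentBound P j
      (fun ω => ∑ k ∈ Finset.range n, Y k ω * ∑ u ∈ Finset.range n, c k u * Z u ω)
      (512 * b * b' * √(∑ k ∈ Finset.range n, ∑ u ∈ Finset.range n, c k u ^ 2)) := by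
  have hb' := (hZ 0).nonneg
  have h1 := sum_forward hX hind hj n hYm hY hYmean
    (R := fun k ω => ∑ u ∈ Finset.range n, (if u ∈ Set.Iio k then c k u else 0) * Z u ω)
    (fun k => measurable_sum_ite hZm n (c k) (Set.Iio k))
    (fun k _ => sum_linear_ite hX hind hj n hZm hZ hZmean (c k) (Set.Iio k))
  have h2 := sum_backward hX hind hj n hYm hY hYmean
    (R := fun k ω => ∑ u ∈ Finset.range n, (if u ∈ Set.Ioi k then c k u else 0) * Z u ω)
    (fun k => measurable_sum_ite hZm n (c k) (Set.Ioi k))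
    (fun k _ => sum_linear_ite hX hind hj n hZm hZ hZmean (c k) (Set.Ioi k))
  have h3 := add (by omega) h1 h2
  have hs : √(∑ k ∈ Finset.range n, (16 * b' * √(∑ u ∈ Finset.range n, c k u ^ 2)) ^ 2)
      = 16 * b' * √(∑ k ∈ Finset.range n, ∑ u ∈ Finset.range n, c k u ^ 2) := by
    have : ∀ k, (16 * b' * √(∑ u ∈ Finset.range n, c k u ^ 2)) ^ 2
        = (16 * b') ^ 2 * ∑ u ∈ Finset.range n, c k u ^ 2 := fun k => by
      rw [mul_pow, Real.sq_sqrt (Finset.sum_nonneg fun _ _ => sq_nonneg _)]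
    simp only [this]
    rw [← Finset.mul_sum, Real.sqrt_mul (sq_nonneg _), Real.sqrt_sq (by positivity)]
  rw [hs] at h3
  refine (h3.congr (ae_of_all _ fun ω => ?_)).mono (le_of_eq (by ring))
  simp only
  rw [← Finset.sum_add_distrib]
  refine Finset.sum_congr rfl fun k _ => ?_
  rw [← mul_add, ← sum_split n k (c k) (fun u => Z u ω) (hc k)]

/-- The form `∑ₖ Yₖ (∑ᵥ cₖᵥ Zᵥ)²`. -/
theorem sum_mul_linear_sq (hX : ∀ k, Measurable (X k)) (hind : iIndepFun X P)
    {Y Z : ℕ → Ω → ℝ} {b b' : ℝ} (n : ℕ)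
    (hYm : ∀ k, Measurable[sigmaOf X {k}] (Y k)) (hY : ∀ k, MomentBound P 1 (Y k) b)
    (hYmean : ∀ k, ∫ ω, Y k ω ∂P = 0)
    (hZm : ∀ k, Measurable[sigmaOf X {k}] (Z k)) (hZ : ∀ k, MomentBound P 1 (Z k) b')
    (hZmean : ∀ k, ∫ ω, Z k ω ∂P = 0) (c : ℕ → ℕ → ℝ) (hc : ∀ k, c k k = 0) :
    MomentBound P 2
      (fun ω => ∑ k ∈ Finset.range n, Y k ω * (∑ u ∈ Finset.range n, c k u * Z u ω) ^ 2)
      (16384 * b * b' ^ 2 * √(∑ k ∈ Finset.range n, (∑ u ∈ Finset.range n, c k u ^ 2) ^ 2)) := by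
  have hb := (hY 0).nonneg
  have hb' := (hZ 0).nonneg
  have hA : ∀ k, 0 ≤ ∑ u ∈ Finset.range n, c k u ^ 2 :=
    fun k => Finset.sum_nonneg fun _ _ => sq_nonneg _
  have hY2 : ∀ k, MomentBound P 2 (Y k) b := fun k => (hY k).mono_weight (by norm_num)
  set Ll : ℕ → Ω → ℝ :=
    fun k ω => ∑ u ∈ Finset.range n, (if u ∈ Set.Iio k then c k u else 0) * Z u ω with hLl
  set Lg : ℕ → Ω → ℝ :=
    fun k ω => ∑ u ∈ Finset.range n, (if u ∈ Set.Ioi k then c k u else 0) * Z u ω with hLg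
  have mLl : ∀ k, Measurable[sigmaOf X (Set.Iio k)] (Ll k) :=
    fun k => measurable_sum_ite hZm n (c k) (Set.Iio k)
  have mLg : ∀ k, Measurable[sigmaOf X (Set.Ioi k)] (Lg k) :=
    fun k => measurable_sum_ite hZm n (c k) (Set.Ioi k)
  have bLl : ∀ k, MomentBound P 1 (Ll k) (16 * b' * √(∑ u ∈ Finset.range n, c k u ^ 2)) :=
    fun k => sum_linear_ite hX hind (Or.inl rfl) n hZm hZ hZmean (c k) (Set.Iio k)
  have bLg : ∀ k, MomentBound P 1 (Lg k) (16 * b' * √(∑ u ∈ Finset.range n, c k u ^ 2)) :=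
    fun k => sum_linear_ite hX hind (Or.inl rfl) n hZm hZ hZmean (c k) (Set.Ioi k)
  -- The square of past plus future is expanded; past² is predictable for the forward order, future²
  -- for the backward order.
  have h1 := sum_forward hX hind (Or.inr rfl) n hYm hY2 hYmean (R := fun k ω => Ll k ω ^ 2)
    (fun k => (mLl k).pow_const 2) (fun k _ => (bLl k).pow 2)
  have h2 := sum_backward hX hind (Or.inr rfl) n hYm hY2 hYmean (R := fun k ω => Lg k ω ^ 2)
    (fun k => (mLg k).pow_const 2) (fun k _ => (bLg k).pow 2)
  -- The cross term past · future fits neither order. Summed first over k for fixed v > k, it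
  -- becomes an iterated forward sum whose v-th coefficient uses only variables before v.
  have hin : ∀ v, MomentBound P 1 (fun ω => ∑ k ∈ Finset.range n, Y k ω *
      ((if k ∈ Set.Iio v then c k v else 0) * Ll k ω))
      (16 * b * √(∑ k ∈ Finset.range n,
        (|if k ∈ Set.Iio v then c k v else 0| * (16 * b' * √(∑ u ∈ Finset.range n, c k u ^ 2))) ^ 2)) :=
    fun v => sum_forward hX hind (Or.inl rfl) n hYm hY hYmean
      (fun k => (mLl k).const_mul _) (fun k _ => (bLl k).const_mul _)
  have h3 := sum_forward hX hind (Or.inl rfl) n hZm hZ hZmean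
    (R := fun v ω => ∑ k ∈ Finset.range n, Y k ω *
      ((if k ∈ Set.Iio v then c k v else 0) * Ll k ω))
    (fun v => by
      refine Finset.measurable_fun_sum _ fun k _ => ?_
      by_cases hk : k ∈ Set.Iio v
      · simp only [if_pos hk]
        exact (measurable_sigmaOf_mono (by simpa using hk) (hYm k)).mul
          ((measurable_sigmaOf_mono (Set.Iio_subset_Iio (le_of_lt hk)) (mLl k)).const_mul _)
      · simp only [if_neg hk, zero_mul, mul_zero]
        exact measurable_const)
    (fun v _ => (hin v))
  have h4 := add (by norm_num) (add (by norm_num) h1 h2)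
    (((h3.mono_weight (j := 2) (by norm_num))).const_mul 2)
  have s1 : √(∑ k ∈ Finset.range n, ((16 * b' * √(∑ u ∈ Finset.range n, c k u ^ 2)) ^ 2) ^ 2)
      = 256 * b' ^ 2 * √(∑ k ∈ Finset.range n, (∑ u ∈ Finset.range n, c k u ^ 2) ^ 2) := by
    have : ∀ k, ((16 * b' * √(∑ u ∈ Finset.range n, c k u ^ 2)) ^ 2) ^ 2
        = (256 * b' ^ 2) ^ 2 * (∑ u ∈ Finset.range n, c k u ^ 2) ^ 2 := fun k => by
      rw [mul_pow, Real.sq_sqrt (hA k)]; ring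
    simp only [this]
    rw [← Finset.mul_sum, Real.sqrt_mul (sq_nonneg _), Real.sqrt_sq (by positivity)]
  have s2 : √(∑ v ∈ Finset.range n, (16 * b * √(∑ k ∈ Finset.range n,
        (|if k ∈ Set.Iio v then c k v else 0| * (16 * b' * √(∑ u ∈ Finset.range n, c k u ^ 2))) ^ 2)) ^ 2)
      ≤ 256 * b * b' * √(∑ k ∈ Finset.range n, (∑ u ∈ Finset.range n, c k u ^ 2) ^ 2) := by
    refine Real.sqrt_le_iff.2 ⟨by positivity, ?_⟩
    rw [mul_pow, Real.sq_sqrt (Finset.sum_nonneg fun _ _ => sq_nonneg _)]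
    calc _ ≤ ∑ v ∈ Finset.range n, (256 * b * b') ^ 2 *
          ∑ k ∈ Finset.range n, c k v ^ 2 * ∑ u ∈ Finset.range n, c k u ^ 2 := by
          refine Finset.sum_le_sum fun v _ => ?_
          rw [mul_pow, Real.sq_sqrt (Finset.sum_nonneg fun _ _ => sq_nonneg _), Finset.mul_sum,
            Finset.mul_sum]
          refine Finset.sum_le_sum fun k _ => ?_
          have hle : (if k ∈ Set.Iio v then c k v else 0) ^ 2 ≤ c k v ^ 2 := by
            split_ifs
            · exact le_rfl
            · simpa using sq_nonneg (c k v)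
          calc _ = (256 * b * b') ^ 2 * ((if k ∈ Set.Iio v then c k v else 0) ^ 2 *
                ∑ u ∈ Finset.range n, c k u ^ 2) := by
                rw [mul_pow |_|, sq_abs, mul_pow (16 * b'), Real.sq_sqrt (hA k)]; ring
            _ ≤ _ := by gcongr
      _ = _ := by
        rw [← Finset.mul_sum, Finset.sum_comm]
        congr 1
        refine Finset.sum_congr rfl fun k _ => ?_
        rw [← Finset.sum_mul, sq]
  refine (h4.congr (ae_of_all _ fun ω => ?_)).mono ?_
  · have hcross : ∑ v ∈ Finset.range n, Z v ω * ∑ k ∈ Finset.range n, Y k ω *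
        ((if k ∈ Set.Iio v then c k v else 0) * Ll k ω)
        = ∑ k ∈ Finset.range n, Y k ω * (Ll k ω * Lg k ω) := by
      simp only [hLg, Finset.mul_sum]
      rw [Finset.sum_comm]
      refine Finset.sum_congr rfl fun k _ => Finset.sum_congr rfl fun v _ => ?_
      by_cases h : k < v
      · simp [h]; ring
      · simp [h]
    simp only
    rw [hcross, Finset.mul_sum, ← Finset.sum_add_distrib, ← Finset.sum_add_distrib]
    refine Finset.sum_congr rfl fun k _ => ?_
    rw [sum_split n k (c k) (fun u => Z u ω) (hc k)]
    ring
  · rw [s1, abs_of_pos (by norm_num : (0 : ℝ) < 2)]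
    have h5 : 16 * b' * √(∑ v ∈ Finset.range n, (16 * b * √(∑ k ∈ Finset.range n,
        (|if k ∈ Set.Iio v then c k v else 0| * (16 * b' * √(∑ u ∈ Finset.range n, c k u ^ 2))) ^ 2)) ^ 2)
        ≤ 16 * b' * (256 * b * b' * √(∑ k ∈ Finset.range n, (∑ u ∈ Finset.range n, c k u ^ 2) ^ 2)) := by
      gcongr
    linarith

end MomentBound

end

/-! ### Quadratic forms in independent variables with Stein kernels -/

/-- The `k`-th row `∑ᵥ aₖᵥ xᵥ` of a matrix applied to the first `n` entries of a sequence. -/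
def rowForm (a : ℕ → ℕ → ℝ) (n k : ℕ) (x : ℕ → ℝ) : ℝ := ∑ v ∈ Finset.range n, a k v * x v

/-- The quadratic form `½ ∑ₖᵥ aₖᵥ xₖ xᵥ`. -/
noncomputable def halfForm (a : ℕ → ℕ → ℝ) (n : ℕ) (x : ℕ → ℝ) : ℝ :=
  1 / 2 * ∑ k ∈ Finset.range n, x k * rowForm a n k x

/-- The carré du champ `∑ₖ τₖ(xₖ) (∂ₖF)²` of the quadratic form `F`. -/
def carreDuChamp (τ : ℕ → ℝ → ℝ) (a : ℕ → ℕ → ℝ) (n : ℕ) (x : ℕ → ℝ) : ℝ :=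
  ∑ k ∈ Finset.range n, τ k (x k) * rowForm a n k x ^ 2

/-- The `j`-th partial derivative of the carré du champ of the quadratic form. -/
noncomputable def carreDeriv (τ : ℕ → ℝ → ℝ) (a : ℕ → ℕ → ℝ) (n j : ℕ) (x : ℕ → ℝ) : ℝ :=
  deriv (τ j) (x j) * rowForm a n j x ^ 2 +
    2 * ∑ k ∈ Finset.range n, τ k (x k) * rowForm a n k x * a k j

/-- The iterated carré du champ `∑ⱼ τⱼ(xⱼ) (∂ⱼΓ)²` with `Γ` the carré du champ of the form. -/
noncomputable def carreCarre (τ : ℕ → ℝ → ℝ) (a : ℕ → ℕ → ℝ) (n : ℕ) (x : ℕ → ℝ) : ℝ :=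
  ∑ j ∈ Finset.range n, τ j (x j) * carreDeriv τ a n j x ^ 2

/-- The squared norm of the `k`-th row. -/
def rowSq (a : ℕ → ℕ → ℝ) (n k : ℕ) : ℝ := ∑ v ∈ Finset.range n, a k v ^ 2

/-- The entries of the matrix `AᵀA`. -/
def gram (a : ℕ → ℕ → ℝ) (n u v : ℕ) : ℝ := ∑ k ∈ Finset.range n, a k u * a k v

/-- The quantity `∑ₖ (∑ᵥ aₖᵥ²)² + ∑ᵤᵥ (AᵀA)ᵤᵥ²`. -/
def fourthOrder (a : ℕ → ℕ → ℝ) (n : ℕ) : ℝ :=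
  ∑ k ∈ Finset.range n, rowSq a n k ^ 2 +
    ∑ u ∈ Finset.range n, ∑ v ∈ Finset.range n, gram a n u v ^ 2

/-- Independent centred variables of variance `1` with regular Stein kernels bounded below by `τ₀`,
where `b` bounds the `L⁸` norms of the variables, the kernels and their derivatives. -/
structure SteinSequence {Ω : Type*} [MeasurableSpace Ω] (P : Measure Ω) (X : ℕ → Ω → ℝ)
    (p : ℕ → ℝ → ℝ) (τ₀ b : ℝ) : Prop where
  meas : ∀ k, Measurable (X k)
  indep : iIndepFun X P
  mean : ∀ k, ∫ ω, X k ω ∂P = 0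
  secondMoment : ∀ k, ∫ ω, X k ω ^ 2 ∂P = 1
  regular : ∀ k, HasRegularSteinKernel P (X k) (p k) τ₀
  pos : 0 < τ₀
  one_le : 1 ≤ b
  bound : ∀ k, MomentBound P 1 (X k) b
  bound_kernel : ∀ k, MomentBound P 1 (fun ω => steinKernel (p k) (X k ω)) b
  bound_deriv : ∀ k, MomentBound P 1 (fun ω => deriv (steinKernel (p k)) (X k ω)) b

theorem rowSq_nonneg (a : ℕ → ℕ → ℝ) (n k : ℕ) : 0 ≤ rowSq a n k :=
  Finset.sum_nonneg fun _ _ => sq_nonneg _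

theorem gram_self (a : ℕ → ℕ → ℝ) (hs : ∀ k u, a k u = a u k) (n u : ℕ) :
    gram a n u u = rowSq a n u := by
  simp only [gram, rowSq]
  refine Finset.sum_congr rfl fun k _ => ?_
  rw [hs k u, sq]

theorem sum_gram_sq_nonneg (a : ℕ → ℕ → ℝ) (n : ℕ) :
    0 ≤ ∑ u ∈ Finset.range n, ∑ v ∈ Finset.range n, gram a n u v ^ 2 :=
  Finset.sum_nonneg fun _ _ => Finset.sum_nonneg fun _ _ => sq_nonneg _

theorem sum_rowSq_sq_nonneg (a : ℕ → ℕ → ℝ) (n : ℕ) :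
    0 ≤ ∑ k ∈ Finset.range n, rowSq a n k ^ 2 :=
  Finset.sum_nonneg fun _ _ => sq_nonneg _

theorem fourthOrder_nonneg (a : ℕ → ℕ → ℝ) (n : ℕ) : 0 ≤ fourthOrder a n :=
  add_nonneg (sum_rowSq_sq_nonneg a n) (sum_gram_sq_nonneg a n)

theorem sum_mul_rowForm (a : ℕ → ℕ → ℝ) (n j : ℕ) (x : ℕ → ℝ) :
    ∑ k ∈ Finset.range n, a k j * rowForm a n k x =
      ∑ v ∈ Finset.range n, gram a n j v * x v := by
  simp only [rowForm, gram, Finset.mul_sum, Finset.sum_mul]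
  rw [Finset.sum_comm]
  refine Finset.sum_congr rfl fun _ _ => Finset.sum_congr rfl fun _ _ => by ring

theorem sum_rowForm_sq (a : ℕ → ℕ → ℝ) (n : ℕ) (x : ℕ → ℝ) :
    ∑ k ∈ Finset.range n, rowForm a n k x ^ 2 =
      ∑ u ∈ Finset.range n, x u * ∑ v ∈ Finset.range n, gram a n u v * x v := by
  simp only [← sum_mul_rowForm]
  have : ∀ k, rowForm a n k x ^ 2 = ∑ u ∈ Finset.range n, x u * (a k u * rowForm a n k x) := by
    intro k
    rw [sq]
    nth_rewrite 1 [rowForm]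
    rw [Finset.sum_mul]
    exact Finset.sum_congr rfl fun _ _ => by ring
  simp only [this, Finset.mul_sum]
  rw [Finset.sum_comm]

theorem SteinSequence.measurable_self {Ω : Type*} {X : ℕ → Ω → ℝ} (k : ℕ) : Measurable[sigmaOf X {k}] (X k) :=
  measurable_sigmaOf (Set.mem_singleton k)

/-! ### Moment estimates for the form, its carré du champ and the iterated one. -/

namespace SteinSequence

variable {Ω : Type*} [MeasurableSpace Ω] {P : Measure Ω} {X : ℕ → Ω → ℝ}
  {p : ℕ → ℝ → ℝ} {τ₀ b : ℝ}

theorem kernel_pos (h : SteinSequence P X p τ₀ b) (k : ℕ) (x : ℝ) : 0 < steinKernel (p k) x :=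
  h.pos.trans_le ((h.regular k).ge x)

theorem measurable_kernel_sub_one (h : SteinSequence P X p τ₀ b) (k : ℕ) :
    Measurable[sigmaOf X {k}] fun ω => steinKernel (p k) (X k ω) - 1 :=
  ((h.regular k).continuous_steinKernel.measurable.comp (measurable_self k)).sub_const 1

/-- A vanishing diagonal entry removes the k-th variable from the k-th row. -/
theorem indepFun_rowForm (h : SteinSequence P X p τ₀ b) {a : ℕ → ℕ → ℝ}
    (ha : ∀ k, a k k = 0) (n k : ℕ) {f : Ω → ℝ} (hf : Measurable[sigmaOf X {k}] f) :
    IndepFun f (fun ω => rowForm a n k fun i => X i ω) P := by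
  refine indepFun_of_sigmaOf h.meas h.indep (S := {k}) (T := {k}ᶜ) (by simp) hf ?_
  refine Finset.measurable_fun_sum _ fun v _ => ?_
  by_cases hv : v = k
  · subst hv
    simp only [ha, zero_mul]
    exact measurable_const
  · exact (measurable_sigmaOf (by simpa using hv)).const_mul _

variable [IsProbabilityMeasure P]

/-- Stein's identity for Φ(y) = y: E τ(X) = E X² = 1, so that τ - 1 is centred. -/
theorem integral_steinKernel (h : SteinSequence P X p τ₀ b) (k : ℕ) :
    ∫ ω, steinKernel (p k) (X k ω) ∂P = 1 := by
  have h1 := (h.regular k).integral_mul_eq (h.meas k) (Z := fun _ : Ω => ()) measurable_const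
    (indepFun_const_right _ _) (Φ := fun t _ => t) (Ψ := fun _ _ => 1) measurable_fst
    measurable_const (ae_of_all _ fun _ t => hasDerivAt_id t)
    (by simpa only [sq] using ((h.bound k).pow 2).integrable (by norm_num))
    (((h.bound_kernel k).mul (h.bound k)).integrable (by norm_num))
    (by simpa using (h.bound_kernel k).integrable (by norm_num))
  simp only [mul_one] at h1
  rw [← h1, ← h.secondMoment k]
  simp only [sq]

theorem bound_kernel_sub_one (h : SteinSequence P X p τ₀ b) (k : ℕ) :
    MomentBound P 1 (fun ω => steinKernel (p k) (X k ω) - 1) (2 * b) :=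
  ((h.bound_kernel k).sub (by norm_num) (MomentBound.const 1)).mono (by
    rw [abs_one]; linarith [h.one_le])

theorem integral_kernel_sub_one (h : SteinSequence P X p τ₀ b) (k : ℕ) :
    ∫ ω, (steinKernel (p k) (X k ω) - 1) ∂P = 0 := by
  rw [integral_sub ((h.bound_kernel k).integrable (by norm_num)) (integrable_const 1),
    h.integral_steinKernel]
  simp

theorem bound_rowForm (h : SteinSequence P X p τ₀ b) (a : ℕ → ℕ → ℝ) (n k : ℕ) :
    MomentBound P 1 (fun ω => rowForm a n k fun i => X i ω) (16 * b * √(rowSq a n k)) :=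
  MomentBound.sum_linear h.meas h.indep (Or.inl rfl) n measurable_self h.bound h.mean (a k)

theorem bound_halfForm (h : SteinSequence P X p τ₀ b) {a : ℕ → ℕ → ℝ} (ha : ∀ k, a k k = 0)
    (n : ℕ) : MomentBound P 1 (fun ω => halfForm a n fun i => X i ω)
      (256 * b ^ 2 * √(∑ k ∈ Finset.range n, rowSq a n k)) := by
  have := (MomentBound.sum_bilinear h.meas h.indep (Or.inl rfl) n measurable_self h.bound h.mean
    measurable_self h.bound h.mean a ha).const_mul (1 / 2)
  refine this.mono (le_of_eq ?_)
  simp only [rowSq]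
  rw [abs_of_pos (by norm_num)]
  ring

/-- Γ - E Γ is a sum of three centred pieces: (τ_k - 1) L_k², the diagonal part of |AX|² with X_k² -
1, and its off-diagonal part, a bilinear form with Gram coefficients. -/
theorem bound_carreDuChamp_sub (h : SteinSequence P X p τ₀ b) {a : ℕ → ℕ → ℝ}
    (ha : ∀ k, a k k = 0) (hs : ∀ k u, a k u = a u k) (n : ℕ) :
    MomentBound P 2 (fun ω => carreDuChamp (fun k => steinKernel (p k)) a n (fun i => X i ω) -
      ∑ k ∈ Finset.range n, rowSq a n k) (40000 * b ^ 3 * √(fourthOrder a n)) := by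
  have h1 := MomentBound.sum_mul_linear_sq h.meas h.indep n h.measurable_kernel_sub_one
    h.bound_kernel_sub_one h.integral_kernel_sub_one measurable_self h.bound h.mean a ha
  have h2 := MomentBound.sum_linear h.meas h.indep (j := 2) (Or.inr rfl) (b := 2 * b ^ 2)
    (Y := fun k ω => X k ω ^ 2 - 1) n
    (fun k => ((measurable_self k).pow_const 2).sub_const 1)
    (fun k => (((h.bound k).pow 2).sub (by norm_num) (MomentBound.const 1)).mono (by
      rw [abs_one]; nlinarith [h.one_le]))
    (fun k => by
      rw [integral_sub (((h.bound k).pow 2).integrable (by norm_num)) (integrable_const 1),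
        h.secondMoment]
      simp) (rowSq a n)
  have h3 := MomentBound.sum_bilinear h.meas h.indep (j := 2) (Or.inr rfl) n measurable_self
    (fun k => (h.bound k).mono_weight (by norm_num)) h.mean measurable_self
    (fun k => (h.bound k).mono_weight (by norm_num)) h.mean
    (fun u v => if u = v then 0 else gram a n u v) (by simp)
  have h4 := (h1.add (by norm_num) h2).add (by norm_num) h3
  refine (h4.congr (ae_of_all _ fun ω => ?_)).mono ?_
  · have e1 : carreDuChamp (fun k => steinKernel (p k)) a n (fun i => X i ω) =
        ∑ k ∈ Finset.range n, (steinKernel (p k) (X k ω) - 1) *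
          (∑ u ∈ Finset.range n, a k u * X u ω) ^ 2 +
        ∑ k ∈ Finset.range n, rowForm a n k (fun i => X i ω) ^ 2 := by
      rw [← Finset.sum_add_distrib]
      refine Finset.sum_congr rfl fun k _ => ?_
      simp only [rowForm]; ring
    have e2 : ∑ k ∈ Finset.range n, rowSq a n k * (X k ω ^ 2 - 1) =
        ∑ k ∈ Finset.range n, rowSq a n k * X k ω ^ 2 - ∑ k ∈ Finset.range n, rowSq a n k := by
      rw [← Finset.sum_sub_distrib]
      exact Finset.sum_congr rfl fun _ _ => by ring
    have e3 : ∑ u ∈ Finset.range n, X u ω * ∑ v ∈ Finset.range n, gram a n u v * X v ω =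
        ∑ k ∈ Finset.range n, rowSq a n k * X k ω ^ 2 +
        ∑ u ∈ Finset.range n, X u ω * ∑ v ∈ Finset.range n,
          (if u = v then 0 else gram a n u v) * X v ω := by
      rw [← Finset.sum_add_distrib]
      refine Finset.sum_congr rfl fun u hu => ?_
      have : ∑ v ∈ Finset.range n, gram a n u v * X v ω = gram a n u u * X u ω +
          ∑ v ∈ Finset.range n, (if u = v then 0 else gram a n u v) * X v ω := by
        rw [← Finset.add_sum_erase _ _ hu, ← Finset.add_sum_erase (Finset.range n)
          (fun v => (if u = v then 0 else gram a n u v) * X v ω) hu]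
        simp only [if_true, zero_mul, zero_add]
        congr 1
        refine Finset.sum_congr rfl fun v hv => ?_
        rw [if_neg (Finset.ne_of_mem_erase hv).symm]
      rw [this, gram_self a hs]
      ring
    simp only
    rw [e1, e2, sum_rowForm_sq, e3]
    ring
  · have hb := h.one_le
    have w1 : √(∑ k ∈ Finset.range n, (∑ u ∈ Finset.range n, a k u ^ 2) ^ 2)
        ≤ √(fourthOrder a n) :=
      Real.sqrt_le_sqrt (le_add_of_nonneg_right (sum_gram_sq_nonneg a n))
    have w2 : √(∑ k ∈ Finset.range n, rowSq a n k ^ 2) ≤ √(fourthOrder a n) :=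
      Real.sqrt_le_sqrt (le_add_of_nonneg_right (sum_gram_sq_nonneg a n))
    have w3 : √(∑ u ∈ Finset.range n, ∑ v ∈ Finset.range n,
        (if u = v then 0 else gram a n u v) ^ 2) ≤ √(fourthOrder a n) := by
      refine Real.sqrt_le_sqrt (le_trans ?_ (le_add_of_nonneg_left (sum_rowSq_sq_nonneg a n)))
      refine Finset.sum_le_sum fun u _ => Finset.sum_le_sum fun v _ => ?_
      split_ifs
      · simpa using sq_nonneg (gram a n u v)
      · exact le_rfl
    have hb2 : b ^ 2 ≤ b ^ 3 := pow_le_pow_right₀ hb (by norm_num)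
    have hb0 : 0 ≤ b := by linarith
    calc 16384 * (2 * b) * b ^ 2 * √(∑ k ∈ Finset.range n, (∑ u ∈ Finset.range n, a k u ^ 2) ^ 2)
          + 16 * (2 * b ^ 2) * √(∑ k ∈ Finset.range n, rowSq a n k ^ 2)
          + 512 * b * b * √(∑ u ∈ Finset.range n, ∑ v ∈ Finset.range n,
            (if u = v then 0 else gram a n u v) ^ 2)
        ≤ 16384 * (2 * b) * b ^ 2 * √(fourthOrder a n) + 16 * (2 * b ^ 2) * √(fourthOrder a n)
          + 512 * b * b * √(fourthOrder a n) := by gcongr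
      _ = (32768 * b ^ 3 + 544 * b ^ 2) * √(fourthOrder a n) := by ring
      _ ≤ (40000 * b ^ 3) * √(fourthOrder a n) := by
        gcongr
        nlinarith

/-- Writing τ = 1 + (τ - 1) separates a linear form with Gram coefficients from a centred bilinear
form. Twice this sum is the part of ∂_jΓ that does not involve τ_j'. -/
theorem bound_sum_kernel_mul_rowForm (h : SteinSequence P X p τ₀ b) {a : ℕ → ℕ → ℝ}
    (ha : ∀ k, a k k = 0) (n j : ℕ) :
    MomentBound P 1 (fun ω => ∑ k ∈ Finset.range n, steinKernel (p k) (X k ω) *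
        rowForm a n k (fun i => X i ω) * a k j)
      (1040 * b ^ 2 * √(∑ v ∈ Finset.range n, gram a n j v ^ 2 +
        ∑ k ∈ Finset.range n, a k j ^ 2 * rowSq a n k)) := by
  have h1 := MomentBound.sum_linear h.meas h.indep (Or.inl rfl) n measurable_self h.bound h.mean
    (gram a n j)
  have h2 := MomentBound.sum_bilinear h.meas h.indep (Or.inl rfl) n h.measurable_kernel_sub_one
    h.bound_kernel_sub_one h.integral_kernel_sub_one measurable_self h.bound h.mean
    (fun k v => a k j * a k v) (by simp [ha])
  have h3 := h1.add (by norm_num) h2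
  refine (h3.congr (ae_of_all _ fun ω => ?_)).mono ?_
  · simp only
    rw [← sum_mul_rowForm a n j (fun i => X i ω), ← Finset.sum_add_distrib]
    refine Finset.sum_congr rfl fun k _ => ?_
    simp only [rowForm, mul_assoc, ← Finset.mul_sum]
    ring
  · have hb := h.one_le
    have hb2 : b ≤ b ^ 2 := by nlinarith
    have n1 : 0 ≤ ∑ v ∈ Finset.range n, gram a n j v ^ 2 :=
      Finset.sum_nonneg fun _ _ => sq_nonneg _
    have n2 : 0 ≤ ∑ k ∈ Finset.range n, a k j ^ 2 * rowSq a n k :=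
      Finset.sum_nonneg fun _ _ => mul_nonneg (sq_nonneg _) (rowSq_nonneg a n _)
    have e : ∑ k ∈ Finset.range n, ∑ u ∈ Finset.range n, (a k j * a k u) ^ 2 =
        ∑ k ∈ Finset.range n, a k j ^ 2 * rowSq a n k := by
      refine Finset.sum_congr rfl fun k _ => ?_
      simp only [rowSq, mul_pow, Finset.mul_sum]
    rw [e]
    set s := √(∑ v ∈ Finset.range n, gram a n j v ^ 2 +
        ∑ k ∈ Finset.range n, a k j ^ 2 * rowSq a n k) with hs
    have w1 : √(∑ v ∈ Finset.range n, gram a n j v ^ 2) ≤ s := Real.sqrt_le_sqrt (by linarith)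
    have w2 : √(∑ k ∈ Finset.range n, a k j ^ 2 * rowSq a n k) ≤ s :=
      Real.sqrt_le_sqrt (by linarith)
    have hs0 : 0 ≤ s := Real.sqrt_nonneg _
    calc _ ≤ 16 * b * s + 512 * (2 * b) * b * s := by gcongr
      _ = (16 * b + 1024 * b ^ 2) * s := by ring
      _ ≤ 1040 * b ^ 2 * s := by
        gcongr
        linarith

theorem bound_carreCarre (h : SteinSequence P X p τ₀ b) {a : ℕ → ℕ → ℝ}
    (ha : ∀ k, a k k = 0) (n : ℕ) :
    MomentBound P 4 (fun ω => carreCarre (fun k => steinKernel (p k)) a n fun i => X i ω)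
      (10 ^ 7 * b ^ 7 * fourthOrder a n) := by
  have hb := h.one_le
  have hb0 : 0 ≤ b := by linarith
  have hτm : ∀ k, Measurable (steinKernel (p k)) :=
    fun k => (h.regular k).continuous_steinKernel.measurable
  have h1 : ∀ j, MomentBound P 4 (fun ω => steinKernel (p j) (X j ω) *
      deriv (steinKernel (p j)) (X j ω) ^ 2 * rowForm a n j (fun i => X i ω) ^ 4)
      (b * b ^ 2 * (16 * b * √(rowSq a n j)) ^ 4) := fun j => by
    -- τ_j τ_j'² has weight 3 and L_j⁴ weight 4. Independence keeps the product at 4 instead of 7,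
    -- which leaves room for the later factor Γ⁻³.
    refine MomentBound.mul_indep (by norm_num)
      (((h.bound_kernel j).mul ((h.bound_deriv j).pow 2)).mono_weight (by norm_num))
      ((h.bound_rowForm a n j).pow 4) ?_
    exact (h.indepFun_rowForm ha n j (f := fun ω => steinKernel (p j) (X j ω) *
      deriv (steinKernel (p j)) (X j ω) ^ 2) (((hτm j).comp (measurable_self j)).mul
        (((measurable_deriv _).comp (measurable_self j)).pow_const 2))).comp
          (φ := id) (ψ := fun x => x ^ 4) measurable_id (by fun_prop)
  have h2 : ∀ j, MomentBound P 4 (fun ω => steinKernel (p j) (X j ω) *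
      (∑ k ∈ Finset.range n, steinKernel (p k) (X k ω) *
        rowForm a n k (fun i => X i ω) * a k j) ^ 2)
      (b * (1040 * b ^ 2 * √(∑ v ∈ Finset.range n, gram a n j v ^ 2 +
        ∑ k ∈ Finset.range n, a k j ^ 2 * rowSq a n k)) ^ 2) := fun j =>
    ((h.bound_kernel j).mul ((h.bound_sum_kernel_mul_rowForm ha n j).pow 2)).mono_weight
      (by norm_num)
  have h3 := MomentBound.sum (by norm_num) (Finset.range n) fun j _ =>
    ((h1 j).const_mul 2).add (by norm_num) ((h2 j).const_mul 8)
  have mrow : ∀ k, Measurable fun ω => rowForm a n k fun i => X i ω := fun k =>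
    Finset.measurable_fun_sum _ fun v _ => (h.meas v).const_mul _
  have mD : ∀ j, Measurable fun ω => carreDeriv (fun k => steinKernel (p k)) a n j
      fun i => X i ω := fun j =>
    (((measurable_deriv _).comp (h.meas j)).mul ((mrow j).pow_const 2)).add
      ((Finset.measurable_fun_sum _ fun k _ =>
        (((hτm k).comp (h.meas k)).mul (mrow k)).mul_const _).const_mul 2)
  refine (h3.mono_abs (Finset.measurable_fun_sum _ fun j _ =>
    ((hτm j).comp (h.meas j)).mul ((mD j).pow_const 2)).aestronglyMeasurable
      (ae_of_all _ fun ω => ?_)).mono ?_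
  · refine abs_le_abs_of_nonneg (Finset.sum_nonneg fun j _ =>
      mul_nonneg (h.kernel_pos j _).le (sq_nonneg _)) (Finset.sum_le_sum fun j _ => ?_)
    simp only [carreDeriv]
    set S := ∑ k ∈ Finset.range n, steinKernel (p k) (X k ω) *
        rowForm a n k (fun i => X i ω) * a k j
    set d := deriv (steinKernel (p j)) (X j ω)
    set l := rowForm a n j fun i => X i ω
    calc steinKernel (p j) (X j ω) * (d * l ^ 2 + 2 * S) ^ 2
        ≤ steinKernel (p j) (X j ω) * (2 * (d ^ 2 * l ^ 4) + 8 * S ^ 2) := by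
          gcongr
          · exact (h.kernel_pos j _).le
          · nlinarith [sq_nonneg (d * l ^ 2 - 2 * S)]
      _ = _ := by ring
  · have e1 : ∀ j, (16 * b * √(rowSq a n j)) ^ 4 = 65536 * b ^ 4 * rowSq a n j ^ 2 := fun j => by
      rw [mul_pow, show √(rowSq a n j) ^ 4 = (√(rowSq a n j) ^ 2) ^ 2 by ring,
        Real.sq_sqrt (rowSq_nonneg a n j)]
      ring
    have e2 : ∀ j, (1040 * b ^ 2 * √(∑ v ∈ Finset.range n, gram a n j v ^ 2 +
        ∑ k ∈ Finset.range n, a k j ^ 2 * rowSq a n k)) ^ 2 = 1081600 * b ^ 4 *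
        (∑ v ∈ Finset.range n, gram a n j v ^ 2 +
          ∑ k ∈ Finset.range n, a k j ^ 2 * rowSq a n k) := fun j => by
      rw [mul_pow, Real.sq_sqrt (add_nonneg (Finset.sum_nonneg fun _ _ => sq_nonneg _)
        (Finset.sum_nonneg fun _ _ => mul_nonneg (sq_nonneg _) (rowSq_nonneg a n _)))]
      ring
    have e3 : ∑ j ∈ Finset.range n, ∑ k ∈ Finset.range n, a k j ^ 2 * rowSq a n k =
        ∑ k ∈ Finset.range n, rowSq a n k ^ 2 := by
      rw [Finset.sum_comm]
      refine Finset.sum_congr rfl fun k _ => ?_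
      rw [← Finset.sum_mul, sq]
      rfl
    simp only [e1, e2]
    rw [abs_of_pos (by norm_num : (0 : ℝ) < 2), abs_of_pos (by norm_num : (0 : ℝ) < 8)]
    have e4 : ∑ j ∈ Finset.range n, (2 * (b * b ^ 2 * (65536 * b ^ 4 * rowSq a n j ^ 2)) +
        8 * (b * (1081600 * b ^ 4 * (∑ v ∈ Finset.range n, gram a n j v ^ 2 +
          ∑ k ∈ Finset.range n, a k j ^ 2 * rowSq a n k)))) =
        131072 * b ^ 7 * ∑ k ∈ Finset.range n, rowSq a n k ^ 2 + 8652800 * b ^ 5 *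
          fourthOrder a n := by
      have e5 : fourthOrder a n = ∑ j ∈ Finset.range n, (∑ v ∈ Finset.range n, gram a n j v ^ 2 +
          ∑ k ∈ Finset.range n, a k j ^ 2 * rowSq a n k) := by
        rw [Finset.sum_add_distrib, e3, fourthOrder, add_comm]
      rw [e5, Finset.mul_sum, Finset.mul_sum, ← Finset.sum_add_distrib]
      exact Finset.sum_congr rfl fun _ _ => by ring
    rw [e4]
    have hb5 : b ^ 5 ≤ b ^ 7 := pow_le_pow_right₀ hb (by norm_num)
    have hW := fourthOrder_nonneg a n
    have hle : ∑ k ∈ Finset.range n, rowSq a n k ^ 2 ≤ fourthOrder a n :=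
      le_add_of_nonneg_right (sum_gram_sq_nonneg a n)
    calc _ ≤ 131072 * b ^ 7 * fourthOrder a n + 8652800 * b ^ 7 * fourthOrder a n := by gcongr
      _ = 8783872 * (b ^ 7 * fourthOrder a n) := by ring
      _ ≤ 10 ^ 7 * (b ^ 7 * fourthOrder a n) := by
        gcongr
        norm_num
      _ = _ := by ring

end SteinSequence

/-! ### Partial derivatives of quadratic forms -/

section

variable {a : ℕ → ℕ → ℝ} {n k : ℕ}

theorem hasDerivAt_update_apply (x : ℕ → ℝ) (k u : ℕ) (t : ℝ) :
    HasDerivAt (fun t => Function.update x k t u) (if u = k then 1 else 0) t := by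
  by_cases h : u = k
  · subst h
    simpa using hasDerivAt_id' t
  · simpa [h] using hasDerivAt_const t (x u)

theorem hasDerivAt_rowForm (hk : k < n) (j : ℕ) (x : ℕ → ℝ) (t : ℝ) :
    HasDerivAt (fun t => rowForm a n j (Function.update x k t)) (a j k) t := by
  have h := HasDerivAt.fun_sum (u := Finset.range n)
    fun v _ => (hasDerivAt_update_apply x k v t).const_mul (a j v)
  refine h.congr_deriv ?_
  simp [hk]

theorem hasDerivAt_halfForm (hs : ∀ k u, a k u = a u k) (hk : k < n) (x : ℕ → ℝ) (t : ℝ) :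
    HasDerivAt (fun t => halfForm a n (Function.update x k t))
      (rowForm a n k (Function.update x k t)) t := by
  have h := (HasDerivAt.fun_sum (u := Finset.range n)
    fun j _ => (hasDerivAt_update_apply x k j t).mul (hasDerivAt_rowForm (a := a) hk j x t)).const_mul
      (1 / 2 : ℝ)
  refine h.congr_deriv ?_
  rw [Finset.sum_add_distrib]
  have e : ∑ j ∈ Finset.range n, Function.update x k t j * a j k =
      rowForm a n k (Function.update x k t) :=
    Finset.sum_congr rfl fun j _ => by rw [hs j k, mul_comm]
  rw [e]
  simp [hk]
  ring

theorem hasDerivAt_carreDuChamp {τ : ℕ → ℝ → ℝ} (hτ : ∀ j x, HasDerivAt (τ j) (deriv (τ j) x) x)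
    (hk : k < n) (x : ℕ → ℝ) (t : ℝ) :
    HasDerivAt (fun t => carreDuChamp τ a n (Function.update x k t))
      (carreDeriv τ a n k (Function.update x k t)) t := by
  have h := HasDerivAt.fun_sum (u := Finset.range n) fun j _ =>
    (((hτ j (Function.update x k t j)).comp t (hasDerivAt_update_apply x k j t)).mul
      ((hasDerivAt_rowForm (a := a) hk j x t).pow 2))
  refine h.congr_deriv ?_
  rw [Finset.sum_add_distrib, carreDeriv]
  congr 1
  · simp [hk]
  · rw [Finset.mul_sum]
    refine Finset.sum_congr rfl fun j _ => ?_
    simp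
    ring

end

theorem measurable_rowForm (a : ℕ → ℕ → ℝ) (n k : ℕ) : Measurable (rowForm a n k) :=
  Finset.measurable_fun_sum _ fun v _ => (measurable_pi_apply v).const_mul _

theorem measurable_halfForm (a : ℕ → ℕ → ℝ) (n : ℕ) : Measurable (halfForm a n) :=
  (Finset.measurable_fun_sum _ fun k _ =>
    (measurable_pi_apply k).mul (measurable_rowForm a n k)).const_mul _

theorem measurable_carreDuChamp {τ : ℕ → ℝ → ℝ} (hτ : ∀ k, Measurable (τ k)) (a : ℕ → ℕ → ℝ)
    (n : ℕ) : Measurable (carreDuChamp τ a n) :=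
  Finset.measurable_fun_sum _ fun k _ =>
    ((hτ k).comp (measurable_pi_apply k)).mul ((measurable_rowForm a n k).pow_const 2)

theorem measurable_carreDeriv {τ : ℕ → ℝ → ℝ} (hτ : ∀ k, Measurable (τ k)) (a : ℕ → ℕ → ℝ)
    (n j : ℕ) : Measurable (carreDeriv τ a n j) :=
  (((measurable_deriv _).comp (measurable_pi_apply j)).mul
    ((measurable_rowForm a n j).pow_const 2)).add
      ((Finset.measurable_fun_sum _ fun k _ =>
        (((hτ k).comp (measurable_pi_apply k)).mul (measurable_rowForm a n k)).mul_const _).const_mul 2)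

/-! ### Integration by parts for the quadratic form. -/

namespace SteinSequence

variable {Ω : Type*} [MeasurableSpace Ω] {P : Measure Ω} {X : ℕ → Ω → ℝ}
  {p : ℕ → ℝ → ℝ} {τ₀ b : ℝ}

theorem measurable_sequence (h : SteinSequence P X p τ₀ b) :
    Measurable fun ω => fun i => X i ω := measurable_pi_lambda _ h.meas

theorem measurable_steinKernel (h : SteinSequence P X p τ₀ b) (k : ℕ) :
    Measurable (steinKernel (p k)) := (h.regular k).continuous_steinKernel.measurable

theorem carreDuChamp_pos (h : SteinSequence P X p τ₀ b) {a : ℕ → ℕ → ℝ} {n : ℕ} {x : ℕ → ℝ}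
    (hx : ∃ k < n, rowForm a n k x ≠ 0) : 0 < carreDuChamp (fun k => steinKernel (p k)) a n x := by
  obtain ⟨k, hk, hne⟩ := hx
  refine Finset.sum_pos' (fun j _ => mul_nonneg (h.kernel_pos j _).le (sq_nonneg _))
    ⟨k, Finset.mem_range.2 hk, mul_pos (h.kernel_pos k _) (by positivity)⟩

variable [IsProbabilityMeasure P]

/-- Stein's identity in the `k`-th coordinate. Differentiability is only needed along the lines
that avoid the origin. -/
theorem integral_mul_eq (h : SteinSequence P X p τ₀ b) {n k : ℕ} (hn : 2 ≤ n)
    {Φ Ψ : (ℕ → ℝ) → ℝ} (hΦ : Measurable Φ) (hΨ : Measurable Ψ)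
    (hder : ∀ x : ℕ → ℝ, (∃ j < n, j ≠ k ∧ x j ≠ 0) → ∀ t,
      HasDerivAt (fun t => Φ (Function.update x k t)) (Ψ (Function.update x k t)) t)
    (i1 : Integrable (fun ω => X k ω * Φ fun i => X i ω) P)
    (i2 : Integrable (fun ω => steinKernel (p k) (X k ω) * Φ fun i => X i ω) P)
    (i3 : Integrable (fun ω => steinKernel (p k) (X k ω) * Ψ fun i => X i ω) P) :
    ∫ ω, X k ω * Φ (fun i => X i ω) ∂P =
      ∫ ω, steinKernel (p k) (X k ω) * Ψ (fun i => X i ω) ∂P := by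
  -- The frozen variable is the sequence with its k-th entry reset to 0; it is independent of `X k`,
  -- and updating that entry recovers the sequence.
  have hZ : Measurable[sigmaOf X {k}ᶜ] fun ω => Function.update (fun i => X i ω) k 0 := by
    refine @measurable_pi_lambda _ _ _ (sigmaOf X {k}ᶜ) _ _ fun j => ?_
    by_cases hj : j = k
    · subst hj
      simp only [Function.update_self]
      exact measurable_const
    · simp only [Function.update_of_ne hj]
      exact measurable_sigmaOf (by simpa using hj)
  have hZ' : Measurable fun ω => Function.update (fun i => X i ω) k 0 :=
    hZ.mono (sigmaOf_le h.meas _) le_rfl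
  have hind := indepFun_of_sigmaOf h.meas h.indep (S := {k}) (T := {k}ᶜ) (by simp)
    (measurable_self k) hZ
  have hup : Measurable fun z : ℝ × (ℕ → ℝ) => Function.update z.2 k z.1 := by
    refine measurable_pi_lambda _ fun j => ?_
    by_cases hj : j = k
    · subst hj
      simpa using measurable_fst
    · simp only [Function.update_of_ne hj]
      exact (measurable_pi_apply j).comp measurable_snd
  have hrec : ∀ ω, Function.update (Function.update (fun i => X i ω) k 0) k (X k ω) =
      fun i => X i ω := fun ω => by simp
  -- As n ≥ 2 there is another coordinate. It has a density, so it is almost surely nonzero and the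
  -- line in direction k misses the origin.
  obtain ⟨j, hjn, hjk⟩ : ∃ j < n, j ≠ k := by
    by_cases h0 : k = 0
    · exact ⟨1, by omega, by omega⟩
    · exact ⟨0, by omega, by omega⟩
  have := (h.regular k).integral_mul_eq (h.meas k) hZ' hind
    (Φ := fun t z => Φ (Function.update z k t)) (Ψ := fun t z => Ψ (Function.update z k t))
    (hΦ.comp hup) (hΨ.comp hup) (by
      have hms : MeasurableSet {x : ℕ → ℝ | x j ≠ 0} :=
        (measurableSet_eq_fun (measurable_pi_apply j) measurable_const).compl
      have hne : ∀ᵐ z ∂(P.map fun ω => Function.update (fun i => X i ω) k 0), z j ≠ 0 := by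
        rw [ae_map_iff hZ'.aemeasurable hms]
        filter_upwards [(h.regular j).ae_ne (h.meas j) 0] with ω hω
        rwa [Function.update_of_ne hjk]
      filter_upwards [hne] with z hz t
      exact hder z ⟨j, hjn, hjk, hz⟩ t)
    (by simpa only [hrec] using i1) (by simpa only [hrec] using i2)
    (by simpa only [hrec] using i3)
  simpa only [hrec] using this

theorem integral_mul_rowForm (h : SteinSequence P X p τ₀ b) {a : ℕ → ℕ → ℝ} {n k : ℕ}
    (hn : 2 ≤ n) (hk : k < n) (j : ℕ) :
    ∫ ω, X k ω * rowForm a n j (fun i => X i ω) ∂P = a j k := by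
  rw [h.integral_mul_eq hn (measurable_rowForm a n j) (Ψ := fun _ => a j k) measurable_const
    (fun x _ t => hasDerivAt_rowForm hk j x t)
    (((h.bound k).mul (h.bound_rowForm a n j)).integrable (by norm_num))
    (((h.bound_kernel k).mul (h.bound_rowForm a n j)).integrable (by norm_num))
    (((h.bound_kernel k).integrable (by norm_num)).mul_const _), integral_mul_const,
    h.integral_steinKernel, one_mul]

theorem integral_rowForm_sq (h : SteinSequence P X p τ₀ b) {a : ℕ → ℕ → ℝ} {n : ℕ}
    (hn : 2 ≤ n) (j : ℕ) :
    ∫ ω, rowForm a n j (fun i => X i ω) ^ 2 ∂P = rowSq a n j := by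
  have e : ∀ ω, rowForm a n j (fun i => X i ω) ^ 2 =
      ∑ v ∈ Finset.range n, a j v * (X v ω * rowForm a n j (fun i => X i ω)) := fun ω => by
    rw [sq]
    nth_rewrite 1 [rowForm]
    rw [Finset.sum_mul]
    exact Finset.sum_congr rfl fun _ _ => by ring
  simp only [e]
  rw [integral_finsetSum _ fun v _ =>
    (((h.bound v).mul (h.bound_rowForm a n j)).integrable (by norm_num)).const_mul _]
  refine Finset.sum_congr rfl fun v hv => ?_
  rw [integral_const_mul, h.integral_mul_rowForm hn (Finset.mem_range.1 hv), sq]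

theorem integral_halfForm (h : SteinSequence P X p τ₀ b) {a : ℕ → ℕ → ℝ} {n : ℕ}
    (hn : 2 ≤ n) (ha : ∀ k, a k k = 0) :
    ∫ ω, halfForm a n (fun i => X i ω) ∂P = 0 := by
  simp only [halfForm]
  rw [integral_const_mul, integral_finsetSum _ fun k _ =>
    (((h.bound k).mul (h.bound_rowForm a n k)).integrable (by norm_num)),
    Finset.sum_eq_zero fun k hk => ?_, mul_zero]
  rw [h.integral_mul_rowForm hn (Finset.mem_range.1 hk), ha]

/-- One factor is opened as ½ ∑ X_k L_k. Since ∂_k L_k = a_kk = 0, Stein's identity leaves E[τ_k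
L_k²], which factors by independence. This identifies 2σ² with the centring constant of Γ. -/
theorem integral_halfForm_sq (h : SteinSequence P X p τ₀ b) {a : ℕ → ℕ → ℝ} {n : ℕ}
    (hn : 2 ≤ n) (ha : ∀ k, a k k = 0) (hs : ∀ k u, a k u = a u k) :
    ∫ ω, halfForm a n (fun i => X i ω) ^ 2 ∂P = 1 / 2 * ∑ k ∈ Finset.range n, rowSq a n k := by
  have bF := h.bound_halfForm ha n
  have bL := h.bound_rowForm a n
  have e : ∀ ω, halfForm a n (fun i => X i ω) ^ 2 = 1 / 2 * ∑ k ∈ Finset.range n,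
      X k ω * (rowForm a n k (fun i => X i ω) * halfForm a n (fun i => X i ω)) := fun ω => by
    rw [sq]
    nth_rewrite 1 [halfForm]
    rw [mul_assoc, Finset.sum_mul]
    congr 1
    exact Finset.sum_congr rfl fun _ _ => by ring
  simp only [e]
  rw [integral_const_mul, integral_finsetSum _ fun k _ =>
    (((h.bound k).mul ((bL k).mul bF)).integrable (by norm_num))]
  congr 1
  refine Finset.sum_congr rfl fun k hk => ?_
  have hk' := Finset.mem_range.1 hk
  rw [h.integral_mul_eq hn (Φ := fun x => rowForm a n k x * halfForm a n x)
    (Ψ := fun x => rowForm a n k x ^ 2)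
    ((measurable_rowForm a n k).mul (measurable_halfForm a n))
    ((measurable_rowForm a n k).pow_const 2)
    (fun x _ t => ((hasDerivAt_rowForm hk' k x t).mul
      (hasDerivAt_halfForm hs hk' x t)).congr_deriv (by rw [ha]; ring))
    (((h.bound k).mul ((bL k).mul bF)).integrable (by norm_num))
    (((h.bound_kernel k).mul ((bL k).mul bF)).integrable (by norm_num))
    (((h.bound_kernel k).mul ((bL k).pow 2)).integrable (by norm_num))]
  have hind := (h.indepFun_rowForm ha n k (measurable_self k)).comp
    (φ := steinKernel (p k)) (ψ := fun x => x ^ 2) (h.measurable_steinKernel k) (by fun_prop)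
  have := hind.integral_fun_mul_eq_mul_integral (h.bound_kernel k).aesm ((bL k).aesm.pow 2)
  simp only [Function.comp_apply] at this
  rw [this, h.integral_steinKernel, h.integral_rowForm_sq hn, one_mul]

/-- The weight in the integration by parts formula for a quadratic form. -/
noncomputable def _root_.steinWeight (τ : ℕ → ℝ → ℝ) (a : ℕ → ℕ → ℝ) (n : ℕ) (x : ℕ → ℝ) : ℝ :=
  2 * halfForm a n x * (carreDuChamp τ a n x)⁻¹ +
    (∑ k ∈ Finset.range n, τ k (x k) * rowForm a n k x * carreDeriv τ a n k x) *
      (carreDuChamp τ a n x)⁻¹ ^ 2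

theorem exists_bound_carreDeriv (h : SteinSequence P X p τ₀ b) {a : ℕ → ℕ → ℝ}
    (ha : ∀ k, a k k = 0) (n j : ℕ) : ∃ c, MomentBound P 3 (fun ω =>
      carreDeriv (fun k => steinKernel (p k)) a n j fun i => X i ω) c :=
  ⟨_, ((h.bound_deriv j).mul ((h.bound_rowForm a n j).pow 2)).add (by norm_num)
    (((h.bound_sum_kernel_mul_rowForm ha n j).const_mul 2).mono_weight (by norm_num))⟩

/-- Only integrability is needed, so the constant is left open; the weight is 1 + 1 + 3 + 2 = 7. -/
theorem exists_bound_steinWeight (h : SteinSequence P X p τ₀ b) {a : ℕ → ℕ → ℝ}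
    (ha : ∀ k, a k k = 0) {n : ℕ} {g : ℝ} (hg : MomentBound P 1
      (fun ω => (carreDuChamp (fun k => steinKernel (p k)) a n fun i => X i ω)⁻¹) g) :
    ∃ c, MomentBound P 7 (fun ω =>
      steinWeight (fun k => steinKernel (p k)) a n fun i => X i ω) c := by
  choose d hd using h.exists_bound_carreDeriv (n := n) ha
  exact ⟨_, ((((h.bound_halfForm ha n).const_mul 2).mul hg).mono_weight (by norm_num)).add
    (by norm_num) ((MomentBound.sum (by norm_num) (Finset.range n) fun k _ =>
      ((h.bound_kernel k).mul (h.bound_rowForm a n k)).mul (hd k)).mul (hg.pow 2))⟩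

/-- Integration by parts for a quadratic form `F`: `E[φ'(F)] = E[φ(F) δ]`. -/
theorem integral_deriv_halfForm (h : SteinSequence P X p τ₀ b) {a : ℕ → ℕ → ℝ}
    (ha : ∀ k, a k k = 0) (hs : ∀ k u, a k u = a u k) {n : ℕ} (hn : 2 ≤ n)
    (hinj : ∀ x : ℕ → ℝ, (∃ j < n, x j ≠ 0) → ∃ k < n, rowForm a n k x ≠ 0) {g : ℝ}
    (hg : MomentBound P 1
      (fun ω => (carreDuChamp (fun k => steinKernel (p k)) a n fun i => X i ω)⁻¹) g)
    {φ φ' : ℝ → ℝ} (hφ : ∀ x, HasDerivAt φ (φ' x) x) (hφ' : Continuous φ') {M : ℝ}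
    (hM : ∀ x, |φ x| ≤ M ∧ |φ' x| ≤ M) :
    ∫ ω, φ' (halfForm a n fun i => X i ω) ∂P = ∫ ω, φ (halfForm a n fun i => X i ω) *
      steinWeight (fun k => steinKernel (p k)) a n (fun i => X i ω) ∂P := by
  set τ : ℕ → ℝ → ℝ := fun k => steinKernel (p k) with hτdef
  have hτm : ∀ k, Measurable (τ k) := h.measurable_steinKernel
  have hφc : Continuous φ := continuous_iff_continuousAt.2 fun x => (hφ x).continuousAt
  have hM0 : 0 ≤ M := (abs_nonneg _).trans (hM 0).1
  have mF := measurable_halfForm a n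
  have mL := measurable_rowForm a n
  have mG := measurable_carreDuChamp hτm a n
  have mD := measurable_carreDeriv hτm a n
  have mX := h.measurable_sequence
  have bφ : MomentBound P 0 (fun ω => φ (halfForm a n fun i => X i ω)) M :=
    MomentBound.of_abs_le ((hφc.measurable.comp (mF.comp mX)).aestronglyMeasurable) hM0
      (ae_of_all _ fun ω => (hM _).1)
  have bφ' : MomentBound P 0 (fun ω => φ' (halfForm a n fun i => X i ω)) M :=
    MomentBound.of_abs_le ((hφ'.measurable.comp (mF.comp mX)).aestronglyMeasurable) hM0
      (ae_of_all _ fun ω => (hM _).2)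
  have bL := h.bound_rowForm a n
  choose d hd using h.exists_bound_carreDeriv (n := n) ha
  -- The normalised gradient field φ(F) L_k / Γ and its k-th partial derivative, which has no ∂_k
  -- L_k term because the diagonal vanishes.
  set Φ : ℕ → (ℕ → ℝ) → ℝ := fun k x =>
    φ (halfForm a n x) * (rowForm a n k x * (carreDuChamp τ a n x)⁻¹) with hΦ
  set Ψ : ℕ → (ℕ → ℝ) → ℝ := fun k x =>
    φ' (halfForm a n x) * (rowForm a n k x * (rowForm a n k x * (carreDuChamp τ a n x)⁻¹)) -
      φ (halfForm a n x) * (rowForm a n k x * (carreDeriv τ a n k x *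
        (carreDuChamp τ a n x)⁻¹ ^ 2)) with hΨ
  have i1 : ∀ k, Integrable (fun ω => X k ω * Φ k fun i => X i ω) P := fun k =>
    ((h.bound k).mul (bφ.mul ((bL k).mul hg))).integrable (by norm_num)
  have i2 : ∀ k, Integrable (fun ω => steinKernel (p k) (X k ω) * Φ k fun i => X i ω) P := fun k =>
    ((h.bound_kernel k).mul (bφ.mul ((bL k).mul hg))).integrable (by norm_num)
  have i3 : ∀ k, Integrable (fun ω => steinKernel (p k) (X k ω) * Ψ k fun i => X i ω) P := fun k =>
    ((h.bound_kernel k).mul (((bφ'.mul ((bL k).mul ((bL k).mul hg))).mono_weight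
      (j := 6) (by norm_num)).sub (by norm_num)
        (bφ.mul ((bL k).mul ((hd k).mul (hg.pow 2)))))).integrable (by norm_num)
  have hk : ∀ k ∈ Finset.range n, ∫ ω, X k ω * Φ k (fun i => X i ω) ∂P =
      ∫ ω, steinKernel (p k) (X k ω) * Ψ k (fun i => X i ω) ∂P := by
    intro k hk
    have hkn := Finset.mem_range.1 hk
    refine h.integral_mul_eq hn
      ((hφc.measurable.comp mF).mul ((mL k).mul mG.inv))
      (((hφ'.measurable.comp mF).mul ((mL k).mul ((mL k).mul mG.inv))).sub
        ((hφc.measurable.comp mF).mul ((mL k).mul ((mD k).mul (mG.inv.pow_const 2)))))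
      ?_ (i1 k) (i2 k) (i3 k)
    rintro x ⟨j, hjn, hjk, hxj⟩ t
    have hpos : 0 < carreDuChamp τ a n (Function.update x k t) :=
      h.carreDuChamp_pos (hinj _ ⟨j, hjn, by rwa [Function.update_of_ne hjk]⟩)
    have hd1 := (hφ (halfForm a n (Function.update x k t))).comp t
      (hasDerivAt_halfForm hs hkn x t)
    have hd2 := (hasDerivAt_carreDuChamp (τ := τ) (a := a)
      (fun j x => (h.regular j).hasDerivAt x) hkn x t).inv hpos.ne'
    refine (hd1.mul ((hasDerivAt_rowForm (a := a) hkn k x t).mul hd2)).congr_deriv ?_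
    simp only [hΨ, ha, Function.comp_apply]
    rw [inv_pow]
    simp only [div_eq_mul_inv, Pi.inv_apply, Pi.mul_apply]
    ring
  have hsum := Finset.sum_congr rfl hk
  rw [← integral_finsetSum _ fun k _ => i1 k, ← integral_finsetSum _ fun k _ => i3 k] at hsum
  have hne : ∀ᵐ ω ∂P, 0 < carreDuChamp τ a n fun i => X i ω := by
    filter_upwards [(h.regular 0).ae_ne (h.meas 0) 0] with ω hω
    exact h.carreDuChamp_pos (hinj _ ⟨0, by omega, hω⟩)
  obtain ⟨c, hc⟩ := h.exists_bound_steinWeight ha hg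
  have hdiff : ∫ ω, (φ (halfForm a n fun i => X i ω) *
      steinWeight τ a n (fun i => X i ω) - φ' (halfForm a n fun i => X i ω)) ∂P =
      ∫ ω, (∑ k ∈ Finset.range n, X k ω * Φ k (fun i => X i ω) -
        ∑ k ∈ Finset.range n, steinKernel (p k) (X k ω) * Ψ k (fun i => X i ω)) ∂P := by
    refine integral_congr_ae ?_
    filter_upwards [hne] with ω hω
    simp only [hΦ, hΨ, steinWeight, mul_sub, Finset.sum_sub_distrib]
    set x : ℕ → ℝ := fun i => X i ω with hx
    set G := carreDuChamp τ a n x with hG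
    -- Euler's identity ∑ x_k L_k = 2F for a form of degree 2; next, ∑ τ_k L_k² / Γ = 1 isolates
    -- φ'(F).
    have e1 : ∑ k ∈ Finset.range n, X k ω * (φ (halfForm a n x) * (rowForm a n k x * G⁻¹)) =
        φ (halfForm a n x) * (2 * halfForm a n x * G⁻¹) := by
      rw [halfForm]
      simp only [Finset.mul_sum, Finset.sum_mul]
      exact Finset.sum_congr rfl fun k _ => by ring
    have e2 : ∑ k ∈ Finset.range n, steinKernel (p k) (X k ω) *
        (φ' (halfForm a n x) * (rowForm a n k x * (rowForm a n k x * G⁻¹))) =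
        φ' (halfForm a n x) := by
      have : ∑ k ∈ Finset.range n, steinKernel (p k) (X k ω) *
        (φ' (halfForm a n x) * (rowForm a n k x * (rowForm a n k x * G⁻¹))) =
        φ' (halfForm a n x) * (G * G⁻¹) := by
        rw [hG]
        nth_rewrite 2 [carreDuChamp]
        simp only [Finset.mul_sum, Finset.sum_mul]
        exact Finset.sum_congr rfl fun k _ => by ring
      rw [this, mul_inv_cancel₀ hω.ne', mul_one]
    have e3 : ∑ k ∈ Finset.range n, steinKernel (p k) (X k ω) *
        (φ (halfForm a n x) * (rowForm a n k x * (carreDeriv τ a n k x * G⁻¹ ^ 2))) =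
        φ (halfForm a n x) * ((∑ k ∈ Finset.range n,
          τ k (x k) * rowForm a n k x * carreDeriv τ a n k x) * G⁻¹ ^ 2) := by
      simp only [Finset.mul_sum, Finset.sum_mul]
      exact Finset.sum_congr rfl fun k _ => by ring
    rw [e1, e2, e3]
    ring
  rw [integral_sub ((bφ.mul hc).integrable (by norm_num)) (bφ'.integrable (by norm_num)),
    integral_sub (integrable_finsetSum _ fun k _ => i1 k)
      (integrable_finsetSum _ fun k _ => i3 k), hsum, sub_self] at hdiff
  linarith

end SteinSequence

/-! ### The Fisher information distance of a quadratic form -/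

/-- Cauchy–Schwarz with weights τ_k. -/
theorem sq_sum_mul_carreDeriv_le {τ : ℕ → ℝ → ℝ} (hτ : ∀ k x, 0 ≤ τ k x) (a : ℕ → ℕ → ℝ) (n : ℕ)
    (x : ℕ → ℝ) :
    (∑ k ∈ Finset.range n, τ k (x k) * rowForm a n k x * carreDeriv τ a n k x) ^ 2 ≤
      carreDuChamp τ a n x * carreCarre τ a n x :=
  Finset.sum_sq_le_sum_mul_sum_of_sq_le_mul _ (fun k _ => mul_nonneg (hτ k _) (sq_nonneg _))
    (fun k _ => mul_nonneg (hτ k _) (sq_nonneg _)) fun k _ => le_of_eq (by ring)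

namespace SteinSequence

variable {Ω : Type*} [MeasurableSpace Ω] {P : Measure Ω} {X : ℕ → Ω → ℝ}
  {p : ℕ → ℝ → ℝ} {τ₀ b : ℝ}

/-- Γ ≥ τ₀ ∑ L_k² ≥ τ₀ l ∑ x_i², so inverse moments of Γ reduce to those of the sum of squares. -/
theorem bound_inv_carreDuChamp (h : SteinSequence P X p τ₀ b) {a : ℕ → ℕ → ℝ} {n : ℕ}
    (hn : 1 ≤ n) {l : ℝ} (hl : 0 < l) (hlow : ∀ x : ℕ → ℝ,
      l * ∑ i ∈ Finset.range n, x i ^ 2 ≤ ∑ k ∈ Finset.range n, rowForm a n k x ^ 2) {c : ℝ}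
    (hc : 0 ≤ c) (hneg : (n : ℝ≥0∞) ^ 8 * negMomentSumSq P X n ≤ ENNReal.ofReal (c ^ 8)) :
    MomentBound P 1
      (fun ω => (carreDuChamp (fun k => steinKernel (p k)) a n fun i => X i ω)⁻¹)
      (c / (τ₀ * (l * n))) := by
  have hn0 : (0 : ℝ) < n := by exact_mod_cast hn
  have hτ₀ := h.pos
  refine MomentBound.of_lintegral (p := 8) (by norm_num)
    (((measurable_carreDuChamp h.measurable_steinKernel a n).comp
      h.measurable_sequence).inv.aestronglyMeasurable) (by positivity) ?_
  have hle : ∫⁻ ω, ‖(carreDuChamp (fun k => steinKernel (p k)) a n fun i => X i ω)⁻¹‖ₑ ^ 8 ∂P ≤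
      ENNReal.ofReal ((τ₀ * l)⁻¹ ^ 8) * negMomentSumSq P X n := by
    rw [negMomentSumSq, ← lintegral_const_mul' _ _ ENNReal.ofReal_ne_top]
    refine lintegral_mono_ae ?_
    filter_upwards [(h.regular 0).ae_ne (h.meas 0) 0] with ω hω
    have hS : 0 < ∑ i ∈ Finset.range n, X i ω ^ 2 :=
      Finset.sum_pos' (fun _ _ => sq_nonneg _) ⟨0, Finset.mem_range.2 hn, by positivity⟩
    have hG : τ₀ * l * ∑ i ∈ Finset.range n, X i ω ^ 2 ≤
        carreDuChamp (fun k => steinKernel (p k)) a n fun i => X i ω := by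
      rw [mul_assoc]
      refine (mul_le_mul_of_nonneg_left (hlow fun i => X i ω) hτ₀.le).trans ?_
      rw [carreDuChamp, Finset.mul_sum]
      exact Finset.sum_le_sum fun k _ =>
        mul_le_mul_of_nonneg_right ((h.regular k).ge _) (sq_nonneg _)
    have hG0 : 0 < carreDuChamp (fun k => steinKernel (p k)) a n fun i => X i ω :=
      (by positivity : 0 < τ₀ * l * ∑ i ∈ Finset.range n, X i ω ^ 2).trans_le hG
    rw [Real.enorm_eq_ofReal_abs, abs_of_pos (inv_pos.2 hG0), ← ENNReal.ofReal_inv_of_pos hS,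
      ← ENNReal.ofReal_pow (inv_pos.2 hG0).le, ← ENNReal.ofReal_pow (inv_pos.2 hS).le,
      ← ENNReal.ofReal_mul (by positivity), ← mul_pow, ← mul_inv]
    refine ENNReal.ofReal_le_ofReal (pow_le_pow_left₀ (inv_pos.2 hG0).le ?_ 8)
    exact inv_anti₀ (by positivity) hG
  refine hle.trans ?_
  have hn8 : (n : ℝ≥0∞) ^ 8 = ENNReal.ofReal ((n : ℝ) ^ 8) := by
    rw [ENNReal.ofReal_pow hn0.le, ENNReal.ofReal_natCast]
  have hneg2 : negMomentSumSq P X n ≤ ENNReal.ofReal (c ^ 8 / n ^ 8) := by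
    rw [ENNReal.ofReal_div_of_pos (by positivity), ENNReal.le_div_iff_mul_le
      (Or.inl (by rw [← hn8]; positivity)) (Or.inl ENNReal.ofReal_ne_top), ← hn8, mul_comm]
    exact hneg
  calc _ ≤ ENNReal.ofReal ((τ₀ * l)⁻¹ ^ 8) * ENNReal.ofReal (c ^ 8 / n ^ 8) := by gcongr
    _ = _ := by
      rw [← ENNReal.ofReal_mul (by positivity)]
      congr 1
      field_simp

variable [IsProbabilityMeasure P]

/-- The two terms come from the two parts of W - σδ. The first has weight 2 + 4 + 2 = 8, with
nothing to spare; the second has 4 + 3 = 7. -/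
theorem fisherDistance_halfForm_le (h : SteinSequence P X p τ₀ b) {a : ℕ → ℕ → ℝ}
    (ha : ∀ k, a k k = 0) (hs : ∀ k u, a k u = a u k) {n : ℕ} (hn : 2 ≤ n)
    (hinj : ∀ x : ℕ → ℝ, (∃ j < n, x j ≠ 0) → ∃ k < n, rowForm a n k x ≠ 0) {g : ℝ}
    (hg : MomentBound P 1
      (fun ω => (carreDuChamp (fun k => steinKernel (p k)) a n fun i => X i ω)⁻¹) g)
    {σ : ℝ} (hσ : 0 < σ) (hσ2 : ∑ k ∈ Finset.range n, rowSq a n k = 2 * σ ^ 2) :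
    fisherDistance P (fun ω => σ⁻¹ * halfForm a n fun i => X i ω) 0 1 ≤
      ENNReal.ofReal (2 * σ⁻¹ ^ 2 * ((256 * b ^ 2 * √(2 * σ ^ 2)) ^ 2 *
        (40000 * b ^ 3 * √(fourthOrder a n)) ^ 2 * g ^ 2) +
        2 * σ ^ 2 * (10 ^ 7 * b ^ 7 * fourthOrder a n * g ^ 3)) := by
  have mX := h.measurable_sequence
  have bF := h.bound_halfForm ha n
  obtain ⟨c, hc⟩ := h.exists_bound_steinWeight ha hg
  set τ : ℕ → ℝ → ℝ := fun k => steinKernel (p k) with hτdef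
  have hibp := fisherDistance_le_of_integral_deriv_eq (P := P)
    (W := fun ω => σ⁻¹ * halfForm a n fun i => X i ω)
    (D := fun ω => σ * steinWeight τ a n fun i => X i ω)
    (((measurable_halfForm a n).comp mX).const_mul _)
    ((bF.integrable (by norm_num)).const_mul _) ((hc.integrable (by norm_num)).const_mul _)
    (by
      rintro φ φ' hφ hφ' ⟨M, hM⟩
      have hcomp : ∀ x, HasDerivAt (fun x => φ (σ⁻¹ * x)) (σ⁻¹ * φ' (σ⁻¹ * x)) x := fun x => by
        have h2 : HasDerivAt (fun x => σ⁻¹ * x) σ⁻¹ x := by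
          simpa using (hasDerivAt_id' x).const_mul σ⁻¹
        exact ((hφ (σ⁻¹ * x)).comp x h2).congr_deriv (by ring)
      have := h.integral_deriv_halfForm ha hs hn hinj hg hcomp
        (continuous_const.mul (hφ'.comp (continuous_const.mul continuous_id)))
        (M := max M (σ⁻¹ * M)) (fun x => ⟨(hM _).1.trans (le_max_left _ _), by
          rw [abs_mul, abs_of_pos (inv_pos.2 hσ)]
          exact (mul_le_mul_of_nonneg_left (hM _).2 (inv_pos.2 hσ).le).trans (le_max_right _ _)⟩)
      rw [integral_const_mul] at this
      have h3 : ∀ ω, φ (σ⁻¹ * halfForm a n fun i => X i ω) *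
          (σ * steinWeight τ a n fun i => X i ω) = σ * (φ (σ⁻¹ * halfForm a n fun i => X i ω) *
          steinWeight τ a n fun i => X i ω) := fun ω => by ring
      simp only [h3]
      rw [integral_const_mul, ← this, ← mul_assoc, mul_inv_cancel₀ hσ.ne', one_mul])
  refine hibp.trans ?_
  have b1 := h.bound_carreDuChamp_sub ha hs n
  have b2 := h.bound_carreCarre ha n
  rw [hσ2] at b1 bF
  have b3 := ((((bF.pow 2).mul (b1.pow 2)).mul (hg.pow 2)).const_mul (2 * σ⁻¹ ^ 2)).add
    (by norm_num) (((b2.mul (hg.pow 3)).mono_weight (j := 8) (by norm_num)).const_mul (2 * σ ^ 2))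
  have hle := b3.lintegral_enorm_le (by norm_num)
  rw [abs_of_pos (by positivity : 0 < 2 * σ⁻¹ ^ 2), abs_of_pos (by positivity : 0 < 2 * σ ^ 2)]
    at hle
  refine le_trans (lintegral_mono_ae ?_) hle
  filter_upwards [(h.regular 0).ae_ne (h.meas 0) 0] with ω hω
  have hpos : 0 < carreDuChamp τ a n fun i => X i ω :=
    h.carreDuChamp_pos (hinj _ ⟨0, by omega, hω⟩)
  have hcs := sq_sum_mul_carreDeriv_le (fun k x => (h.kernel_pos k x).le) a n fun i => X i ω
  rw [steinWeight, Real.enorm_eq_ofReal_abs, ← ENNReal.ofReal_pow (abs_nonneg _), sq_abs,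
    Real.enorm_eq_ofReal_abs]
  refine ENNReal.ofReal_le_ofReal (le_trans ?_ (le_abs_self _))
  change _ ^ 2 ≤ carreDuChamp τ a n _ * carreCarre τ a n _ at hcs
  set G := carreDuChamp τ a n fun i => X i ω
  set F := halfForm a n fun i => X i ω
  set C := carreCarre τ a n fun i => X i ω
  set S := ∑ k ∈ Finset.range n, τ k (X k ω) * (rowForm a n k fun i => X i ω) *
    carreDeriv τ a n k fun i => X i ω
  -- Subtracting the main term 2σF/Γ from F/σ leaves the fluctuation of Γ about its mean 2σ².
  have hid : σ⁻¹ * F - σ * (2 * F * G⁻¹ + S * G⁻¹ ^ 2) =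
      σ⁻¹ * F * ((G - 2 * σ ^ 2) * G⁻¹) - σ * S * G⁻¹ ^ 2 := by
    field_simp
    ring
  have hS : S ^ 2 * G⁻¹ ^ 4 ≤ C * G⁻¹ ^ 3 := by
    calc S ^ 2 * G⁻¹ ^ 4 ≤ G * C * G⁻¹ ^ 4 := by gcongr
      _ = C * G⁻¹ ^ 3 := by field_simp
  rw [hid]
  calc (σ⁻¹ * F * ((G - 2 * σ ^ 2) * G⁻¹) - σ * S * G⁻¹ ^ 2) ^ 2
      ≤ 2 * (σ⁻¹ * F * ((G - 2 * σ ^ 2) * G⁻¹)) ^ 2 + 2 * (σ * S * G⁻¹ ^ 2) ^ 2 := by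
        nlinarith [sq_nonneg (σ⁻¹ * F * ((G - 2 * σ ^ 2) * G⁻¹) + σ * S * G⁻¹ ^ 2)]
    _ = 2 * σ⁻¹ ^ 2 * (F ^ 2 * (G - 2 * σ ^ 2) ^ 2 * G⁻¹ ^ 2) +
        2 * σ ^ 2 * (S ^ 2 * G⁻¹ ^ 4) := by ring
    _ ≤ _ := by gcongr

end SteinSequence

/-! ### Negative moments of sums of squares -/

/-- (1 + x + x²/2)(1 - x + x²/2) = 1 + x⁴/4 ≥ 1. -/
theorem exp_neg_le_quadratic {x : ℝ} (hx : 0 ≤ x) : Real.exp (-x) ≤ 1 - x + x ^ 2 / 2 := by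
  have h1 := Real.quadratic_le_exp_of_nonneg hx
  have h2 : 0 < 1 + x + x ^ 2 / 2 := by positivity
  rw [Real.exp_neg]
  refine (inv_anti₀ h2 h1).trans ?_
  rw [inv_le_iff_one_le_mul₀ h2]
  nlinarith [sq_nonneg (x ^ 2)]

section

variable {Ω : Type*} [MeasurableSpace Ω] {P : Measure Ω} [IsProbabilityMeasure P]
  {X : ℕ → Ω → ℝ} {b : ℝ}

theorem integrable_exp_neg_mul {T : Ω → ℝ} (hT : Measurable T) (hT0 : ∀ ω, 0 ≤ T ω) {t : ℝ}
    (ht : t ≤ 0) : Integrable (fun ω => Real.exp (t * T ω)) P := by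
  refine Integrable.of_bound (hT.const_mul t).exp.aestronglyMeasurable 1 (ae_of_all _ fun ω => ?_)
  rw [Real.norm_eq_abs, abs_of_pos (Real.exp_pos _), Real.exp_le_one_iff]
  exact mul_nonpos_of_nonpos_of_nonneg ht (hT0 ω)

theorem mgf_sq_le (hX : Measurable (X 0)) (h2 : ∫ ω, X 0 ω ^ 2 ∂P = 1)
    (hb : MomentBound P 1 (X 0) b) {s : ℝ} (hs : 0 ≤ s) :
    mgf (fun ω => X 0 ω ^ 2) P (-s) ≤ Real.exp (-s + s ^ 2 * b ^ 4 / 2) := by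
  have i2 := (hb.pow 2).integrable (by norm_num)
  have i4 := (hb.pow 4).integrable (by norm_num)
  have i24 : Integrable (fun ω => 1 - s * X 0 ω ^ 2) P := (integrable_const 1).sub (i2.const_mul s)
  calc mgf (fun ω => X 0 ω ^ 2) P (-s)
      ≤ ∫ ω, (1 - s * X 0 ω ^ 2 + s ^ 2 / 2 * X 0 ω ^ 4) ∂P := by
        refine integral_mono (integrable_exp_neg_mul (hX.pow_const 2) (fun ω => sq_nonneg _)
          (by linarith)) (i24.add (i4.const_mul _)) fun ω => ?_
        have := exp_neg_le_quadratic (mul_nonneg hs (sq_nonneg (X 0 ω)))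
        simp only [neg_mul]
        refine this.trans (le_of_eq (by ring))
    _ = 1 - s + s ^ 2 / 2 * ∫ ω, X 0 ω ^ 4 ∂P := by
        rw [integral_add i24 (i4.const_mul _), integral_sub (integrable_const 1) (i2.const_mul s),
          integral_const_mul, integral_const_mul, h2]
        simp
    _ ≤ 1 - s + s ^ 2 / 2 * b ^ 4 := by
        gcongr
        exact (hb.pow 4).integral_le (by norm_num)
    _ ≤ _ := by
        have := Real.add_one_le_exp (-s + s ^ 2 * b ^ 4 / 2)
        linarith

/-- A Chernoff bound: a sum of squares with unit means rarely falls below a quarter of its mean. -/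
theorem measureReal_sum_sq_le (hX : ∀ k, Measurable (X k)) (hind : iIndepFun X P)
    (h2 : ∀ k, ∫ ω, X k ω ^ 2 ∂P = 1) (hb1 : 1 ≤ b) (hb : ∀ k, MomentBound P 1 (X k) b)
    (s : Finset ℕ) :
    P.real {ω | ∑ i ∈ s, X i ω ^ 2 ≤ (s.card : ℝ) / 4} ≤ Real.exp (-(s.card / (4 * b ^ 4))) := by
  have hb4 : 0 < b ^ 4 := by positivity
  have hsum : (fun ω => ∑ i ∈ s, X i ω ^ 2) = ∑ i ∈ s, fun ω => X i ω ^ 2 := by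
    ext ω; simp
  -- s = 1/b⁴ minimises the exponent -s + s²b⁴/2, with value -1/(2b⁴); the threshold gives back
  -- 1/(4b⁴) per variable.
  have hch := measure_le_le_exp_mul_mgf (μ := P) (X := fun ω => ∑ i ∈ s, X i ω ^ 2)
    (t := -(1 / b ^ 4)) ((s.card : ℝ) / 4) (by simpa using hb4.le)
    (integrable_exp_neg_mul (Finset.measurable_fun_sum _ fun i _ => (hX i).pow_const 2)
      (fun ω => Finset.sum_nonneg fun _ _ => sq_nonneg _) (by simpa using hb4.le))
  refine hch.trans ?_
  have hindsq : iIndepFun (fun i ω => X i ω ^ 2) P :=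
    hind.comp (fun _ x => x ^ 2) fun _ => by fun_prop
  rw [hsum, hindsq.mgf_sum (fun i => (hX i).pow_const 2)]
  have hprod : ∏ i ∈ s, mgf (fun ω => X i ω ^ 2) P (-(1 / b ^ 4)) ≤
      Real.exp (-(1 / (2 * b ^ 4))) ^ s.card := by
    rw [← Finset.prod_const]
    refine Finset.prod_le_prod (fun i _ => mgf_nonneg) fun i _ => ?_
    refine (mgf_sq_le (X := fun _ => X i) (hX i) (h2 i) (hb i) (by positivity)).trans (le_of_eq ?_)
    congr 1
    field_simp
    ring
  calc _ ≤ Real.exp (-(-(1 / b ^ 4)) * (s.card / 4)) * Real.exp (-(1 / (2 * b ^ 4))) ^ s.card := by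
        gcongr
    _ = _ := by
        rw [← Real.exp_nat_mul, ← Real.exp_add]
        congr 1
        field_simp
        ring

/-- If the m new squares sum to more than m/4, the inverse is at most 4/m. Otherwise only the first
n₀ squares are kept; they are independent of this exponentially rare event. -/
theorem negMomentSumSq_add_le (hX : ∀ k, Measurable (X k)) (hind : iIndepFun X P)
    (h2 : ∀ k, ∫ ω, X k ω ^ 2 ∂P = 1) (hb1 : 1 ≤ b) (hb : ∀ k, MomentBound P 1 (X k) b)
    (n₀ m : ℕ) (hm : 1 ≤ m) :
    negMomentSumSq P X (n₀ + m) ≤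
      negMomentSumSq P X n₀ * ENNReal.ofReal (Real.exp (-(m / (4 * b ^ 4)))) +
        ENNReal.ofReal ((4 / m) ^ 8) := by
  have hm0 : (0 : ℝ) < m := by exact_mod_cast hm
  set T : Ω → ℝ := fun ω => ∑ i ∈ Finset.Ico n₀ (n₀ + m), X i ω ^ 2 with hT
  set S : Ω → ℝ := fun ω => ∑ i ∈ Finset.range n₀, X i ω ^ 2 with hS
  have hTm : Measurable T := Finset.measurable_fun_sum _ fun i _ => (hX i).pow_const 2
  have hSm : Measurable S := Finset.measurable_fun_sum _ fun i _ => (hX i).pow_const 2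
  have hS0 : ∀ ω, 0 ≤ S ω := fun ω => Finset.sum_nonneg fun _ _ => sq_nonneg _
  have hT0 : ∀ ω, 0 ≤ T ω := fun ω => Finset.sum_nonneg fun _ _ => sq_nonneg _
  have hsplit : ∀ ω, ∑ i ∈ Finset.range (n₀ + m), X i ω ^ 2 = S ω + T ω := fun ω => by
    rw [hS, hT]
    simp only
    rw [Finset.sum_range_add_sum_Ico _ (Nat.le_add_right n₀ m)]
  have hST : IndepFun S T P := by
    refine indepFun_of_sigmaOf hX hind (S := Set.Iio n₀) (T := Set.Ici n₀)
      (Set.Iio_disjoint_Ici le_rfl)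
      (Finset.measurable_fun_sum _ fun i hi => (measurable_sigmaOf ?_).pow_const 2)
      (Finset.measurable_fun_sum _ fun i hi => (measurable_sigmaOf ?_).pow_const 2)
    · simpa using hi
    · exact (Finset.mem_Ico.1 hi).1
  set U : Set ℝ := Set.Iic ((m : ℝ) / 4) with hU
  have hpt : ∀ ω, (ENNReal.ofReal (∑ i ∈ Finset.range (n₀ + m), X i ω ^ 2))⁻¹ ^ 8 ≤
      (ENNReal.ofReal (S ω))⁻¹ ^ 8 * U.indicator 1 (T ω) + ENNReal.ofReal ((4 / m) ^ 8) := by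
    intro ω
    rw [hsplit]
    by_cases hω : T ω ∈ U
    · rw [Set.indicator_of_mem hω, Pi.one_apply, mul_one]
      refine le_add_right ?_
      gcongr
      linarith [hT0 ω]
    · have hlt : (m : ℝ) / 4 < S ω + T ω := by
        have : (m : ℝ) / 4 < T ω := by simpa [hU] using hω
        linarith [hS0 ω]
      have hpos : 0 < S ω + T ω := by have := hS0 ω; have : 0 < (m : ℝ) / 4 := by positivity
                                      linarith
      refine le_add_left ?_
      rw [← ENNReal.ofReal_inv_of_pos hpos, ← ENNReal.ofReal_pow (inv_pos.2 hpos).le]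
      refine ENNReal.ofReal_le_ofReal (pow_le_pow_left₀ (inv_pos.2 hpos).le ?_ 8)
      rw [show (4 : ℝ) / m = ((m : ℝ) / 4)⁻¹ by rw [inv_div]]
      exact inv_anti₀ (by positivity) hlt.le
  have hprob : P {ω | T ω ≤ (m : ℝ) / 4} ≤ ENNReal.ofReal (Real.exp (-(m / (4 * b ^ 4)))) := by
    have := measureReal_sum_sq_le hX hind h2 hb1 hb (Finset.Ico n₀ (n₀ + m))
    simp only [Nat.card_Ico, Nat.add_sub_cancel_left] at this
    rw [← ofReal_measureReal]
    exact ENNReal.ofReal_le_ofReal this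
  have hSinv : Measurable fun x : ℝ => (ENNReal.ofReal x)⁻¹ ^ 8 := by fun_prop
  have hUm : Measurable (U.indicator (1 : ℝ → ℝ≥0∞)) := measurable_one.indicator measurableSet_Iic
  calc negMomentSumSq P X (n₀ + m)
      ≤ ∫⁻ ω, ((ENNReal.ofReal (S ω))⁻¹ ^ 8 * U.indicator 1 (T ω) +
          ENNReal.ofReal ((4 / m) ^ 8)) ∂P := lintegral_mono hpt
    _ = ∫⁻ ω, (ENNReal.ofReal (S ω))⁻¹ ^ 8 * U.indicator 1 (T ω) ∂P +
          ENNReal.ofReal ((4 / m) ^ 8) := by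
        rw [lintegral_add_right _ measurable_const]
        simp
    _ = negMomentSumSq P X n₀ * P {ω | T ω ≤ (m : ℝ) / 4} + ENNReal.ofReal ((4 / m) ^ 8) := by
        congr 1
        have := lintegral_mul_eq_lintegral_mul_lintegral_of_indepFun
          (hSinv.comp hSm) (hUm.comp hTm) (hST.comp hSinv hUm)
        simp only [Pi.mul_apply, Function.comp_apply] at this
        rw [this]
        congr 1
        have e : (fun ω => U.indicator (1 : ℝ → ℝ≥0∞) (T ω)) =
            {ω | T ω ≤ (m : ℝ) / 4}.indicator 1 := by
          ext ω
          simp [Set.indicator, hU]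
        rw [e, lintegral_indicator_one (measurableSet_le hTm measurable_const)]
    _ ≤ _ := by gcongr

/-- The factor n⁸ is beaten by exponential decay in one term and balanced by (4/m)⁸ in the other; m
= 0 is separate. -/
theorem negMomentSup_lt_top (hX : ∀ k, Measurable (X k)) (hind : iIndepFun X P)
    (h2 : ∀ k, ∫ ω, X k ω ^ 2 ∂P = 1) (hb1 : 1 ≤ b) (hb : ∀ k, MomentBound P 1 (X k) b)
    {n₀ : ℕ} (hfin : negMomentSumSq P X n₀ < ∞) : negMomentSup P X n₀ < ∞ := by
  have hb4 : 0 < 4 * b ^ 4 := by positivity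
  set I := negMomentSumSq P X n₀ with hI
  set K : ℝ≥0∞ := (n₀ : ℝ≥0∞) ^ 8 * I + ((n₀ + 1 : ℕ) : ℝ≥0∞) ^ 8 *
    (I * ENNReal.ofReal ((Nat.factorial 8) * (4 * b ^ 4) ^ 8) + ENNReal.ofReal (4 ^ 8)) with hK
  have hKfin : K < ∞ := by
    rw [hK]
    refine ENNReal.add_lt_top.2 ⟨ENNReal.mul_lt_top (by finiteness) hfin,
      ENNReal.mul_lt_top (by finiteness) (ENNReal.add_lt_top.2
        ⟨ENNReal.mul_lt_top hfin ENNReal.ofReal_lt_top, ENNReal.ofReal_lt_top⟩)⟩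
  refine (iSup₂_le fun n hn => ?_).trans_lt hKfin
  obtain ⟨m, rfl⟩ := Nat.exists_eq_add_of_le hn
  rcases Nat.eq_zero_or_pos m with rfl | hm
  · exact le_add_right le_rfl
  refine le_add_left ?_
  have hm0 : (0 : ℝ) < m := by exact_mod_cast hm
  have hnm : ((n₀ + m : ℕ) : ℝ≥0∞) ^ 8 ≤ ((n₀ + 1 : ℕ) : ℝ≥0∞) ^ 8 * ENNReal.ofReal ((m : ℝ) ^ 8) := by
    rw [ENNReal.ofReal_pow hm0.le, ENNReal.ofReal_natCast, ← mul_pow]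
    gcongr
    have : n₀ + m ≤ (n₀ + 1) * m := by nlinarith
    exact_mod_cast this
  have hexp : (m : ℝ) ^ 8 * Real.exp (-(m / (4 * b ^ 4))) ≤ Nat.factorial 8 * (4 * b ^ 4) ^ 8 := by
    have h1 := Real.pow_div_factorial_le_exp (m / (4 * b ^ 4)) (by positivity) 8
    rw [Real.exp_neg, ← div_eq_mul_inv, div_le_iff₀ (Real.exp_pos _)]
    rw [div_le_iff₀ (by positivity), div_pow, div_le_iff₀ (by positivity)] at h1
    linarith
  calc ((n₀ + m : ℕ) : ℝ≥0∞) ^ 8 * negMomentSumSq P X (n₀ + m)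
      ≤ (((n₀ + 1 : ℕ) : ℝ≥0∞) ^ 8 * ENNReal.ofReal ((m : ℝ) ^ 8)) *
        (I * ENNReal.ofReal (Real.exp (-(m / (4 * b ^ 4)))) + ENNReal.ofReal ((4 / m) ^ 8)) := by
        gcongr
        exact negMomentSumSq_add_le hX hind h2 hb1 hb n₀ m hm
    _ = ((n₀ + 1 : ℕ) : ℝ≥0∞) ^ 8 * (I * ENNReal.ofReal ((m : ℝ) ^ 8 *
          Real.exp (-(m / (4 * b ^ 4)))) + ENNReal.ofReal ((m : ℝ) ^ 8 * (4 / m) ^ 8)) := by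
        rw [ENNReal.ofReal_mul (by positivity), ENNReal.ofReal_mul (by positivity)]
        ring
    _ ≤ _ := by
        gcongr
        refine le_of_eq ?_
        field_simp

end

/-! ### The smallest eigenvalue -/

section

variable {n : ℕ}

theorem smallest_eigenvalue_pos {M : Matrix (Fin n) (Fin n) ℝ} (hM : M.PosDef) {l : ℝ}
    (hl : Module.End.HasEigenvalue (Matrix.toLin' M) l) : 0 < l := by
  obtain ⟨v, hv⟩ := hl.exists_hasEigenvector
  have h1 : M.mulVec v = l • v := by simpa using hv.apply_eq_smul
  have h2 := hM.dotProduct_mulVec_pos hv.2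
  rw [h1, star_trivial, dotProduct_smul, smul_eq_mul] at h2
  have h3 : 0 ≤ dotProduct v v := Finset.sum_nonneg fun i _ => mul_self_nonneg _
  by_contra hneg
  push Not at hneg
  exact absurd h2 (not_lt.2 (mul_nonpos_of_nonpos_of_nonneg hneg h3))

/-- M - l·1 is positive semidefinite, because its eigenvalues shifted by l are eigenvalues of M. -/
theorem smallest_eigenvalue_mul_le {M : Matrix (Fin n) (Fin n) ℝ} (hM : M.IsHermitian) {l : ℝ}
    (hl : ∀ t, Module.End.HasEigenvalue (Matrix.toLin' M) t → l ≤ t) (x : Fin n → ℝ) :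
    l * dotProduct x x ≤ dotProduct x (M.mulVec x) := by
  have hN : (M - l • (1 : Matrix (Fin n) (Fin n) ℝ)).IsHermitian := by
    refine hM.sub ?_
    rw [Matrix.IsHermitian, Matrix.conjTranspose_smul, Matrix.conjTranspose_one, star_trivial]
  have hpsd : (M - l • (1 : Matrix (Fin n) (Fin n) ℝ)).PosSemidef := by
    rw [hN.posSemidef_iff_eigenvalues_nonneg]
    intro i
    have h1 := hN.mulVec_eigenvectorBasis i
    set v : Fin n → ℝ := ⇑(hN.eigenvectorBasis i) with hv
    have hv0 : v ≠ 0 := by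
      intro h0
      have h2 := hN.eigenvectorBasis.orthonormal.ne_zero i
      apply h2
      ext j
      exact congrFun h0 j
    rw [Matrix.sub_mulVec, Matrix.smul_mulVec, Matrix.one_mulVec] at h1
    have h3 : M.mulVec v = (hN.eigenvalues i + l) • v := by
      rw [add_smul, ← h1]; abel
    have h4 : Module.End.HasEigenvalue (Matrix.toLin' M) (hN.eigenvalues i + l) :=
      Module.End.hasEigenvalue_of_hasEigenvector (x := v)
        (Module.End.hasEigenvector_iff.2 ⟨Module.End.mem_eigenspace_iff.2 (by simpa using h3), hv0⟩)
    have := hl _ h4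
    simp only [Pi.zero_apply]
    linarith
  have h5 := hpsd.dotProduct_mulVec_nonneg x
  rw [star_trivial, Matrix.sub_mulVec, Matrix.smul_mulVec, Matrix.one_mulVec, dotProduct_sub,
    dotProduct_smul, smul_eq_mul] at h5
  linarith

/-- The extension of a matrix by zeros. -/
noncomputable def Matrix.extendZero (A : Matrix (Fin n) (Fin n) ℝ) (u v : ℕ) : ℝ :=
  if h : u < n ∧ v < n then A ⟨u, h.1⟩ ⟨v, h.2⟩ else 0

theorem Matrix.extendZero_coe (A : Matrix (Fin n) (Fin n) ℝ) (u v : Fin n) :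
    A.extendZero u v = A u v := by
  simp [Matrix.extendZero]

theorem Matrix.extendZero_self {A : Matrix (Fin n) (Fin n) ℝ} (hA : ∀ u, A u u = 0) (k : ℕ) :
    A.extendZero k k = 0 := by
  by_cases h : k < n <;> simp [Matrix.extendZero, h, hA]

theorem Matrix.IsSymm.extendZero {A : Matrix (Fin n) (Fin n) ℝ} (hA : A.IsSymm) (k u : ℕ) :
    A.extendZero k u = A.extendZero u k := by
  by_cases h : k < n ∧ u < n
  · simp only [Matrix.extendZero, h.1, h.2, and_self, dite_true]
    exact hA.apply _ _
  · rw [Matrix.extendZero, Matrix.extendZero, dif_neg h, dif_neg fun h' => h ⟨h'.2, h'.1⟩]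

theorem rowForm_extendZero (A : Matrix (Fin n) (Fin n) ℝ) (k : Fin n) (x : ℕ → ℝ) :
    rowForm A.extendZero n k x = A.mulVec (fun i => x i) k := by
  simp [rowForm, Finset.sum_range, Matrix.extendZero_coe, Matrix.mulVec, dotProduct]

theorem fourthOrder_extendZero (A : Matrix (Fin n) (Fin n) ℝ) :
    fourthOrder A.extendZero n =
      ∑ k, (∑ v, A k v ^ 2) ^ 2 + ∑ u, ∑ v, (∑ k, A k u * A k v) ^ 2 := by
  simp [fourthOrder, rowSq, gram, Finset.sum_range, Matrix.extendZero_coe]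

theorem quadForm_eq_halfForm {Ω : Type*} {A : Matrix (Fin n) (Fin n) ℝ} (hA : A.IsSymm)
    (hd : ∀ u, A u u = 0) (X : ℕ → Ω → ℝ) (ω : Ω) :
    quadForm A X ω = halfForm A.extendZero n fun i => X i ω := by
  set f : Fin n → Fin n → ℝ := fun u v => A u v * X u ω * X v ω with hf
  have h1 : quadForm A X ω = ∑ u, ∑ v, if u ≤ v then f u v else 0 := by
    simp only [quadForm]
    refine Finset.sum_congr rfl fun u _ => ?_
    rw [← Finset.sum_filter]
    refine Finset.sum_congr ?_ fun _ _ => rfl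
    ext v; simp
  have h2 : quadForm A X ω = ∑ u, ∑ v, if v ≤ u then f u v else 0 := by
    rw [h1, Finset.sum_comm]
    refine Finset.sum_congr rfl fun u _ => Finset.sum_congr rfl fun v _ => ?_
    have : f v u = f u v := by simp only [hf]; rw [hA.apply u v]; ring
    rw [this]
  have h3 : halfForm A.extendZero n (fun i => X i ω) = 1 / 2 * ∑ u, ∑ v, f u v := by
    rw [halfForm, Finset.sum_range]
    congr 1
    refine Finset.sum_congr rfl fun u _ => ?_
    rw [rowForm, Finset.sum_range, Finset.mul_sum]
    refine Finset.sum_congr rfl fun v _ => ?_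
    rw [Matrix.extendZero_coe]
    ring
  have h4 : ∑ u, ∑ v, f u v = quadForm A X ω + quadForm A X ω := by
    nth_rewrite 1 [h1]
    rw [h2, ← Finset.sum_add_distrib]
    refine Finset.sum_congr rfl fun u _ => ?_
    rw [← Finset.sum_add_distrib]
    refine Finset.sum_congr rfl fun v _ => ?_
    rcases lt_trichotomy u v with h | rfl | h
    · simp [h.le, h.not_ge]
    · simp [hf, hd]
    · simp [h.le, h.not_ge]
  rw [h3, h4]
  ring

theorem smallest_eigenvalue_mul_sum_sq_le {A : Matrix (Fin n) (Fin n) ℝ} {l : ℝ}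
    (hM : (A.transpose * A).IsHermitian)
    (hl : ∀ t, Module.End.HasEigenvalue (Matrix.toLin' (A.transpose * A)) t → l ≤ t) (x : ℕ → ℝ) :
    l * ∑ i ∈ Finset.range n, x i ^ 2 ≤
      ∑ k ∈ Finset.range n, rowForm A.extendZero n k x ^ 2 := by
  have h := smallest_eigenvalue_mul_le hM hl fun i => x i
  rw [← Matrix.mulVec_mulVec, Matrix.dotProduct_mulVec, Matrix.vecMul_transpose] at h
  simpa only [Finset.sum_range, rowForm_extendZero, sq, dotProduct] using h

/-- Testing on unit vectors bounds every squared column norm below by l. As the total is 2σ², this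
gives l n ≤ 2σ², which balances the final estimate. -/
theorem mul_card_le_sum_rowSq {a : ℕ → ℕ → ℝ} {l : ℝ} (hlow : ∀ x : ℕ → ℝ,
    l * ∑ i ∈ Finset.range n, x i ^ 2 ≤ ∑ k ∈ Finset.range n, rowForm a n k x ^ 2) :
    l * n ≤ ∑ k ∈ Finset.range n, rowSq a n k := by
  have h1 : ∀ v ∈ Finset.range n, l ≤ ∑ k ∈ Finset.range n, a k v ^ 2 := fun v hv => by
    have := hlow (Pi.single v 1)
    simpa [rowForm, Pi.single_apply, Finset.mem_range.1 hv] using this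
  have h2 := Finset.sum_le_sum h1
  rw [Finset.sum_comm] at h2
  simp only [Finset.sum_const, Finset.card_range, nsmul_eq_mul] at h2
  rw [mul_comm]
  exact h2

end

/-! ### The main bound -/

theorem MomentBound.of_eighthMoment_le {Ω : Type*} [MeasurableSpace Ω] {P : Measure Ω} {f : Ω → ℝ}
    (hf : AEStronglyMeasurable f P) {B : ℝ≥0∞} (hB : B < ∞) (h : ∫⁻ ω, ‖f ω‖ₑ ^ 8 ∂P ≤ B) :
    MomentBound P 1 f (|B.toReal| ^ (1 / 8 : ℝ)) := by
  refine MomentBound.of_lintegral (p := 8) (by norm_num) hf (by positivity) (h.trans ?_)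
  rw [abs_of_nonneg ENNReal.toReal_nonneg, ← Real.rpow_natCast, ← Real.rpow_mul
    ENNReal.toReal_nonneg]
  norm_num
  rw [ENNReal.ofReal_toReal hB.ne]

theorem steinSequence_of_eighthMomentSup_lt_top {Ω : Type*} [MeasurableSpace Ω] {P : Measure Ω}
    [IsProbabilityMeasure P] {X : ℕ → Ω → ℝ} {p : ℕ → ℝ → ℝ} {τ₀ : ℝ}
    (hX : ∀ k, Measurable (X k)) (hind : iIndepFun X P) (hmean : ∀ k, ∫ ω, X k ω ∂P = 0)
    (hvar : ∀ k, variance (X k) P = 1) (hp : ∀ k, IsDiffIntervalDensity P (X k) (p k))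
    (hβ : eighthMomentSup P X p < ∞) (hτ₀ : 0 < τ₀)
    (hτ : ∀ k, ∀ᵐ ω ∂P, τ₀ ≤ steinKernel (p k) (X k ω)) :
    SteinSequence P X p τ₀ (|(eighthMomentSup P X p).toReal| ^ (1 / 8 : ℝ)) := by
  have hb : ∀ k, MomentBound P 1 (X k) (|(eighthMomentSup P X p).toReal| ^ (1 / 8 : ℝ)) :=
    fun k => MomentBound.of_eighthMoment_le (hX k).aestronglyMeasurable hβ
      ((le_iSup (fun k => ∫⁻ ω, ‖X k ω‖ₑ ^ 8 ∂P) k).trans (le_max_left _ _))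
  have hreg : ∀ k, HasRegularSteinKernel P (X k) (p k) τ₀ := fun k =>
    (hp k).hasRegularSteinKernel (hX k) ((hb k).integrable (by norm_num)) (hmean k) hτ₀ (hτ k)
  have h2 : ∀ k, ∫ ω, X k ω ^ 2 ∂P = 1 := fun k => by
    rw [← hvar k, variance_of_integral_eq_zero (hX k).aemeasurable (hmean k)]
  refine ⟨hX, hind, hmean, h2, hreg, hτ₀, ?_, hb, fun k => ?_, fun k => ?_⟩
  -- 1 = E X₀² ≤ b², so powers of b can be merged upwards.
  · have h1 := ((hb 0).pow 2).integral_le (by norm_num)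
    rw [h2 0] at h1
    exact (one_le_sq_iff₀ (hb 0).nonneg).1 h1
  · exact MomentBound.of_eighthMoment_le
      ((hreg k).continuous_steinKernel.measurable.comp (hX k)).aestronglyMeasurable hβ
      ((le_iSup (fun k => ∫⁻ ω, ‖steinKernel (p k) (X k ω)‖ₑ ^ 8 ∂P) k).trans
        ((le_max_left _ _).trans (le_max_right _ _)))
  · exact MomentBound.of_eighthMoment_le
      ((measurable_deriv _).comp (hX k)).aestronglyMeasurable hβ
      ((le_iSup (fun k => ∫⁻ ω, ‖deriv (steinKernel (p k)) (X k ω)‖ₑ ^ 8 ∂P) k).trans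
        ((le_max_right _ _).trans (le_max_right _ _)))

/-- The constant in the bound on the Fisher information distance of a quadratic form. -/
noncomputable def quadFormConst (b c : ℝ) : ℝ :=
  1 + 838860800000000 * (b ^ 10 * c ^ 2) + 20000000 * (b ^ 7 * c ^ 3)

/-- The first term is of order W/N², the second of order σ²W/N³; N ≤ 2σ² brings the first to the
form of the second. -/
theorem fisher_bound_le_quadFormConst {b c σ W N : ℝ} (hb : 0 ≤ b) (hc : 0 ≤ c) (hσ : 0 < σ)
    (hW : 0 ≤ W) (hN : 0 < N) (hNσ : N ≤ 2 * σ ^ 2) :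
    2 * σ⁻¹ ^ 2 * ((256 * b ^ 2 * √(2 * σ ^ 2)) ^ 2 * (40000 * b ^ 3 * √W) ^ 2 * (c / N) ^ 2) +
        2 * σ ^ 2 * (10 ^ 7 * b ^ 7 * W * (c / N) ^ 3) ≤
      quadFormConst b c / σ ^ 4 * W * (σ ^ (-2 : ℤ) * N) ^ (-3 : ℤ) := by
  have e1 : 2 * σ⁻¹ ^ 2 * ((256 * b ^ 2 * √(2 * σ ^ 2)) ^ 2 * (40000 * b ^ 3 * √W) ^ 2 *
      (c / N) ^ 2) = 419430400000000 * (b ^ 10 * c ^ 2) * W / N ^ 3 * N := by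
    rw [mul_pow _ (√(2 * σ ^ 2)), mul_pow _ (√W), Real.sq_sqrt (by positivity), Real.sq_sqrt hW]
    field_simp
    ring
  have e2 : quadFormConst b c / σ ^ 4 * W * (σ ^ (-2 : ℤ) * N) ^ (-3 : ℤ) =
      W / N ^ 3 * σ ^ 2 + 838860800000000 * (b ^ 10 * c ^ 2) * W / N ^ 3 * σ ^ 2 +
      20000000 * (b ^ 7 * c ^ 3) * W / N ^ 3 * σ ^ 2 := by
    rw [quadFormConst, zpow_neg, zpow_neg]
    norm_cast
    field_simp
  have e3 : 2 * σ ^ 2 * (10 ^ 7 * b ^ 7 * W * (c / N) ^ 3) =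
      20000000 * (b ^ 7 * c ^ 3) * W / N ^ 3 * σ ^ 2 := by
    field_simp
    ring
  rw [e1, e2, e3]
  have h1 : 419430400000000 * (b ^ 10 * c ^ 2) * W / N ^ 3 * N ≤
      419430400000000 * (b ^ 10 * c ^ 2) * W / N ^ 3 * (2 * σ ^ 2) := by gcongr
  have h2 : 0 ≤ W / N ^ 3 * σ ^ 2 := by positivity
  have h3 : 419430400000000 * (b ^ 10 * c ^ 2) * W / N ^ 3 * (2 * σ ^ 2) =
    838860800000000 * (b ^ 10 * c ^ 2) * W / N ^ 3 * σ ^ 2 := by ring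
  linarith

/-- The sequence is indexed from `0`: the variables `X 0, …, X (n - 1)` are the first `n` ones. -/
theorem corollary4p1 :
    ∃ C : ℝ → ℝ → ℝ → ℝ, (∀ β τ₀ γ, 0 < C β τ₀ γ) ∧
      ∀ (Ω : Type*) [MeasurableSpace Ω] (P : Measure Ω) [IsProbabilityMeasure P]
        (X : ℕ → Ω → ℝ) (p : ℕ → ℝ → ℝ) (τ₀ : ℝ) (n₀ : ℕ),
        (∀ k, Measurable (X k)) →
        iIndepFun X P →
        (∀ k, ∫ ω, X k ω ∂P = 0) →
        (∀ k, variance (X k) P = 1) →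
        (∀ k, IsDiffIntervalDensity P (X k) (p k)) →
        eighthMomentSup P X p < ∞ →
        0 < τ₀ →
        (∀ k, ∀ᵐ ω ∂P, τ₀ ≤ steinKernel (p k) (X k ω)) →
        1 ≤ n₀ →
        negMomentSumSq P X n₀ < ∞ →
        negMomentSup P X n₀ < ∞ ∧
        ∀ (n : ℕ) (A : Matrix (Fin n) (Fin n) ℝ) (lmin σ : ℝ),
          n₀ ≤ n →
          A.IsSymm →
          (∀ u, A u u = 0) →
          (A.transpose * A).PosDef →
          IsLeast {t : ℝ | Module.End.HasEigenvalue (Matrix.toLin' (A.transpose * A)) t} lmin →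
          σ = Real.sqrt (variance (quadForm A X) P) →
          fisherDistance P (fun ω => σ⁻¹ * quadForm A X ω) 0 1 ≤
            ENNReal.ofReal
              (C (eighthMomentSup P X p).toReal τ₀ (negMomentSup P X n₀).toReal / σ ^ 4 *
                (∑ k, (∑ v, A k v ^ 2) ^ 2 + ∑ u, ∑ v, (∑ k, A k u * A k v) ^ 2) *
                (σ ^ (-2 : ℤ) * lmin * n) ^ (-3 : ℤ)) := by
  -- Eighth roots turn moments into norms. The absolute values here and the summand 1 in
  -- `quadFormConst` keep the constant positive for all real arguments.
  refine ⟨fun β τ₀ γ => quadFormConst (|β| ^ (1 / 8 : ℝ)) (|γ| ^ (1 / 8 : ℝ) / |τ₀|),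
    fun β τ₀ γ => by unfold quadFormConst; positivity, ?_⟩
  intro Ω _ P _ X p τ₀ n₀ hX hind hmean hvar hp hβ hτ₀ hτ hn₀ hneg
  have h := steinSequence_of_eighthMomentSup_lt_top hX hind hmean hvar hp hβ hτ₀ hτ
  set b := |(eighthMomentSup P X p).toReal| ^ (1 / 8 : ℝ) with hbdef
  have hγ := negMomentSup_lt_top hX hind h.secondMoment h.one_le h.bound hneg
  refine ⟨hγ, ?_⟩
  intro n A l σ hn hA hd hpd hl hσ
  have hl0 : 0 < l := smallest_eigenvalue_pos hpd hl.1
  have hlow := smallest_eigenvalue_mul_sum_sq_le (A := A) hpd.1 fun t ht => hl.2 ht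
  have ha := Matrix.extendZero_self hd
  have hs := hA.extendZero
  have hinj : ∀ x : ℕ → ℝ, (∃ j < n, x j ≠ 0) → ∃ k < n, rowForm A.extendZero n k x ≠ 0 := by
    rintro x ⟨j, hj, hxj⟩
    by_contra! hcon
    have h1 := hlow x
    have h0 : ∑ k ∈ Finset.range n, rowForm A.extendZero n k x ^ 2 = 0 :=
      Finset.sum_eq_zero fun k hk => by rw [hcon k (Finset.mem_range.1 hk)]; norm_num
    rw [h0] at h1
    have h2 : 0 < ∑ i ∈ Finset.range n, x i ^ 2 :=
      Finset.sum_pos' (fun _ _ => sq_nonneg _) ⟨j, Finset.mem_range.2 hj, by positivity⟩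
    exact absurd h1 (not_le.2 (mul_pos hl0 h2))
  -- A 1 × 1 matrix with zero diagonal is zero, which contradicts injectivity.
  have hn2 : 2 ≤ n := by
    by_contra hlt
    have hn1 : n = 1 := by omega
    subst hn1
    obtain ⟨k, hk, hne⟩ := hinj (fun _ => 1) ⟨0, by norm_num, one_ne_zero⟩
    have hk0 : k = 0 := by omega
    subst hk0
    exact hne (by simp [rowForm, ha])
  have hn0 : (0 : ℝ) < n := by positivity
  have hcard := mul_card_le_sum_rowSq hlow
  have hq : quadForm A X = fun ω => halfForm A.extendZero n fun i => X i ω :=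
    funext fun ω => quadForm_eq_halfForm hA hd X ω
  have hVar : variance (quadForm A X) P =
      1 / 2 * ∑ k ∈ Finset.range n, rowSq A.extendZero n k := by
    rw [hq, variance_of_integral_eq_zero (X := fun ω => halfForm A.extendZero n fun i => X i ω)
      ((measurable_halfForm _ n).comp h.measurable_sequence).aemeasurable
      (h.integral_halfForm hn2 ha), h.integral_halfForm_sq hn2 ha hs]
  have hsum0 : 0 < ∑ k ∈ Finset.range n, rowSq A.extendZero n k :=
    lt_of_lt_of_le (by positivity) hcard
  have hσ0 : 0 < σ := by rw [hσ, hVar]; positivity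
  have hσ2 : ∑ k ∈ Finset.range n, rowSq A.extendZero n k = 2 * σ ^ 2 := by
    rw [hσ, hVar, Real.sq_sqrt (by positivity)]
    ring
  set c := |(negMomentSup P X n₀).toReal| ^ (1 / 8 : ℝ) with hcdef
  have hc0 : 0 ≤ c := by positivity
  have hg := h.bound_inv_carreDuChamp (by omega) hl0 hlow hc0 (by
    have h1 : (n : ℝ≥0∞) ^ 8 * negMomentSumSq P X n ≤ negMomentSup P X n₀ :=
      le_iSup₂ (f := fun (n : ℕ) (_ : n₀ ≤ n) => (n : ℝ≥0∞) ^ 8 * negMomentSumSq P X n) n hn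
    refine h1.trans ?_
    rw [hcdef, abs_of_nonneg ENNReal.toReal_nonneg, ← Real.rpow_natCast, ← Real.rpow_mul
      ENNReal.toReal_nonneg]
    norm_num
    rw [ENNReal.ofReal_toReal hγ.ne])
  have hF := h.fisherDistance_halfForm_le ha hs hn2 hinj hg hσ0 hσ2
  have hqω : ∀ ω, quadForm A X ω = halfForm A.extendZero n fun i => X i ω :=
    quadForm_eq_halfForm hA hd X
  simp only [hqω]
  refine hF.trans (ENNReal.ofReal_le_ofReal ?_)
  have hfin := fisher_bound_le_quadFormConst (b := b) (c := c / τ₀) (W := fourthOrder A.extendZero n)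
    (N := l * n) (by linarith [h.one_le]) (by positivity) hσ0 (fourthOrder_nonneg _ n)
    (by positivity) (by linarith)
  rw [fourthOrder_extendZero, ← mul_assoc (σ ^ (-2 : ℤ)), div_div] at hfin
  rw [abs_of_pos hτ₀, fourthOrder_extendZero]
  exact hfin
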